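/- **Input.** A polygon means a closed region of $\mathbb{R}^2$ bounded by a simple closed polygonal curve with at least three vertices; it need not be convex, and straight angles at vertices are allowed. Let $K$ be a finite, connected, pure polygonal $2$-complex in $\mathbb{R}^2$: a finite family of polygons, together with their edges and vertices, such that the intersection of any two distinct polygons is empty, a common vertex, or a common edge, and such that the union $|K|$ of the polygons is connected. Let $\mathcal{C}^H$ be a finite family of polygons (the holes) all of whose edges are edges of $K$, let $|\mathcal{C}^H|$ be their union, and let the outside cell $\mathcal{C}^O$ be the closure of $\mathbb{R}^2\setminus(|K|\cup|\mathcal{C}^H|)$. Assume: 1. $\mathbb{R}^2\setminus(|K|\cup|\mathcal{C}^H|)$ is connected; 2. the holes are pairwise disjoint, and disjoint from $\mathcal{C}^O$; 3. a polygon of $K$ and a hole meet at most in one common edge (that is, in the empty set, a common vertex, or a common edge); 4. no two adjacent edges of a polygon of $K$ are both contained in $\mathcal{C}^O$. The vertices of $\mathcal{C}^O$ are the vertices of $K$ lying in it, and its edges are the edges of $K$ contained in it. **Euler transformation.** The complex $\hat K$ has as vertices one copy $(c,v)$ of $v$ for each $c\in K\cup\mathcal{C}^H\cup\mathcal{C}^O$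 of dimension $2$ and each vertex $v$ of $c$. Its $2$-cells are specified by their edges: * Class 1: for each polygon $f\in K$, the cell $\hat f$ with the edges $\{(f,u),(f,v)\}$, where $\{u,v\}$ runs over the edges of $f$. * Class 2: for each edge $e=\{u,v\}$ of $K$, shared by the two $2$-cells $c,c'$, the cell $\hat f_e$ with the edges $\{(c,u),(c,v)\}$, $\{(c,v),(c',v)\}$, $\{(c',u),(c',v)\}$, $\{(c,u),(c',u)\}$. * Class 3: for each vertex $v$ of $K$, consider the polygons of $K$ containing $v$, two of them being adjacent if they share an edge containing $v$. Each connected component $C$ of this adjacency relation (there is only one unless $v$ is an articulation vertex) generates a cell $\hat f_{v,C}$ with the edges $\{(c,v),(c',v)\}$, where $c\in C$ and $c'\ne c$ is a $2$-cell in $K\cup\mathcal{C}^H\cup\mathcal{C}^O$ sharing with $c$ an edge that contains $v$. Let $\hat G$ be the $1$-skeleton of $\hat K$, the graph formed by the vertices of $\hat K$ and the edges of its $2$-cells. **Mitered offsets.** For a polygon $f\in K$ and $t\ge 0$ let $f^t$ be the closed polygonal curve obtained by moving all edges of $f$ inwards in parallel by the distance $t$, each vertex moving along the bisector of the angle at it.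 A number $b_f>0$ is an admissible offset distance if $f^t$ is a simple closed polygon with as many vertices as $f$ for all $0\le t\le b_f$ (no edge shrinks to a point and the polygon is not split). **Claim.** $\hat G$ is a planar graph. More precisely, every polygon of $K$ has an admissible offset distance, and for every choice of admissible offset distances $(b_f)_{f\in K}$ the following holds. Place $(f,v)$ at the position of $v$ in $f^{b_f}$ for each polygon $f\in K$, place $(c,v)$ at $v$ for $c\in\mathcal{C}^H\cup\mathcal{C}^O$, and draw all edges of $\hat K$ as straight segments. Then * this is a crossing-free drawing of $\hat G$ in $\mathbb{R}^2$: distinct vertices are distinct points, an edge passes through no vertex but its ends, and two edges meet only in common ends; * the edges of each $2$-cell of $\hat K$ form a simple closed polygon, and the closed regions bounded by any two distinct $2$-cells of $\hat K$ meet in the empty set, a common vertex, or a common edge, so that $\hat K$ is geometrically realized in $\mathbb{R}^2$; * each Class 2 cell is a convex $4$-gon (with no straight angle). -/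

import Mathlib

open Set Filter Topology

noncomputable section

namespace EulerTransform

/-! The Euclidean plane is `ℂ`. Polygons are Mathlib's `Polygon ℂ n`: a cyclic sequence of `n`
vertices, the `i`-th edge joining vertex `i` to vertex `finRotate n i`. -/

/-- The straight segment spanned by an unordered pair, for a placement `φ` of its members. -/
def seg {V : Type*} (φ : V → ℂ) : Sym2 V → Set ℂ :=
  Sym2.lift ⟨fun x y => segment ℝ (φ x) (φ y), fun x y => segment_symm ℝ (φ x) (φ y)⟩

/-- A closed curve together with what it encloses: the points of `Γ` and the points that lie in a
bounded connected component of the complement of `Γ`. -/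
def fill (Γ : Set ℂ) : Set ℂ :=
  Γ ∪ {x | x ∉ Γ ∧ Bornology.IsBounded (connectedComponentIn Γᶜ x)}

/-- A simple closed polygon: consecutive edges meet exactly in their common vertex, all other
pairs of distinct edges are disjoint. (Straight angles are allowed.) -/
structure IsSimple {n : ℕ} (P : Polygon ℂ n) : Prop where
  three_le : 3 ≤ n
  injective : Function.Injective P.vertices
  adjacent : ∀ i, P.edgeSet ℝ i ∩ P.edgeSet ℝ (finRotate n i) = {P (finRotate n i)}
  disjoint : ∀ i j, i ≠ j → j ≠ finRotate n i → i ≠ finRotate n j →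
    Disjoint (P.edgeSet ℝ i) (P.edgeSet ℝ j)

/-- The cyclic sequence of edges, as unordered pairs, of a cyclic sequence of vertices. -/
def cycleEdges {V : Type*} {n : ℕ} (q : Fin n → V) : Set (Sym2 V) :=
  {e | ∃ i, e = s(q i, q (finRotate n i))}

/-- The polygon is traversed counterclockwise: the enclosed region lies to the left of each edge. -/
def IsCounterclockwise {n : ℕ} (P : Polygon ℂ n) : Prop :=
  ∀ i, ∀ᶠ ε : ℝ in 𝓝[>] (0 : ℝ),
    midpoint ℝ (P i) (P (finRotate n i)) + (ε : ℂ) * (Complex.I * (P (finRotate n i) - P i))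
      ∈ fill (P.boundary ℝ)

/-- The unit normal of the `i`-th edge pointing to the left (inwards, if counterclockwise). -/
def normal {n : ℕ} (P : Polygon ℂ n) (i : Fin n) : ℂ :=
  Complex.I * (P (finRotate n i) - P i) / (‖P (finRotate n i) - P i‖ : ℂ)

/-- The polygon reached at time `t` when every edge moves inwards in parallel with unit speed: the
`i`-th vertex moves along the bisector of the angle at that vertex, to the point whose signed
distance from both lines carrying the edges at that vertex is `t`. -/
def offset {n : ℕ} (P : Polygon ℂ n) (t : ℝ) : Polygon ℂ n where
  vertices i :=
    P i + ((t / (1 + inner ℝ (normal P ((finRotate n).symm i)) (normal P i)) : ℝ) : ℂ) *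
      (normal P ((finRotate n).symm i) + normal P i)

/-- The mitered offset of `P` at distance `b > 0` creates no combinatorial or topological change:
up to distance `b` no edge shrinks to a point and the moving boundary does not run into itself. -/
def IsMiteredOffset {n : ℕ} (P : Polygon ℂ n) (b : ℝ) : Prop :=
  0 < b ∧ ∀ t ∈ Icc (0 : ℝ) b, IsSimple (offset P t)

/-- A polygonal 2-cell, not necessarily convex, given by the counterclockwise sequence of its
vertices. -/
structure PolygonCell where
  n : ℕ
  bd : Polygon ℂ n
  simple : IsSimple bd
  ccw : IsCounterclockwise bd

namespace PolygonCell

/-- The closed 2-cell as a point set. -/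
def region (P : PolygonCell) : Set ℂ := fill (P.bd.boundary ℝ)

def verts (P : PolygonCell) : Set ℂ := range P.bd.vertices

def edges (P : PolygonCell) : Set (Sym2 ℂ) := cycleEdges P.bd.vertices

/-- The intersection of the two cells is empty, a common vertex, or a common edge. -/
def MeetInFace (P Q : PolygonCell) : Prop :=
  P.region ∩ Q.region = ∅ ∨
  (∃ v ∈ P.verts ∩ Q.verts, P.region ∩ Q.region = {v}) ∨
  (∃ e ∈ P.edges ∩ Q.edges, P.region ∩ Q.region = seg id e)

end PolygonCell

/-- The polygons of a pure 2-complex in the plane (its edges and vertices are those of its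
polygons) and the polygons that fill its holes. -/
structure Mesh (F H : Type*) where
  poly : F → PolygonCell
  hole : H → PolygonCell

/-- The 2-cells of the plane: polygons of the complex, holes, and the outside cell. -/
inductive Cell (F H : Type*)
  | poly (f : F)
  | hole (h : H)
  | outside

namespace Mesh

variable {F H : Type*} (K : Mesh F H)

/-- The underlying space of the complex. -/
def space : Set ℂ := ⋃ f, (K.poly f).region

/-- The underlying space of the holes. -/
def holeSpace : Set ℂ := ⋃ h, (K.hole h).region

/-- The outside cell: the closure of what is covered neither by the complex nor by the holes. -/
def outside : Set ℂ := closure (K.space ∪ K.holeSpace)ᶜ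

def verts : Set ℂ := ⋃ f, (K.poly f).verts

def edges : Set (Sym2 ℂ) := ⋃ f, (K.poly f).edges

/-- The edges of the cells; those of the outside cell are the edges of `K` contained in it. -/
def cellEdges : Cell F H → Set (Sym2 ℂ)
  | .poly f => (K.poly f).edges
  | .hole h => (K.hole h).edges
  | .outside => {e ∈ K.edges | seg id e ⊆ K.outside}

/-- The standing assumptions on the complex, the holes and the outside cell. -/
structure IsAdmissible : Prop where
  /-- polyhedral complex -/
  meet : ∀ f g, f ≠ g → (K.poly f).MeetInFace (K.poly g)
  /-- the complex is connected -/
  connected : IsConnected K.space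
  /-- the outside is a single cell -/
  outside_connected : IsConnected (K.space ∪ K.holeSpace)ᶜ
  /-- the boundary edges of the holes are present in the complex -/
  hole_edges : ∀ h, (K.hole h).edges ⊆ K.edges
  /-- holes are pairwise disjoint, and disjoint from the outside cell -/
  hole_disjoint : ∀ h h', h ≠ h' → Disjoint (K.hole h).region (K.hole h').region
  hole_outside : ∀ h, Disjoint (K.hole h).region K.outside
  /-- a polygon and a hole meet in at most one edge -/
  meet_hole : ∀ f h, (K.poly f).MeetInFace (K.hole h)
  /-- no two adjacent edges of a polygon are shared with the outside cell -/
  outside_edges : ∀ f i,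
    ¬ ((K.poly f).bd.edgeSet ℝ i ⊆ K.outside ∧
      (K.poly f).bd.edgeSet ℝ (finRotate _ i) ⊆ K.outside)

/-! ### The Euler transformation as an abstract complex -/

/-- Vertices of the transformed complex: one copy of each vertex of each 2-cell. -/
inductive HatVertex
  | poly (f : F) (i : Fin (K.poly f).n)
  | hole (h : H) (i : Fin (K.hole h).n)
  | outside (v : ℂ) (hv : v ∈ K.verts ∩ K.outside)

variable {K}

/-- The 2-cell to whose duplicate the vertex belongs. -/
def HatVertex.cell : K.HatVertex → Cell F H
  | .poly f _ => .poly f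
  | .hole h _ => .hole h
  | .outside _ _ => .outside

/-- The vertex of `K` of which it is a copy. -/
def HatVertex.base : K.HatVertex → ℂ
  | .poly f i => (K.poly f).bd i
  | .hole h i => (K.hole h).bd i
  | .outside v _ => v

variable (K)

/-- The copies of edge `e` in the duplicate of the cell `c`. -/
def copyEdges (c : Cell F H) (e : Sym2 ℂ) : Set (Sym2 K.HatVertex) :=
  {E | e ∈ K.cellEdges c ∧ ∃ x y : K.HatVertex, x.cell = c ∧ y.cell = c ∧
    s(x.base, y.base) = e ∧ E = s(x, y)}

/-- The new edges across `e` at its end `v`: they join the copies of `v` in the two cells that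
share the edge `e`. -/
def newEdges (e : Sym2 ℂ) (v : ℂ) : Set (Sym2 K.HatVertex) :=
  {E | v ∈ e ∧ ∃ x y : K.HatVertex, x.base = v ∧ y.base = v ∧ x.cell ≠ y.cell ∧
    e ∈ K.cellEdges x.cell ∧ e ∈ K.cellEdges y.cell ∧ E = s(x, y)}

/-- The polygons of `K` at the vertex `v`, adjacent when they share an edge at `v`. Its components
are the parts into which the outside cell separates these polygons: there is just one, unless `v`
is an articulation vertex. -/
def starGraph (v : ℂ) : SimpleGraph {f : F // v ∈ (K.poly f).verts} where
  Adj f g := f ≠ g ∧ ∃ e ∈ (K.poly f).edges ∩ (K.poly g).edges, v ∈ e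
  symm := ⟨fun _ _ h => ⟨h.1.symm, by
    obtain ⟨e, he, hv⟩ := h.2
    exact ⟨e, he.symm, hv⟩⟩⟩
  loopless := ⟨fun _ h => h.1 rfl⟩

/-- The 2-cells of the transformed complex: Class 1 from the polygons, Class 2 from the edges and
Class 3 from the vertices of `K` (an articulation vertex generates one cell for each of the parts
of `K` joined at it). -/
inductive HatCell
  | ofPoly (f : F)
  | ofEdge (e : Sym2 ℂ) (he : e ∈ K.edges)
  | ofVertex (v : ℂ) (C : (K.starGraph v).ConnectedComponent)

variable {K}

/-- The facets (edges) of the 2-cells of the transformed complex. -/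
def HatCell.facets : K.HatCell → Set (Sym2 K.HatVertex)
  | .ofPoly f => ⋃ e, K.copyEdges (.poly f) e
  | .ofEdge e _ => (⋃ c, K.copyEdges c e) ∪ ⋃ v, K.newEdges e v
  | .ofVertex v C => {E | ∃ e, E ∈ K.newEdges e v ∧
      ∃ x ∈ E, ∃ f ∈ C.supp, x.cell = Cell.poly f.1}

variable (K)

/-- The 1-skeleton of the transformed complex. -/
def hatGraph : SimpleGraph K.HatVertex :=
  SimpleGraph.fromEdgeSet (⋃ c : K.HatCell, c.facets)

/-! ### Its geometric realization -/

/-- Offset distances, chosen for each polygon, such that the mitered offsets create no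
combinatorial or topological change. -/
def IsOffsetChoice (b : F → ℝ) : Prop :=
  ∀ f, IsMiteredOffset (K.poly f).bd (b f)

/-- Placement of the vertices: polygons of `K` are offset, holes and outside are left unchanged. -/
def place (b : F → ℝ) : K.HatVertex → ℂ
  | .poly f i => offset (K.poly f).bd (b f) i
  | .hole h i => (K.hole h).bd i
  | .outside v _ => v

variable {K}

/-- The closed point set of a 2-cell whose facets are drawn as straight segments. -/
def HatCell.region (c : K.HatCell) (φ : K.HatVertex → ℂ) : Set ℂ :=
  fill (⋃ e ∈ c.facets, seg φ e)

/-- The facets of the cell, drawn as straight segments, form the simple closed polygon with the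
`n` successive vertices `q`. -/
def HatCell.IsDrawnAs (c : K.HatCell) (φ : K.HatVertex → ℂ) {n : ℕ}
    (q : Fin n → K.HatVertex) : Prop :=
  c.facets = cycleEdges q ∧ IsSimple (⟨fun i => φ (q i)⟩ : Polygon ℂ n)

/-- The two cells meet at most in a common vertex or a common edge. -/
def HatCell.MeetInFace (c d : K.HatCell) (φ : K.HatVertex → ℂ) : Prop :=
  c.region φ ∩ d.region φ = ∅ ∨
  (∃ x, (∃ E ∈ c.facets, x ∈ E) ∧ (∃ E ∈ d.facets, x ∈ E) ∧
    c.region φ ∩ d.region φ = {φ x}) ∨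
  (∃ E ∈ c.facets ∩ d.facets, c.region φ ∩ d.region φ = seg φ E)

variable (K)

/-- A placement of the vertices realizes the transformed complex in the plane with straight edges:
each 2-cell is a simple closed polygon, and any two meet at most in a vertex or an edge. -/
structure IsRealization (φ : K.HatVertex → ℂ) : Prop where
  simple : ∀ c : K.HatCell, ∃ (n : ℕ) (q : Fin n → K.HatVertex), c.IsDrawnAs φ q
  meet : ∀ c d : K.HatCell, c ≠ d → c.MeetInFace d φ

end Mesh

/-! ### Planar graphs -/

/-- A drawing of a graph in the plane without crossings: vertices are distinct points, edges are
simple arcs between their ends, an edge passes through no vertex but its ends, and two edges meet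
only in common ends. -/
structure IsPlaneDrawing {V : Type*} (G : SimpleGraph V) (φ : V → ℂ) (arc : Sym2 V → Set ℂ) :
    Prop where
  injective : Function.Injective φ
  isArc : ∀ u v, G.Adj u v → ∃ γ : unitInterval → ℂ, Continuous γ ∧ Function.Injective γ ∧
    γ 0 = φ u ∧ γ 1 = φ v ∧ range γ = arc s(u, v)
  vertex : ∀ e ∈ G.edgeSet, ∀ w, φ w ∈ arc e → w ∈ e
  crossing : ∀ e ∈ G.edgeSet, ∀ e' ∈ G.edgeSet, e ≠ e' → ∀ z ∈ arc e ∩ arc e',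
    ∃ w, w ∈ e ∧ w ∈ e' ∧ z = φ w

def IsPlanar {V : Type*} (G : SimpleGraph V) : Prop :=
  ∃ φ arc, IsPlaneDrawing G φ arc

end EulerTransform

end

/-! Everything is read off from the motion of the mitered offset. While time runs from `0` to `b f`,
each edge of the polygon `f` sweeps a strip bounded by the bisectors at its two ends. Winding
numbers, followed along the motion, show that a point passed by the moving curve lies outside it
from then on (`argSum_offset_after`). Hence strips of distinct edges of `f` meet only along
bisectors (`strip_inter`), every strip lies in `f`, and a strip meets the region `core` left at time
`b f` only in the final position of its edge (`strip_inter_fill`). As the polygons of `K` meet in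
faces, cores avoid all other polygons, and strips of distinct polygons belong to a common edge or
meet only at common ends of their edges (`strip_inter_strip`).

A new edge joins the copies of an end `v` of an edge `e` in the two cells at `e`. Let `κ` and `κ'`
be the cotangents of half the angles at `v` in the two polygons at `e` (`slope`), and `b`, `b'`
their offset distances. In coordinates along `e` with origin `v`, the copies are `(b κ, b)` and `(b'
κ', -b')`, so the new edge crosses the line of `e` at distance `b b' (κ + κ') / (b + b')` from `v`;
if one cell is a hole or the outside, then `b' = 0` and the crossing is `v` itself. The two angles
add up to less than the full angle, that is, `κ + κ' > 0` (`MeetInFace.slope_add_pos`), and no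
offset edge has shrunk to a point, so the two crossings on `e` come in the right order
(`cut_add_lt`).

The new edges thus cut each strip into a middle piece and two corners. The Class 1 cell is the core,
the Class 2 cell is a trapezoid lying in the middle pieces on the two sides of `e`, and the Class 3
cell lies in the corners at `v` of the polygons of one part of the star. The corners are star-shaped
about `v`, so containment of the boundary suffices (`fill_subset_of_starConvex`). Intersections of
cells are thereby reduced to intersections of pieces, which are given by linear inequalities. The
assumptions on adjacent outer edges and on holes ensure that at each vertex of a polygon one of its
two edges is shared with another polygon (`isPoly_across`); its cut is positive, and so neighbouring
middle pieces touch only at the offset vertex.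

Every edge of the graph is a side of a Class 2 trapezoid, so the drawing is free of crossings
because the trapezoids meet only at placed vertices. A walk around `v` shows that the edges of a
Class 3 cell form one cycle (`exists_cycle`), which is then a simple polygon because the drawing has
no crossings. -/

open Set Filter Topology
noncomputable section
namespace EulerTransform

/-! ### The winding number of a polygon -/

/-- No topology on the target is needed: later `f` is a winding number, but also a proposition
depending on time or the membership of a point in a set. -/
theorem eq_of_isPreconnected {X α : Type*} [TopologicalSpace X] {S : Set X}
    (hS : IsPreconnected S) {f : X → α} (hf : ∀ x ∈ S, ∀ᶠ y in 𝓝[S] x, f y = f x) {x y : X}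
    (hx : x ∈ S) (hy : y ∈ S) : f x = f y := by
  refine hS.induction₂' (fun a b => f a = f b) (fun a ha => ?_) (fun a b c _ _ _ => Eq.trans) hx hy
  filter_upwards [hf a ha] with b hb using ⟨hb.symm, hb⟩

/-- The total angle under which the polygon is seen from a point: `2 * π` times the winding number,
off the polygon. -/
def argSum {n : ℕ} (P : Polygon ℂ n) (x : ℂ) : ℝ :=
  ∑ i, Complex.arg ((P (finRotate n i) - x) / (P i - x))

theorem edgeSet_eq_segment {n : ℕ} (P : Polygon ℂ n) (i : Fin n) :
    P.edgeSet ℝ i = segment ℝ (P i) (P (finRotate n i)) :=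
  affineSegment_eq_segment ℝ _ _

theorem mem_boundary_iff {n : ℕ} {P : Polygon ℂ n} {x : ℂ} :
    x ∈ P.boundary ℝ ↔ ∃ i, x ∈ segment ℝ (P i) (P (finRotate n i)) := by
  simp [Polygon.boundary, edgeSet_eq_segment]

theorem left_mem_boundary {n : ℕ} (P : Polygon ℂ n) (i : Fin n) : P i ∈ P.boundary ℝ :=
  mem_boundary_iff.2 ⟨i, left_mem_segment ℝ _ _⟩

theorem isCompact_boundary {n : ℕ} (P : Polygon ℂ n) : IsCompact (P.boundary ℝ) := by
  refine isCompact_iUnion fun i => ?_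
  rw [edgeSet_eq_segment, segment_eq_image]
  exact isCompact_Icc.image (by fun_prop)

/-- If the quotient were a real `r ≤ 0`, then `b - x` and `a - x` would point in opposite directions
and `x` would lie between `a` and `b`. So each summand of `argSum` is continuous off its edge. -/
theorem div_mem_slitPlane {a b x : ℂ} (h : x ∉ segment ℝ a b) :
    (b - x) / (a - x) ∈ Complex.slitPlane := by
  have ha : a - x ≠ 0 := fun h0 => h (by
    rw [← sub_eq_zero.1 h0]; exact left_mem_segment ℝ _ _)
  by_contra hr
  rw [Complex.mem_slitPlane_iff, not_or, not_lt, not_not] at hr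
  set r := (b - x) / (a - x) with hrdef
  have hrr : r = ((r.re : ℝ) : ℂ) := Complex.ext (by simp) (by simp [hr.2])
  have hb : b - x = (r.re : ℂ) * (a - x) := by rw [← hrr, hrdef]; field_simp
  refine h ⟨-r.re / (1 - r.re), 1 / (1 - r.re), ?_, ?_, ?_, ?_⟩
  · exact div_nonneg (by linarith [hr.1]) (by linarith [hr.1])
  · exact div_nonneg (by norm_num) (by linarith [hr.1])
  · field_simp [show (1 - r.re) ≠ 0 by linarith [hr.1]]; ring
  · have h1 : ((1 : ℂ) - (r.re : ℂ)) ≠ 0 := by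
      have : (1 - r.re) ≠ 0 := by linarith [hr.1]
      exact_mod_cast this
    have hb' : b = x + (r.re : ℂ) * (a - x) := by linear_combination hb
    rw [hb']
    simp only [Complex.real_smul]
    push_cast
    field_simp
    ring

theorem exp_sum_arg {ι : Type*} [Fintype ι] (r : ι → ℂ) (hr : ∀ i, r i ≠ 0) :
    Complex.exp ((∑ i, Complex.arg (r i) : ℝ) * Complex.I) = (∏ i, r i) / (‖∏ i, r i‖ : ℝ) := by
  push_cast
  rw [Finset.sum_mul, Complex.exp_sum, norm_prod]
  push_cast
  rw [← Finset.prod_div_distrib]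
  refine Finset.prod_congr rfl fun i _ => ?_
  have := Complex.norm_mul_exp_arg_mul_I (r i)
  have h0 : (‖r i‖ : ℂ) ≠ 0 := by simpa using hr i
  rw [eq_div_iff h0, mul_comm, this]

theorem prod_div_finRotate {n : ℕ} {P : Polygon ℂ n} {x : ℂ} (h : ∀ i, P i ≠ x) :
    ∏ i, (P (finRotate n i) - x) / (P i - x) = 1 := by
  rw [Finset.prod_div_distrib, Equiv.prod_comp (finRotate n) (fun i => P i - x)]
  exact div_self (Finset.prod_ne_zero_iff.2 fun i _ => sub_ne_zero.2 (h i))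

/-- The quotients telescope to the product `1` around the cycle, so the sum of their arguments is
the argument of `1`. -/
theorem exists_argSum_eq {n : ℕ} {P : Polygon ℂ n} {x : ℂ} (h : ∀ i, P i ≠ x) :
    ∃ k : ℤ, argSum P x = 2 * Real.pi * k := by
  have := exp_sum_arg (fun i => (P (finRotate n i) - x) / (P i - x))
    (fun i => div_ne_zero (sub_ne_zero.2 (h _)) (sub_ne_zero.2 (h _)))
  rw [prod_div_finRotate h] at this
  simp only [norm_one, Complex.ofReal_one, div_one] at this
  obtain ⟨k, hk⟩ := Complex.exp_eq_one_iff.1 this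
  refine ⟨k, ?_⟩
  have h2 : ((∑ i, Complex.arg ((P (finRotate n i) - x) / (P i - x)) : ℝ) : ℂ)
      = ((2 * Real.pi * k : ℝ) : ℂ) := by
    apply mul_right_cancel₀ Complex.I_ne_zero
    rw [hk]; push_cast; ring
  exact_mod_cast h2

/-- Distinct multiples of `2 * π` differ by more than `1`. This turns continuity of `argSum` into
local constancy. -/
theorem int_eq_of_abs_lt {a b : ℝ} {k l : ℤ} (ha : a = 2 * Real.pi * k)
    (hb : b = 2 * Real.pi * l) (h : |a - b| < 1) : a = b := by
  have hpi := Real.pi_gt_three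
  have : k = l := by
    by_contra hne
    have h1 : (1 : ℝ) ≤ |((k - l : ℤ) : ℝ)| := by
      have := Int.one_le_abs (sub_ne_zero.2 hne)
      exact_mod_cast this
    have h2 : |a - b| = 2 * Real.pi * |((k - l : ℤ) : ℝ)| := by
      rw [ha, hb, ← mul_sub, abs_mul, abs_of_pos (by positivity)]; push_cast; ring
    nlinarith
  rw [ha, hb, this]

section Family

variable {X : Type*} [TopologicalSpace X] {n : ℕ} {V : X → Polygon ℂ n} {y : X → ℂ} {s₀ : X}

theorem continuousAt_argSum (hV : ∀ i, ContinuousAt (fun s => V s i) s₀) (hy : ContinuousAt y s₀)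
    (h : y s₀ ∉ (V s₀).boundary ℝ) : ContinuousAt (fun s => argSum (V s) (y s)) s₀ := by
  unfold argSum
  refine tendsto_finsetSum _ fun i _ => ?_
  have hi : y s₀ ∉ segment ℝ (V s₀ i) (V s₀ (finRotate n i)) := fun hi =>
    h (mem_boundary_iff.2 ⟨i, hi⟩)
  refine (Complex.continuousAt_arg (div_mem_slitPlane hi)).comp
    (f := fun s => (V s (finRotate n i) - y s) / (V s i - y s)) ?_
  refine ((hV _).sub hy).div ((hV _).sub hy) (sub_ne_zero.2 fun h0 => hi ?_)
  rw [← h0]; exact left_mem_segment ℝ _ _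

/-- Polygon and point both depend on the parameter, so that the parameter may be the time of the
moving offset as well as a point of the plane. -/
theorem argSum_eventually_eq (hV : ∀ i, ContinuousAt (fun s => V s i) s₀)
    (hy : ContinuousAt y s₀) (h : y s₀ ∉ (V s₀).boundary ℝ) :
    ∀ᶠ s in 𝓝 s₀, argSum (V s) (y s) = argSum (V s₀) (y s₀) := by
  have hne : ∀ i, V s₀ i ≠ y s₀ := fun i h0 => h (h0 ▸ left_mem_boundary _ i)
  have h1 : ∀ᶠ s in 𝓝 s₀, ∀ i, V s i ≠ y s :=
    eventually_all.2 fun i => (((hV i).sub hy).eventually_ne (sub_ne_zero.2 (hne i))).mono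
      fun _ => sub_ne_zero.1
  have h2 := (continuousAt_argSum hV hy h).eventually (Metric.ball_mem_nhds _ one_pos)
  obtain ⟨l, hl⟩ := exists_argSum_eq hne
  filter_upwards [h1, h2] with s hs1 hs2
  obtain ⟨k, hk⟩ := exists_argSum_eq hs1
  exact int_eq_of_abs_lt hk hl (by rwa [Real.dist_eq] at hs2)

/-- Crossing an edge from its right to its left increases the winding number by one. -/
theorem argSum_jump (hV : ∀ i, ContinuousAt (fun s => V s i) s₀) (hy : ContinuousAt y s₀)
    (i : Fin n) (hne : V s₀ i ≠ y s₀) (hne' : V s₀ (finRotate n i) ≠ y s₀)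
    (hi : y s₀ ∈ segment ℝ (V s₀ i) (V s₀ (finRotate n i)))
    (h : ∀ j, j ≠ i → y s₀ ∉ segment ℝ (V s₀ j) (V s₀ (finRotate n j))) :
    ∃ k : ℤ, ∀ᶠ s in 𝓝 s₀,
      (0 < ((V s (finRotate n i) - y s) / (V s i - y s)).im →
        argSum (V s) (y s) = 2 * Real.pi * (k + 1 : ℤ)) ∧
      (((V s (finRotate n i) - y s) / (V s i - y s)).im < 0 →
        argSum (V s) (y s) = 2 * Real.pi * k) := by
  classical
  have hne0 : ∀ j, V s₀ j ≠ y s₀ := by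
    intro j h0
    by_cases hj : j = i
    · exact hne (hj ▸ h0)
    · exact h j hj (h0 ▸ left_mem_segment ℝ _ _)
  have h1 : ∀ᶠ s in 𝓝 s₀, ∀ i, V s i ≠ y s :=
    eventually_all.2 fun i => (((hV i).sub hy).eventually_ne (sub_ne_zero.2 (hne0 i))).mono
      fun _ => sub_ne_zero.1
  let r : X → Fin n → ℂ := fun s j => (V s (finRotate n j) - y s) / (V s j - y s)
  have hrc : ∀ j, ContinuousAt (fun s => r s j) s₀ := fun j =>
    ((hV _).sub hy).div ((hV _).sub hy) (sub_ne_zero.2 (hne0 j))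
  -- At `s₀` the `i`-th quotient is a negative real, on the branch cut of the argument. Negating
  -- this one factor moves it off the cut, so the sum of the arguments of `ρ` is continuous at `s₀`.
  let ρ : X → Fin n → ℂ := fun s j => if j = i then - r s j else r s j
  have hr0 : ∃ c : ℝ, 0 < c ∧ r s₀ i = -(c : ℂ) := by
    obtain ⟨a, b, ha, hb, hab, hx⟩ := hi
    have hb0 : 0 < b := by
      rcases hb.lt_or_eq with h | h
      · exact h
      · exfalso; apply hne; rw [← hx, ← h]; have : a = 1 := by linarith
        simp [this]
    have ha0 : 0 < a := by
      rcases ha.lt_or_eq with h | h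
      · exact h
      · exfalso; apply hne'; rw [← hx, ← h]; have : b = 1 := by linarith
        simp [this]
    refine ⟨a / b, by positivity, ?_⟩
    have hb1 : (b : ℂ) ≠ 0 := by exact_mod_cast hb0.ne'
    have hac : (a : ℂ) = 1 - b := by rw [eq_sub_iff_add_eq]; exact_mod_cast hab
    show (V s₀ (finRotate n i) - y s₀) / (V s₀ i - y s₀) = _
    rw [div_eq_iff (sub_ne_zero.2 (hne0 i))]
    push_cast
    field_simp
    rw [← hx, Complex.real_smul, Complex.real_smul, hac]
    ring
  obtain ⟨c, hc, hrc0⟩ := hr0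
  have hρs : ∀ j, ρ s₀ j ∈ Complex.slitPlane := by
    intro j
    by_cases hj : j = i
    · subst hj
      simp only [ρ, if_true, hrc0, neg_neg]
      exact Complex.ofReal_mem_slitPlane.2 hc
    · simp only [ρ, if_neg hj]
      exact div_mem_slitPlane (h j hj)
  have hρc : ∀ j, ContinuousAt (fun s => ρ s j) s₀ := by
    intro j
    by_cases hj : j = i
    · simp only [ρ, if_pos hj]
      exact (hrc j).neg
    · simpa only [ρ, if_neg hj] using hrc j
  have hC : ContinuousAt (fun s => ∑ j, Complex.arg (ρ s j)) s₀ :=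
    tendsto_finsetSum _ fun j _ =>
      (Complex.continuousAt_arg (hρs j)).comp (f := fun s => ρ s j) (hρc j)
  -- One sign was changed, so the product is `-1` and the continuous sum is an odd multiple of `π`
  -- at `s₀`.
  have hprod : ∏ j, ρ s₀ j = -1 := by
    have hp : ∏ j, r s₀ j = 1 := prod_div_finRotate hne0
    rw [← Finset.mul_prod_erase _ _ (Finset.mem_univ i)] at hp ⊢
    have : ∏ j ∈ Finset.univ.erase i, ρ s₀ j = ∏ j ∈ Finset.univ.erase i, r s₀ j :=
      Finset.prod_congr rfl fun j hj => if_neg (Finset.ne_of_mem_erase hj)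
    rw [this]
    simp only [ρ, if_true]
    linear_combination -hp
  have hexp := exp_sum_arg (ρ s₀) (fun j => Complex.slitPlane_ne_zero (hρs j))
  rw [hprod] at hexp
  have hC0 : ∃ k : ℤ, ∑ j, Complex.arg (ρ s₀ j) = 2 * Real.pi * k + Real.pi := by
    have : Complex.exp ((∑ j, Complex.arg (ρ s₀ j) : ℝ) * Complex.I) =
        Complex.exp (Real.pi * Complex.I) := by
      rw [hexp, Complex.exp_pi_mul_I]; simp
    obtain ⟨k, hk⟩ := Complex.exp_eq_exp_iff_exists_int.1 this
    refine ⟨k, ?_⟩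
    have h2 : ((∑ j, Complex.arg (ρ s₀ j) : ℝ) : ℂ) = ((2 * Real.pi * k + Real.pi : ℝ) : ℂ) := by
      apply mul_right_cancel₀ Complex.I_ne_zero
      rw [hk]; push_cast; ring
    exact_mod_cast h2
  obtain ⟨k, hk⟩ := hC0
  refine ⟨k, ?_⟩
  -- The correction is `arg r - arg (-r)`, which is `π` or `-π` according to the sign of the
  -- imaginary part of `r`; this is the jump.
  have hsum : ∀ s, argSum (V s) (y s) =
      ∑ j, Complex.arg (ρ s j) + (Complex.arg (r s i) - Complex.arg (- r s i)) := by
    intro s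
    unfold argSum
    rw [← Finset.add_sum_erase _ _ (Finset.mem_univ i),
      ← Finset.add_sum_erase _ (fun j => Complex.arg (ρ s j)) (Finset.mem_univ i)]
    have : ∑ j ∈ Finset.univ.erase i, Complex.arg (ρ s j) =
        ∑ j ∈ Finset.univ.erase i, Complex.arg (r s j) :=
      Finset.sum_congr rfl fun j hj => by simp only [ρ, if_neg (Finset.ne_of_mem_erase hj)]
    rw [this]
    simp only [ρ, if_true, r]
    ring
  filter_upwards [h1, hC.eventually (Metric.ball_mem_nhds _ one_pos)] with s hs1 hs2
  rw [Real.dist_eq, hk] at hs2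
  obtain ⟨l, hl⟩ := exists_argSum_eq hs1
  constructor
  · intro him
    refine int_eq_of_abs_lt hl rfl ?_
    rw [hsum s, Complex.arg_neg_eq_arg_sub_pi_of_im_pos him]
    push_cast
    convert hs2 using 2
    ring
  · intro him
    refine int_eq_of_abs_lt hl rfl ?_
    rw [hsum s, Complex.arg_neg_eq_arg_add_pi_of_im_neg him]
    convert hs2 using 2
    ring

end Family

theorem argSum_eq_of_isPreconnected {n : ℕ} {P : Polygon ℂ n} {S : Set ℂ} (hS : IsPreconnected S)
    (h : ∀ x ∈ S, x ∉ P.boundary ℝ) {x y : ℂ} (hx : x ∈ S) (hy : y ∈ S) :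
    argSum P x = argSum P y :=
  eq_of_isPreconnected hS (fun z hz => nhdsWithin_le_nhds
    (argSum_eventually_eq (V := fun _ => P) (fun _ => continuousAt_const) continuousAt_id (h z hz)))
    hx hy

/-- Seen from far away each edge subtends a small angle: the quotients tend to `1`. The integer is
then `0`. -/
theorem argSum_cobounded {n : ℕ} (P : Polygon ℂ n) :
    ∀ᶠ x in Bornology.cobounded ℂ, argSum P x = 0 := by
  have h1 : Tendsto (fun x => argSum P x) (Bornology.cobounded ℂ) (𝓝 0) := by
    unfold argSum
    rw [show (0 : ℝ) = ∑ i : Fin n, Complex.arg 1 by simp]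
    refine tendsto_finsetSum _ fun i _ => ?_
    refine (Complex.continuousAt_arg Complex.one_mem_slitPlane).tendsto.comp ?_
    have h2 : Tendsto (fun x : ℂ => 1 + (P (finRotate n i) - P i) * (P i - x)⁻¹)
        (Bornology.cobounded ℂ) (𝓝 (1 + (P (finRotate n i) - P i) * 0)) := by
      refine tendsto_const_nhds.add (tendsto_const_nhds.mul (tendsto_inv₀_cobounded.comp ?_))
      exact tendsto_const_sub_cobounded (P i)
    rw [mul_zero, add_zero] at h2
    refine h2.congr' ?_
    filter_upwards [Bornology.eventually_ne_cobounded (P i)] with x hx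
    have : P i - x ≠ 0 := sub_ne_zero.2 hx.symm
    field_simp
    ring
  have h2 := h1.eventually (Metric.ball_mem_nhds _ one_pos)
  have h3 : ∀ᶠ x in Bornology.cobounded ℂ, ∀ i, P i ≠ x :=
    eventually_all.2 fun i => (Bornology.eventually_ne_cobounded (P i)).mono fun _ h => h.symm
  filter_upwards [h2, h3] with x hx2 hx3
  obtain ⟨k, hk⟩ := exists_argSum_eq hx3
  exact int_eq_of_abs_lt hk (l := 0) (by simp) (by
    rwa [Real.dist_eq] at hx2)

/-- `argSum` is constant on the component, and it vanishes at all far points. -/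
theorem isBounded_connectedComponentIn_of_argSum_ne_zero {n : ℕ} {P : Polygon ℂ n} {x : ℂ}
    (hx : x ∉ P.boundary ℝ) (h : argSum P x ≠ 0) :
    Bornology.IsBounded (connectedComponentIn (P.boundary ℝ)ᶜ x) := by
  rw [Bornology.isBounded_def]
  filter_upwards [argSum_cobounded P] with y hy hmem
  exact h ((argSum_eq_of_isPreconnected isPreconnected_connectedComponentIn
    (fun z hz => connectedComponentIn_subset _ _ hz) (mem_connectedComponentIn hx) hmem).trans hy)

/-! ### Coordinates adapted to the mitered offset -/

section Miter

variable {n : ℕ} (P : Polygon ℂ n)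

/-- The length of the `i`-th edge. -/
def edgeLen (i : Fin n) : ℝ := ‖P (finRotate n i) - P i‖

/-- The unit vector along the `i`-th edge. -/
def edgeDir (i : Fin n) : ℂ := (P (finRotate n i) - P i) / (edgeLen P i : ℂ)

/-- The cotangent of half the interior angle at the `i`-th vertex. -/
def slope (i : Fin n) : ℝ :=
  (star (edgeDir P ((finRotate n).symm i)) * edgeDir P i).im /
    (1 + (star (edgeDir P ((finRotate n).symm i)) * edgeDir P i).re)

/-- The velocity of the `i`-th vertex of the mitered offset. -/
def miter (i : Fin n) : ℂ := edgeDir P i * (slope P i + Complex.I)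

/-- The signed distance from the line carrying the `i`-th edge. -/
def sdist (i : Fin n) (z : ℂ) : ℝ := ((z - P i) / edgeDir P i).im

/-- The position with respect to the bisector at the `i`-th vertex: the first edge-coordinate of
`z`, measured from the bisector. -/
def side (i : Fin n) (z : ℂ) : ℝ :=
  ((z - P i) / edgeDir P i).re - slope P i * ((z - P i) / edgeDir P i).im

end Miter

theorem finRotate_ne_self {n : ℕ} (hn : 3 ≤ n) (i : Fin n) : finRotate n i ≠ i := by
  obtain ⟨m, rfl⟩ : ∃ m, n = m + 3 := ⟨n - 3, by omega⟩
  rw [finRotate_apply]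
  intro h
  have := congrArg Fin.val h
  rw [Fin.val_add_one] at this
  split_ifs at this with h2
  · rw [h2] at this; simp at this
  · omega

theorem finRotate_finRotate_ne_self {n : ℕ} (hn : 3 ≤ n) (i : Fin n) :
    finRotate n (finRotate n i) ≠ i := by
  obtain ⟨m, rfl⟩ : ∃ m, n = m + 3 := ⟨n - 3, by omega⟩
  rw [finRotate_apply, finRotate_apply]
  intro h
  have := congrArg Fin.val h
  rw [Fin.val_add_one] at this
  split_ifs at this with h2
  · have h3 := congrArg Fin.val h2
    rw [Fin.val_add_one] at h3
    split_ifs at h3 with h4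
    · simp at h3
    · simp at h3 this; omega
  · rw [Fin.val_add_one] at this
    split_ifs at this with h4
    · rw [h4] at this; simp at this
    · omega

theorem mem_segment_of_real {u d : ℂ} {l : ℝ} {x : ℝ} (h0 : 0 ≤ x) (hl : x ≤ l) :
    u + x * d ∈ segment ℝ u (u + l * d) := by
  rcases (h0.trans hl).lt_or_eq with h | h
  · rw [segment_eq_image]
    refine ⟨x / l, ⟨by positivity, (div_le_one h).2 hl⟩, ?_⟩
    have : (l : ℂ) ≠ 0 := by exact_mod_cast h.ne'
    simp only [Complex.real_smul]
    push_cast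
    field_simp
    ring
  · have : x = 0 := by linarith
    subst this
    simpa using left_mem_segment ℝ _ _

theorem normal_eq {n : ℕ} (P : Polygon ℂ n) (i : Fin n) :
    normal P i = Complex.I * edgeDir P i := by
  unfold normal edgeDir edgeLen; ring

namespace IsSimple

variable {n : ℕ} {P : Polygon ℂ n} (hP : IsSimple P)
include hP

theorem ne_finRotate (i : Fin n) : P (finRotate n i) ≠ P i := fun h =>
  finRotate_ne_self hP.three_le i (hP.injective h)

theorem edgeLen_pos (i : Fin n) : 0 < edgeLen P i :=
  norm_pos_iff.2 (sub_ne_zero.2 (hP.ne_finRotate i))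

theorem edgeLen_mul_edgeDir (i : Fin n) :
    (edgeLen P i : ℂ) * edgeDir P i = P (finRotate n i) - P i := by
  have : (edgeLen P i : ℂ) ≠ 0 := by exact_mod_cast (hP.edgeLen_pos i).ne'
  unfold edgeDir; field_simp

theorem norm_edgeDir (i : Fin n) : ‖edgeDir P i‖ = 1 := by
  have := hP.edgeLen_pos i
  unfold edgeDir
  rw [norm_div, Complex.norm_real, Real.norm_of_nonneg this.le]
  exact div_self this.ne'

theorem edgeDir_ne_zero (i : Fin n) : edgeDir P i ≠ 0 := by
  rw [← norm_ne_zero_iff, hP.norm_edgeDir]; norm_num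

theorem star_mul_edgeDir (i : Fin n) : star (edgeDir P i) * edgeDir P i = 1 := by
  have := Complex.conj_mul' (edgeDir P i)
  rw [hP.norm_edgeDir] at this
  simpa using this

/-- An edge that doubles back would share a short stretch with its predecessor. This keeps the
denominators of `slope` and `offset` away from `0`. -/
theorem edgeDir_ne_neg (i : Fin n) : edgeDir P (finRotate n i) ≠ - edgeDir P i := by
  intro h
  have h1 := hP.edgeLen_pos i
  have h2 := hP.edgeLen_pos (finRotate n i)
  set ε := min (edgeLen P i) (edgeLen P (finRotate n i)) with hε
  have hε0 : 0 < ε := lt_min h1 h2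
  have ha : P (finRotate n i) + (ε : ℝ) * edgeDir P (finRotate n i) ∈
      P.edgeSet ℝ (finRotate n i) := by
    rw [edgeSet_eq_segment]
    convert mem_segment_of_real (u := P (finRotate n i)) (d := edgeDir P (finRotate n i))
      hε0.le (min_le_right _ _) using 2
    rw [hP.edgeLen_mul_edgeDir]; ring
  have hb : P (finRotate n i) + (ε : ℝ) * edgeDir P (finRotate n i) ∈ P.edgeSet ℝ i := by
    rw [edgeSet_eq_segment, segment_symm, h]
    convert mem_segment_of_real (u := P (finRotate n i)) (d := - edgeDir P i)
      hε0.le (min_le_left _ _) using 2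
    rw [mul_neg, hP.edgeLen_mul_edgeDir]; ring
  have hc := (hP.adjacent i).le ⟨hb, ha⟩
  rw [mem_singleton_iff, add_eq_left, mul_eq_zero] at hc
  rcases hc with hc | hc
  · exact hε0.ne' (by exact_mod_cast hc)
  · exact hP.edgeDir_ne_zero _ hc

theorem star_mul_edgeDir_normSq (i j : Fin n) :
    (star (edgeDir P i) * edgeDir P j).re ^ 2 + (star (edgeDir P i) * edgeDir P j).im ^ 2 = 1 := by
  have h : ‖star (edgeDir P i) * edgeDir P j‖ = 1 := by
    rw [norm_mul, norm_star, hP.norm_edgeDir, hP.norm_edgeDir, one_mul]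
  have h2 := Complex.sq_norm (star (edgeDir P i) * edgeDir P j)
  rw [h, Complex.normSq_apply] at h2
  linarith

theorem one_add_re_ne_zero (i : Fin n) :
    1 + (star (edgeDir P ((finRotate n).symm i)) * edgeDir P i).re ≠ 0 := by
  intro h
  set ρ := star (edgeDir P ((finRotate n).symm i)) * edgeDir P i with hρ
  have h1 := hP.star_mul_edgeDir_normSq ((finRotate n).symm i) i
  rw [← hρ] at h1
  have hre : ρ.re = -1 := by linarith
  have him : ρ.im = 0 := by
    rw [hre] at h1; nlinarith
  have h2 : ρ = -1 := Complex.ext (by simp [hre]) (by simp [him])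
  refine hP.edgeDir_ne_neg ((finRotate n).symm i) ?_
  rw [Equiv.apply_symm_apply]
  have h3 := hP.star_mul_edgeDir ((finRotate n).symm i)
  have h4 : edgeDir P ((finRotate n).symm i) * ρ = edgeDir P i := by
    rw [hρ, ← mul_assoc, mul_comm (edgeDir P _) (star _), h3, one_mul]
  rw [← h4, h2]; ring

/-- With `κ` the tangent of half the turning angle, the turn is `(1 + iκ) / (1 - iκ)`, while `κ + i
= i (1 - iκ)`. So the velocity of a vertex has mirror-image coordinates in the frames of its two
edges: it runs along the bisector. -/
theorem edgeDir_eq_mul (i : Fin n) :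
    edgeDir P i * (slope P i + Complex.I) =
      edgeDir P ((finRotate n).symm i) * (-slope P i + Complex.I) := by
  set d := edgeDir P i with hd
  set e := edgeDir P ((finRotate n).symm i) with he
  have h1 := hP.one_add_re_ne_zero i
  have h2 := hP.star_mul_edgeDir_normSq ((finRotate n).symm i) i
  have h3 : e * (star e * d) = d := by
    rw [← mul_assoc, mul_comm e, hP.star_mul_edgeDir, one_mul]
  rw [← hd, ← he] at h1 h2
  have hs : slope P i = (star e * d).im / (1 + (star e * d).re) := rfl
  set ρ := star e * d with hρ
  rw [hs, ← h3, mul_assoc]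
  congr 1
  have h1' : (1 : ℂ) + (ρ.re : ℂ) ≠ 0 := by exact_mod_cast h1
  have hre : ρ = (ρ.re : ℂ) + ρ.im * Complex.I := (Complex.re_add_im ρ).symm
  rw [hre]
  simp only [Complex.add_re, Complex.ofReal_re, Complex.mul_re, Complex.I_re, mul_zero,
    Complex.ofReal_im, Complex.I_im, mul_one, sub_self, add_zero, Complex.add_im, Complex.mul_im,
    zero_add]
  push_cast
  field_simp
  have h2' : (ρ.re : ℂ) ^ 2 + (ρ.im : ℂ) ^ 2 = 1 := by exact_mod_cast h2
  linear_combination ((ρ.im : ℂ) * (1 + (ρ.re : ℂ))) * Complex.I_sq + (Complex.I) * h2'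

theorem miter_eq (i : Fin n) :
    miter P i = edgeDir P ((finRotate n).symm i) * (-slope P i + Complex.I) :=
  hP.edgeDir_eq_mul i

theorem miter_finRotate (i : Fin n) :
    miter P (finRotate n i) = edgeDir P i * (-slope P (finRotate n i) + Complex.I) := by
  rw [hP.miter_eq, Equiv.symm_apply_apply]

/-- The sum of the two unit normals has length-`1 + cos` component along either normal. Dividing by
this gives the vector with unit component along both, which is `miter`. -/
theorem offset_apply (t : ℝ) (i : Fin n) : offset P t i = P i + t * miter P i := by
  have h1 := hP.one_add_re_ne_zero i
  have hin : inner ℝ (normal P ((finRotate n).symm i)) (normal P i) =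
      (star (edgeDir P ((finRotate n).symm i)) * edgeDir P i).re := by
    rw [normal_eq, normal_eq, Complex.inner]
    simp
    ring
  have h3 : edgeDir P ((finRotate n).symm i) *
      (star (edgeDir P ((finRotate n).symm i)) * edgeDir P i) = edgeDir P i := by
    rw [← mul_assoc, mul_comm (edgeDir P ((finRotate n).symm i)), hP.star_mul_edgeDir, one_mul]
  show P i + ((t / (1 + inner ℝ (normal P ((finRotate n).symm i)) (normal P i)) : ℝ) : ℂ) *
      (normal P ((finRotate n).symm i) + normal P i) = _
  rw [hin, normal_eq, normal_eq, hP.miter_eq]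
  have hs : slope P i = (star (edgeDir P ((finRotate n).symm i)) * edgeDir P i).im /
    (1 + (star (edgeDir P ((finRotate n).symm i)) * edgeDir P i).re) := rfl
  set e := edgeDir P ((finRotate n).symm i) with he
  set ρ := star e * edgeDir P i with hρ
  rw [← h3, hs]
  have h1' : (1 : ℂ) + (ρ.re : ℂ) ≠ 0 := by exact_mod_cast h1
  have hre : ρ = (ρ.re : ℂ) + ρ.im * Complex.I := (Complex.re_add_im ρ).symm
  rw [hre]
  simp only [Complex.add_re, Complex.ofReal_re, Complex.mul_re, Complex.I_re, mul_zero,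
    Complex.ofReal_im, Complex.I_im, mul_one, sub_self, add_zero, Complex.add_im, Complex.mul_im,
    zero_add]
  push_cast
  field_simp
  linear_combination ((t : ℂ) * e * ρ.im) * Complex.I_sq

/-- `side` and `sdist` are oblique coordinates with the edge and the bisector at its first end as
axes. In them the offset edge at time `t` lies on `sdist = t`, and the path of the vertex lies on
`side = 0`. -/
theorem eq_start (i : Fin n) (z : ℂ) :
    z = P i + side P i z * edgeDir P i + sdist P i z * miter P i := by
  have h := hP.edgeDir_ne_zero i
  have h2 : (z - P i) = edgeDir P i * ((z - P i) / edgeDir P i) := by field_simp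
  have h3 := Complex.re_add_im ((z - P i) / edgeDir P i)
  unfold side sdist miter
  push_cast
  linear_combination h2 - edgeDir P i * h3

theorem side_sdist_of_eq {i : Fin n} {z : ℂ} {ξ t : ℝ}
    (h : z = P i + ξ * edgeDir P i + t * miter P i) : side P i z = ξ ∧ sdist P i z = t := by
  have h0 := hP.edgeDir_ne_zero i
  have h1 : (z - P i) / edgeDir P i = ξ + t * (slope P i + Complex.I) := by
    rw [h]; unfold miter; field_simp; ring
  unfold side sdist
  rw [h1]
  constructor
  · simp; ring
  · simp

/-- The bisector makes equal angles with the directions of its two edges, so the distance from it is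
the same measured along either edge. The right side measures it along the `i`-th edge. -/
theorem side_finRotate (i : Fin n) (z : ℂ) : side P (finRotate n i) z =
    side P i z + (slope P i + slope P (finRotate n i)) * sdist P i z - edgeLen P i := by
  set j := finRotate n i with hj
  have h1 := hP.eq_start i z
  have h2 := hP.eq_start j z
  have h3 := hP.edgeLen_mul_edgeDir i
  have hm : miter P j = edgeDir P i * (-slope P j + Complex.I) := hP.miter_finRotate i
  have hm2 : miter P j = edgeDir P j * (slope P j + Complex.I) := rfl
  have hm1 : miter P i = edgeDir P i * (slope P i + Complex.I) := rfl
  have hd := hP.edgeDir_ne_zero i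
  rw [← hj] at h3
  have hk : ∀ x : ℝ, (x : ℂ) + Complex.I ≠ 0 := fun x hx => by
    have := congrArg Complex.im hx; simp at this
  have hdj : edgeDir P j = edgeDir P i * (-slope P j + Complex.I) / (slope P j + Complex.I) := by
    rw [eq_div_iff (hk _), ← hm2, hm]
  have key : ((side P j z : ℂ) * (-slope P j + Complex.I) / (slope P j + Complex.I)) +
      sdist P j z * (-slope P j + Complex.I) =
      (side P i z : ℂ) + sdist P i z * (slope P i + Complex.I) - edgeLen P i := by
    apply mul_left_cancel₀ hd
    rw [hm] at h2
    rw [hdj] at h2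
    rw [hm1] at h1
    linear_combination h1 - h2 + h3
  have hk' := hk (slope P j)
  have key2 : (side P j z : ℂ) =
      ((side P i z : ℂ) + sdist P i z * (slope P i + Complex.I) - edgeLen P i -
        sdist P j z * (-slope P j + Complex.I)) * ((slope P j + Complex.I) /
          (-slope P j + Complex.I)) := by
    have hk'' : (-(slope P j : ℂ) + Complex.I) ≠ 0 := by
      have := hk (-slope P j); push_cast at this; exact this
    rw [← key]; field_simp; ring
  have key3 : (side P j z : ℂ) * (-slope P j + Complex.I) =
      ((side P i z : ℂ) + sdist P i z * (slope P i + Complex.I) - edgeLen P i -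
        sdist P j z * (-slope P j + Complex.I)) * (slope P j + Complex.I) := by
    have hk'' : (-(slope P j : ℂ) + Complex.I) ≠ 0 := by
      have := hk (-slope P j); push_cast at this; exact this
    rw [key2]; field_simp
  have him := congrArg Complex.im key3
  simp at him
  linarith

/-- The coefficient `2κ / (1 + κ²)` is the sine of the turning angle. In particular the two
distances agree on the bisector. -/
theorem sdist_symm (i : Fin n) (z : ℂ) : sdist P i z =
    sdist P ((finRotate n).symm i) z - 2 * slope P i / (1 + slope P i ^ 2) * side P i z := by
  obtain ⟨j, rfl⟩ : ∃ j, i = finRotate n j := ⟨(finRotate n).symm i,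
    ((finRotate n).apply_symm_apply i).symm⟩
  rw [Equiv.symm_apply_apply]
  set i := finRotate n j with hi
  have hsd := hP.side_finRotate j z
  rw [← hi] at hsd
  have h1 := hP.eq_start i z
  have h2 := hP.eq_start j z
  have h3 := hP.edgeLen_mul_edgeDir j
  rw [← hi] at h3
  have hm : miter P i = edgeDir P j * (-slope P i + Complex.I) := hP.miter_finRotate j
  have hm2 : miter P i = edgeDir P i * (slope P i + Complex.I) := rfl
  have hm1 : miter P j = edgeDir P j * (slope P j + Complex.I) := rfl
  have hd := hP.edgeDir_ne_zero j
  have hsd' : (side P i z : ℂ) = side P j z + (slope P j + slope P i) * sdist P j z -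
      edgeLen P j := by exact_mod_cast hsd
  have hk : ((slope P i : ℂ) + Complex.I) ≠ 0 := fun hx => by
    have := congrArg Complex.im hx; simp at this
  have hdj : edgeDir P i = edgeDir P j * (-slope P i + Complex.I) / (slope P i + Complex.I) := by
    rw [eq_div_iff hk, ← hm2, hm]
  have key : ((side P i z : ℂ) * (-slope P i + Complex.I)) +
      sdist P i z * (-slope P i + Complex.I) * (slope P i + Complex.I) =
      ((side P j z : ℂ) + sdist P j z * (slope P j + Complex.I) - edgeLen P j) *
      (slope P i + Complex.I) := by
    apply mul_left_cancel₀ hd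
    rw [hm, hdj] at h1
    rw [hm1] at h2
    have h1' := congrArg (fun w => (w - P i) * (slope P i + Complex.I)) h1
    have h2' := congrArg (fun w => (w - P i) * (slope P i + Complex.I)) h2
    have e1 : (P i + (side P i z : ℂ) * (edgeDir P j * (-slope P i + Complex.I) /
        (slope P i + Complex.I)) + sdist P i z * (edgeDir P j * (-slope P i + Complex.I)) - P i) *
        (slope P i + Complex.I) = edgeDir P j * (((side P i z : ℂ) * (-slope P i + Complex.I)) +
      sdist P i z * (-slope P i + Complex.I) * (slope P i + Complex.I)) := by
      field_simp; ring
    rw [e1] at h1'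
    linear_combination h2' - h1' + (slope P i + Complex.I) * h3
  have hre := congrArg Complex.re key
  simp at hre
  have hpos : (0 : ℝ) < 1 + slope P i ^ 2 := by positivity
  field_simp
  rw [hsd] at hre ⊢
  nlinarith

end IsSimple

/-! ### Edges of the mitered offset -/

/-- The signed length of the `i`-th edge of the mitered offset at distance `t`. -/
def lenAt {n : ℕ} (P : Polygon ℂ n) (i : Fin n) (t : ℝ) : ℝ :=
  edgeLen P i - (slope P i + slope P (finRotate n i)) * t

theorem continuous_lenAt {n : ℕ} (P : Polygon ℂ n) (i : Fin n) : Continuous (lenAt P i) := by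
  unfold lenAt; fun_prop

theorem continuous_sdist {n : ℕ} (P : Polygon ℂ n) (i : Fin n) : Continuous (sdist P i) := by
  unfold sdist; simp only [div_eq_mul_inv]; fun_prop

theorem continuous_side {n : ℕ} (P : Polygon ℂ n) (i : Fin n) : Continuous (side P i) := by
  unfold side; simp only [div_eq_mul_inv]; fun_prop

theorem sdist_combo {n : ℕ} (P : Polygon ℂ n) (i : Fin n) (z w : ℂ) {a b : ℝ} (h : a + b = 1) :
    sdist P i (a • z + b • w) = a * sdist P i z + b * sdist P i w := by
  have hb : b = 1 - a := by linarith
  subst hb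
  unfold sdist
  rw [show (a • z + (1 - a) • w - P i) / edgeDir P i =
    a * ((z - P i) / edgeDir P i) + (1 - a : ℝ) * ((w - P i) / edgeDir P i) by
      simp only [Complex.real_smul]; push_cast; ring]
  simp [-Complex.ofReal_sub]

theorem side_combo {n : ℕ} (P : Polygon ℂ n) (i : Fin n) (z w : ℂ) {a b : ℝ} (h : a + b = 1) :
    side P i (a • z + b • w) = a * side P i z + b * side P i w := by
  have hb : b = 1 - a := by linarith
  subst hb
  unfold side
  rw [show (a • z + (1 - a) • w - P i) / edgeDir P i =
    a * ((z - P i) / edgeDir P i) + (1 - a : ℝ) * ((w - P i) / edgeDir P i) by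
      simp only [Complex.real_smul]; push_cast; ring]
  simp [-Complex.ofReal_sub]
  ring

theorem mem_segment_iff_real {u d z : ℂ} {l : ℝ} (hl : 0 ≤ l) :
    z ∈ segment ℝ u (u + l * d) ↔ ∃ x : ℝ, 0 ≤ x ∧ x ≤ l ∧ z = u + x * d := by
  constructor
  · rw [segment_eq_image]
    rintro ⟨θ, ⟨h0, h1⟩, rfl⟩
    refine ⟨θ * l, by positivity, by nlinarith, ?_⟩
    simp only [Complex.real_smul]; push_cast; ring
  · rintro ⟨x, h0, h1, rfl⟩
    exact mem_segment_of_real h0 h1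

/-- Disjointness says that a continuous function has no zero on the compact square of parameters,
which is an open condition. -/
theorem segment_disjoint_eventually {X : Type*} [TopologicalSpace X] {a b c d : X → ℂ} {s : X}
    (ha : ContinuousAt a s) (hb : ContinuousAt b s) (hc : ContinuousAt c s)
    (hd : ContinuousAt d s) (h : Disjoint (segment ℝ (a s) (b s)) (segment ℝ (c s) (d s))) :
    ∀ᶠ t in 𝓝 s, Disjoint (segment ℝ (a t) (b t)) (segment ℝ (c t) (d t)) := by
  have key : ∀ᶠ t in 𝓝 s, ∀ p ∈ Icc (0 : ℝ) 1 ×ˢ Icc (0 : ℝ) 1,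
      (1 - p.1) • a t + p.1 • b t - ((1 - p.2) • c t + p.2 • d t) ≠ 0 := by
    refine (isCompact_Icc.prod isCompact_Icc).eventually_forall_of_forall_eventually ?_
    rintro ⟨x, y⟩ ⟨hx, hy⟩
    have hcont : ContinuousAt (fun q : X × (ℝ × ℝ) =>
        (1 - q.2.1) • a q.1 + q.2.1 • b q.1 - ((1 - q.2.2) • c q.1 + q.2.2 • d q.1))
        (s, (x, y)) := by
      have ha' : ContinuousAt (fun q : X × (ℝ × ℝ) => a q.1) (s, (x, y)) :=
        ContinuousAt.comp (f := Prod.fst) ha continuousAt_fst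
      have hb' : ContinuousAt (fun q : X × (ℝ × ℝ) => b q.1) (s, (x, y)) :=
        ContinuousAt.comp (f := Prod.fst) hb continuousAt_fst
      have hc' : ContinuousAt (fun q : X × (ℝ × ℝ) => c q.1) (s, (x, y)) :=
        ContinuousAt.comp (f := Prod.fst) hc continuousAt_fst
      have hd' : ContinuousAt (fun q : X × (ℝ × ℝ) => d q.1) (s, (x, y)) :=
        ContinuousAt.comp (f := Prod.fst) hd continuousAt_fst
      fun_prop
    refine hcont.eventually_ne (sub_ne_zero.2 fun heq => ?_)
    refine disjoint_left.1 h (show (1 - x) • a s + x • b s ∈ _ from ?_) ?_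
    · rw [segment_eq_image]; exact ⟨x, hx, rfl⟩
    · rw [segment_eq_image, heq]; exact ⟨y, hy, rfl⟩
  filter_upwards [key] with t ht
  rw [disjoint_left]
  intro z hz hz'
  rw [segment_eq_image] at hz hz'
  obtain ⟨x, hx, rfl⟩ := hz
  obtain ⟨y, hy, hxy⟩ := hz'
  exact ht (x, y) ⟨hx, hy⟩ (sub_eq_zero.2 hxy.symm)

theorem finRotate_reflTransGen {n : ℕ} {r : Fin n → Fin n → Prop} (hr : ∀ i j, r i j → r j i)
    (h : ∀ i, r i (finRotate n i)) (i j : Fin n) : Relation.ReflTransGen r i j := by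
  have hn : 0 < n := i.pos
  have h0 : ∀ k (hk : k < n), Relation.ReflTransGen r ⟨0, hn⟩ ⟨k, hk⟩ := by
    intro k
    induction k with
    | zero => intro _; exact Relation.ReflTransGen.refl
    | succ k ih =>
      intro hk
      refine (ih (by omega)).tail ?_
      have := h ⟨k, by omega⟩
      obtain ⟨m, rfl⟩ : ∃ m, n = m + 1 := ⟨n - 1, by omega⟩
      rwa [finRotate_of_lt (by omega)] at this
  have : Std.Symm r := ⟨hr⟩
  exact (symm (h0 i i.2)).trans (h0 j j.2)

theorem isPreconnected_iUnion_cyclic {n : ℕ} {s : Fin n → Set ℂ} (hs : ∀ i, IsPreconnected (s i))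
    (h : ∀ i, (s i ∩ s (finRotate n i)).Nonempty) : IsPreconnected (⋃ i, s i) :=
  IsPreconnected.iUnion_of_reflTransGen hs
    (finRotate_reflTransGen (fun _ _ h => by rwa [inter_comm]) h)

theorem isPreconnected_boundary {n : ℕ} (P : Polygon ℂ n) : IsPreconnected (P.boundary ℝ) := by
  refine isPreconnected_iUnion_cyclic (fun i => ?_) fun i => ⟨P (finRotate n i), ?_, ?_⟩
  · rw [edgeSet_eq_segment]; exact (convex_segment _ _).isPreconnected
  · rw [edgeSet_eq_segment]; exact right_mem_segment ℝ _ _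
  · rw [edgeSet_eq_segment]; exact left_mem_segment ℝ _ _

/-- The strip swept by the `i`-th edge during the times in `I`. -/
def strip {n : ℕ} (P : Polygon ℂ n) (I : Set ℝ) (i : Fin n) : Set ℂ :=
  {z | sdist P i z ∈ I ∧ 0 ≤ side P i z ∧ side P (finRotate n i) z ≤ 0}

theorem convex_strip {n : ℕ} (P : Polygon ℂ n) {I : Set ℝ} (hI : Convex ℝ I) (i : Fin n) :
    Convex ℝ (strip P I i) := by
  intro z hz w hw a b ha hb hab
  refine ⟨?_, ?_, ?_⟩
  · rw [sdist_combo _ _ _ _ hab]; exact hI hz.1 hw.1 ha hb hab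
  · rw [side_combo _ _ _ _ hab]
    have := hz.2.1; have := hw.2.1; positivity
  · rw [side_combo _ _ _ _ hab]
    nlinarith [hz.2.2, hw.2.2]

namespace IsSimple

variable {n : ℕ} {P : Polygon ℂ n} (hP : IsSimple P)
include hP

theorem side_sub_side (i : Fin n) (z : ℂ) :
    side P i z - side P (finRotate n i) z = lenAt P i (sdist P i z) := by
  rw [hP.side_finRotate]; unfold lenAt; ring

theorem sdist_finRotate (i : Fin n) {z : ℂ} (h : side P (finRotate n i) z = 0) :
    sdist P (finRotate n i) z = sdist P i z := by
  rw [hP.sdist_symm, h, Equiv.symm_apply_apply]; ring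

theorem offset_zero : offset P 0 = P := by
  have : (offset P 0).vertices = P.vertices := funext fun i => by
    rw [hP.offset_apply]; simp
  cases P; exact congrArg Polygon.mk this

theorem continuous_offset (i : Fin n) : Continuous (fun t => offset P t i) := by
  simp only [hP.offset_apply]; fun_prop

theorem offset_finRotate (t : ℝ) (i : Fin n) :
    offset P t (finRotate n i) = offset P t i + lenAt P i t * edgeDir P i := by
  rw [hP.offset_apply, hP.offset_apply, hP.miter_finRotate]
  have h3 := hP.edgeLen_mul_edgeDir i
  unfold miter lenAt
  push_cast
  linear_combination -h3

theorem side_offset (t : ℝ) (i : Fin n) : side P i (offset P t i) = 0 :=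
  (hP.side_sdist_of_eq (t := t) (by rw [hP.offset_apply]; simp)).1

theorem sdist_offset (t : ℝ) (i : Fin n) : sdist P i (offset P t i) = t :=
  (hP.side_sdist_of_eq (ξ := 0) (by rw [hP.offset_apply]; simp)).2

theorem eq_offset {i : Fin n} {z : ℂ} (h : side P i z = 0) : z = offset P (sdist P i z) i := by
  have := hP.eq_start i z
  rw [h] at this
  rw [hP.offset_apply]
  simpa using this

theorem mem_offset_segment_iff {i : Fin n} {t : ℝ} (h : 0 ≤ lenAt P i t) {z : ℂ} :
    z ∈ segment ℝ (offset P t i) (offset P t (finRotate n i)) ↔ z ∈ strip P {t} i := by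
  rw [hP.offset_finRotate, mem_segment_iff_real h]
  constructor
  · rintro ⟨x, h0, h1, hz⟩
    obtain ⟨h2, h3⟩ := hP.side_sdist_of_eq (i := i) (z := z) (ξ := x) (t := t)
      (by rw [hz, hP.offset_apply]; ring)
    have := hP.side_sub_side i z
    rw [h2, h3] at this
    exact ⟨h3, by rw [h2]; exact h0, by linarith⟩
  · rintro ⟨h1, h2, h3⟩
    have h1 : sdist P i z = t := h1
    have := hP.side_sub_side i z
    rw [h1] at this
    refine ⟨side P i z, h2, by linarith, ?_⟩
    have := hP.eq_start i z
    rw [h1] at this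
    rw [hP.offset_apply]
    linear_combination this

theorem mem_segment_iff (i : Fin n) {z : ℂ} :
    z ∈ segment ℝ (P i) (P (finRotate n i)) ↔ z ∈ strip P {0} i := by
  have := hP.mem_offset_segment_iff (i := i) (t := 0) (z := z)
    (by unfold lenAt; simpa using (hP.edgeLen_pos i).le)
  rwa [hP.offset_zero] at this

theorem mem_offset_boundary_iff {t : ℝ} (h : ∀ i, 0 ≤ lenAt P i t) {z : ℂ} :
    z ∈ (offset P t).boundary ℝ ↔ ∃ i, z ∈ strip P {t} i := by
  rw [mem_boundary_iff]
  exact exists_congr fun i => hP.mem_offset_segment_iff (h i)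

/-- Two consecutive strips meet along the bisector at their common vertex. -/
theorem eq_offset_of_mem_strip {i : Fin n} {I J : Set ℝ} {z : ℂ} (hz : z ∈ strip P I i)
    (hz' : z ∈ strip P J (finRotate n i)) :
    sdist P i z = sdist P (finRotate n i) z ∧ side P (finRotate n i) z = 0 ∧
      z = offset P (sdist P i z) (finRotate n i) := by
  have h0 := le_antisymm hz.2.2 hz'.2.1
  have h1 := hP.sdist_finRotate i h0
  exact ⟨h1.symm, h0, h1 ▸ hP.eq_offset h0⟩

/-- Only edges that are not neighbours need checking. Neighbouring edges lie in consecutive strips,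
which meet on the bisector alone, and a repeated vertex would be common to two edges. -/
theorem isSimple_offset {t : ℝ} (hl : ∀ i, 0 < lenAt P i t)
    (h : ∀ i j, i ≠ j → j ≠ finRotate n i → i ≠ finRotate n j →
      Disjoint ((offset P t).edgeSet ℝ i) ((offset P t).edgeSet ℝ j)) :
    IsSimple (offset P t) where
  three_le := hP.three_le
  injective := by
    have key : ∀ i, offset P t (finRotate n i) ≠ offset P t i := by
      intro i h0
      rw [hP.offset_finRotate, add_eq_left, mul_eq_zero] at h0
      rcases h0 with h0 | h0
      · exact (hl i).ne' (by exact_mod_cast h0)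
      · exact hP.edgeDir_ne_zero i h0
    intro i j hij
    by_contra hne
    rcases eq_or_ne j (finRotate n i) with rfl | h1
    · exact key i hij.symm
    rcases eq_or_ne i (finRotate n j) with rfl | h2
    · exact key j hij
    refine disjoint_left.1 (h i j hne h1 h2) (show offset P t i ∈ _ from ?_) ?_
    · rw [edgeSet_eq_segment]; exact left_mem_segment ℝ _ _
    · rw [edgeSet_eq_segment]
      have hij' : offset P t i = offset P t j := hij
      rw [hij']; exact left_mem_segment ℝ _ _
  adjacent := by
    intro i
    rw [edgeSet_eq_segment, edgeSet_eq_segment]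
    ext z
    rw [mem_inter_iff, hP.mem_offset_segment_iff (hl _).le, hP.mem_offset_segment_iff (hl _).le,
      mem_singleton_iff]
    constructor
    · rintro ⟨h1, h2⟩
      have := (hP.eq_offset_of_mem_strip h1 h2).2.2
      rwa [show sdist P i z = t from h1.1] at this
    · rintro rfl
      rw [← hP.mem_offset_segment_iff (hl _).le, ← hP.mem_offset_segment_iff (hl _).le]
      exact ⟨right_mem_segment ℝ _ _, left_mem_segment ℝ _ _⟩
  disjoint := h

/-- Near a time at which the offset is simple, the offsets are simple and disjoint from it. -/
theorem eventually_offset {s : ℝ} (hs : IsSimple (offset P s)) (hl : ∀ i, 0 < lenAt P i s) :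
    ∀ᶠ t in 𝓝 s, (∀ i, 0 < lenAt P i t) ∧ IsSimple (offset P t) ∧
      (t ≠ s → ∀ z ∈ (offset P t).boundary ℝ, z ∉ (offset P s).boundary ℝ) := by
  have h1 : ∀ᶠ t in 𝓝 s, ∀ i, 0 < lenAt P i t :=
    eventually_all.2 fun i => ((continuous_lenAt P i).tendsto s).eventually (lt_mem_nhds (hl i))
  have hc := fun i => (hP.continuous_offset i).continuousAt (x := s)
  have h2 : ∀ᶠ t in 𝓝 s, ∀ i j, i ≠ j → j ≠ finRotate n i → i ≠ finRotate n j →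
      Disjoint ((offset P t).edgeSet ℝ i) ((offset P t).edgeSet ℝ j) := by
    simp only [eventually_all, edgeSet_eq_segment]
    intro i j h1 h2 h3
    refine segment_disjoint_eventually (hc _) (hc _) (hc _) (hc _) ?_
    simpa only [edgeSet_eq_segment] using hs.disjoint i j h1 h2 h3
  have h3 : ∀ᶠ t in 𝓝 s, ∀ i j, i ≠ j → j ≠ finRotate n i → i ≠ finRotate n j →
      Disjoint ((offset P t).edgeSet ℝ i) ((offset P s).edgeSet ℝ j) := by
    simp only [eventually_all, edgeSet_eq_segment]
    intro i j h1 h2 h3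
    refine segment_disjoint_eventually (hc _) (hc _) continuousAt_const continuousAt_const ?_
    simpa only [edgeSet_eq_segment] using hs.disjoint i j h1 h2 h3
  filter_upwards [h1, h2, h3] with t h1 h2 h3
  refine ⟨h1, hP.isSimple_offset h1 h2, fun hne z hz hz' => hne ?_⟩
  obtain ⟨i, hi⟩ := (hP.mem_offset_boundary_iff fun i => (h1 i).le).1 hz
  obtain ⟨j, hj⟩ := (hP.mem_offset_boundary_iff fun i => (hl i).le).1 hz'
  -- A common point has the same time on both curves: for equal edges trivially, for neighbours
  -- because it lies on their bisector. Other pairs are disjoint at nearby times.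
  rcases eq_or_ne i j with rfl | h4
  · exact hi.1.symm.trans hj.1
  rcases eq_or_ne j (finRotate n i) with rfl | h5
  · exact hi.1.symm.trans ((hP.eq_offset_of_mem_strip hi hj).1.trans hj.1)
  rcases eq_or_ne i (finRotate n j) with rfl | h6
  · exact hi.1.symm.trans ((hP.eq_offset_of_mem_strip hj hi).1.symm.trans hj.1)
  have := h3 i j h4 h5 h6
  rw [edgeSet_eq_segment, edgeSet_eq_segment] at this
  exact (disjoint_left.1 this ((hP.mem_offset_segment_iff (h1 i).le).2 hi)
    ((hP.mem_offset_segment_iff (hl j).le).2 hj)).elim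

theorem eventually_offset_zero :
    ∀ᶠ t in 𝓝 (0 : ℝ), (∀ i, 0 < lenAt P i t) ∧ IsSimple (offset P t) ∧
      (t ≠ 0 → ∀ z ∈ (offset P t).boundary ℝ, z ∉ P.boundary ℝ) := by
  have := hP.eventually_offset (s := 0) (by rwa [hP.offset_zero])
    (fun i => by unfold lenAt; simpa using hP.edgeLen_pos i)
  rwa [hP.offset_zero] at this

/-- Every simple polygon has an admissible offset distance. -/
theorem exists_isMiteredOffset : ∃ b, IsMiteredOffset P b := by
  obtain ⟨δ, hδ, h⟩ := Metric.eventually_nhds_iff.1 hP.eventually_offset_zero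
  refine ⟨δ / 2, half_pos hδ, fun t ht => (h ?_).2.1⟩
  rw [Real.dist_eq, sub_zero, abs_of_nonneg ht.1]
  linarith [ht.2]

/-- A length that becomes nonpositive has a zero in between, and at that time two consecutive
vertices would coincide. -/
theorem lenAt_pos {b : ℝ} (hb : IsMiteredOffset P b) (i : Fin n) {t : ℝ} (ht : t ∈ Icc 0 b) :
    0 < lenAt P i t := by
  by_contra hneg
  have h0 : 0 < lenAt P i 0 := by unfold lenAt; simpa using hP.edgeLen_pos i
  obtain ⟨s, hs, hs0⟩ := intermediate_value_Icc' ht.1 (continuous_lenAt P i).continuousOn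
    (show (0 : ℝ) ∈ Icc _ _ from ⟨not_lt.1 hneg, h0.le⟩)
  refine (hb.2 s ⟨hs.1, hs.2.trans ht.2⟩).ne_finRotate i ?_
  rw [hP.offset_finRotate, hs0]; simp

/-- The winding number jumps across an edge of the moving polygon. -/
theorem argSum_offset_jump {s : ℝ} (hs : IsSimple (offset P s)) (hl : ∀ i, 0 < lenAt P i s)
    {i : Fin n} {y : ℂ} (h0 : sdist P i y = s) (h1 : 0 < side P i y)
    (h2 : side P (finRotate n i) y < 0) :
    ∃ k : ℤ, ∀ᶠ p : ℝ × ℂ in 𝓝 (s, y),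
      (p.1 < sdist P i p.2 → argSum (offset P p.1) p.2 = 2 * Real.pi * (k + 1 : ℤ)) ∧
      (sdist P i p.2 < p.1 → argSum (offset P p.1) p.2 = 2 * Real.pi * k) := by
  have hne : offset P s i ≠ y := by
    rintro rfl; rw [hP.side_offset] at h1; exact lt_irrefl _ h1
  have hne' : offset P s (finRotate n i) ≠ y := by
    rintro rfl; rw [hP.side_offset] at h2; exact lt_irrefl _ h2
  have hi : y ∈ strip P {s} i := ⟨h0, h1.le, h2.le⟩
  obtain ⟨k, hk⟩ := argSum_jump (V := fun p : ℝ × ℂ => offset P p.1) (y := fun p => p.2)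
    (s₀ := (s, y)) (fun j => ((hP.continuous_offset j).comp continuous_fst).continuousAt)
    continuousAt_snd i hne hne' ((hP.mem_offset_segment_iff (hl i).le).2 hi) (by
      intro j hj hmem
      rw [hP.mem_offset_segment_iff (hl j).le] at hmem
      rcases eq_or_ne j (finRotate n i) with rfl | h5
      · exact h2.ne (hP.eq_offset_of_mem_strip hi hmem).2.1
      rcases eq_or_ne i (finRotate n j) with rfl | h6
      · exact h1.ne' (hP.eq_offset_of_mem_strip hmem hi).2.1
      have := hs.disjoint i j hj.symm h5 h6
      rw [edgeSet_eq_segment, edgeSet_eq_segment] at this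
      exact disjoint_left.1 this ((hP.mem_offset_segment_iff (hl i).le).2 hi)
        ((hP.mem_offset_segment_iff (hl j).le).2 hmem))
  refine ⟨k, ?_⟩
  have hev1 : ∀ᶠ p : ℝ × ℂ in 𝓝 (s, y), p.2 - offset P p.1 i ≠ 0 :=
    (continuous_snd.sub ((hP.continuous_offset i).comp continuous_fst)).continuousAt.eventually_ne
      (sub_ne_zero.2 hne.symm)
  have hev2 : ∀ᶠ p : ℝ × ℂ in 𝓝 (s, y), 0 < lenAt P i p.1 :=
    (((continuous_lenAt P i).comp continuous_fst).tendsto (s, y)).eventually (lt_mem_nhds (hl i))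
  filter_upwards [hk, hev1, hev2] with p hp hp1 hp2
  have hd := hP.edgeDir_ne_zero i
  -- The imaginary part has the sign of `sdist - time`, which translates left and right of the edge
  -- into ahead of and behind the moving line.
  have him : ((offset P p.1 (finRotate n i) - p.2) / (offset P p.1 i - p.2)).im =
      lenAt P i p.1 * (sdist P i p.2 - p.1) /
        Complex.normSq ((p.2 - offset P p.1 i) / edgeDir P i) := by
    have e1 : (offset P p.1 (finRotate n i) - p.2) / (offset P p.1 i - p.2) =
        1 - lenAt P i p.1 * ((p.2 - offset P p.1 i) / edgeDir P i)⁻¹ := by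
      rw [hP.offset_finRotate]
      have : offset P p.1 i - p.2 ≠ 0 := by rw [← neg_sub]; exact neg_ne_zero.2 hp1
      field_simp
      ring
    have e2 : ((p.2 - offset P p.1 i) / edgeDir P i).im = sdist P i p.2 - p.1 := by
      have : (p.2 - offset P p.1 i) / edgeDir P i =
          (p.2 - P i) / edgeDir P i - p.1 * (slope P i + Complex.I) := by
        rw [hP.offset_apply]; unfold miter; field_simp; ring
      rw [this]; unfold sdist; simp
    rw [e1, ← e2]
    generalize (p.2 - offset P p.1 i) / edgeDir P i = w
    rw [Complex.sub_im, Complex.one_im, Complex.im_ofReal_mul, Complex.inv_im]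
    ring
  have hns : 0 < Complex.normSq ((p.2 - offset P p.1 i) / edgeDir P i) :=
    Complex.normSq_pos.2 (div_ne_zero hp1 hd)
  rw [him] at hp
  constructor
  · intro h
    exact hp.1 (div_pos (mul_pos hp2 (by linarith)) hns)
  · intro h
    exact hp.2 (div_neg_of_neg_of_pos (mul_neg_of_pos_of_neg hp2 (by linarith)) hns)

end IsSimple

/-! ### The Jordan curve theorem for simple polygons -/

/-- The midpoint of the `i`-th edge of the mitered offset at distance `s`. -/
def midAt {n : ℕ} (P : Polygon ℂ n) (i : Fin n) (s : ℝ) : ℂ :=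
  offset P s i + (lenAt P i s / 2 : ℝ) * edgeDir P i

theorem eventually_notMem_boundary {X : Type*} [TopologicalSpace X] {n : ℕ} {V : X → Polygon ℂ n}
    {y : X → ℂ} {s : X} (hV : ∀ i, ContinuousAt (fun t => V t i) s) (hy : ContinuousAt y s)
    (h : y s ∉ (V s).boundary ℝ) : ∀ᶠ t in 𝓝 s, y t ∉ (V t).boundary ℝ := by
  simp only [mem_boundary_iff, not_exists] at h ⊢
  refine eventually_all.2 fun i => ?_
  have := segment_disjoint_eventually hy hy (hV i) (hV (finRotate n i))
    (by rw [segment_same, disjoint_singleton_left]; exact h i)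
  filter_upwards [this] with t ht
  rwa [segment_same, disjoint_singleton_left] at ht

namespace IsSimple

variable {n : ℕ} {P : Polygon ℂ n} (hP : IsSimple P)
include hP

theorem sdist_midAt (i : Fin n) (s : ℝ) : sdist P i (midAt P i s) = s :=
  (hP.side_sdist_of_eq (ξ := lenAt P i s / 2) (by
    unfold midAt; rw [hP.offset_apply]; ring)).2

theorem side_midAt (i : Fin n) (s : ℝ) : side P i (midAt P i s) = lenAt P i s / 2 :=
  (hP.side_sdist_of_eq (t := s) (by unfold midAt; rw [hP.offset_apply]; ring)).1

theorem side_midAt' (i : Fin n) (s : ℝ) :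
    side P (finRotate n i) (midAt P i s) = - (lenAt P i s / 2) := by
  have := hP.side_sub_side i (midAt P i s)
  rw [hP.sdist_midAt, hP.side_midAt] at this
  linarith

theorem continuous_midAt (i : Fin n) : Continuous (midAt P i) := by
  unfold midAt
  have := hP.continuous_offset i
  have := continuous_lenAt P i
  fun_prop

theorem midAt_mem_strip {i : Fin n} {s : ℝ} {I : Set ℝ} (hs : s ∈ I) (h : 0 ≤ lenAt P i s) :
    midAt P i s ∈ strip P I i :=
  ⟨by rwa [hP.sdist_midAt], by rw [hP.side_midAt]; linarith,
    by rw [hP.side_midAt']; linarith⟩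

/-- Inside an edge the defining inequalities are strict and persist nearby. At a vertex the sign of
`side` there tells which of the two adjacent strips contains a nearby point. -/
theorem eventually_mem_strip {y : ℂ} (hy : y ∈ P.boundary ℝ) {δ : ℝ} (hδ : 0 < δ) :
    ∀ᶠ z in 𝓝 y, ∃ i, z ∈ strip P (Ioo (-δ) δ) i := by
  have hsd : ∀ j, sdist P j y = 0 → ∀ᶠ z in 𝓝 y, sdist P j z ∈ Ioo (-δ) δ := fun j hj =>
    ((continuous_sdist P j).tendsto y).eventually (isOpen_Ioo.mem_nhds (by
      rw [hj]; exact ⟨by linarith, hδ⟩))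
  have hpos : ∀ j, 0 < side P j y → ∀ᶠ z in 𝓝 y, 0 < side P j z := fun j hj =>
    ((continuous_side P j).tendsto y).eventually (lt_mem_nhds hj)
  have hneg : ∀ j, side P j y < 0 → ∀ᶠ z in 𝓝 y, side P j z < 0 := fun j hj =>
    ((continuous_side P j).tendsto y).eventually (gt_mem_nhds hj)
  have hvert : ∀ i, sdist P i y = 0 → side P (finRotate n i) y = 0 →
      ∀ᶠ z in 𝓝 y, ∃ i, z ∈ strip P (Ioo (-δ) δ) i := by
    intro i h0 h1
    have h2 := hP.sdist_finRotate i h1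
    rw [h0] at h2
    have h3 := hP.side_sub_side i y
    have h4 := hP.side_sub_side (finRotate n i) y
    rw [h1, h0] at h3
    rw [h1, h2] at h4
    simp only [lenAt, mul_zero, sub_zero, zero_sub] at h3 h4
    have h5 := hP.edgeLen_pos i
    have h6 := hP.edgeLen_pos (finRotate n i)
    filter_upwards [hsd i h0, hsd _ h2, hpos i (by linarith), hneg _ (by linarith :
      side P (finRotate n (finRotate n i)) y < 0)] with z hz1 hz2 hz3 hz4
    rcases le_total (side P (finRotate n i) z) 0 with h | h
    · exact ⟨i, hz1, hz3.le, h⟩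
    · exact ⟨finRotate n i, hz2, h, hz4.le⟩
  obtain ⟨i, hi⟩ := mem_boundary_iff.1 hy
  rw [hP.mem_segment_iff] at hi
  rcases hi.2.2.lt_or_eq with h1 | h1
  · rcases hi.2.1.lt_or_eq with h2 | h2
    · filter_upwards [hsd i hi.1, hpos _ h2, hneg _ h1] with z hz1 hz2 hz3
      exact ⟨i, hz1, hz2.le, hz3.le⟩
    · obtain ⟨j, rfl⟩ : ∃ j, i = finRotate n j :=
        ⟨(finRotate n).symm i, ((finRotate n).apply_symm_apply i).symm⟩
      refine hvert j ?_ h2.symm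
      rw [← hP.sdist_finRotate j h2.symm]; exact hi.1
  · exact hvert i hi.1 h1

theorem isPreconnected_iUnion_strip {I : Set ℝ} (hI : Convex ℝ I) {t : ℝ} (ht : t ∈ I)
    (hl : ∀ i, 0 < lenAt P i t) : IsPreconnected (⋃ i, strip P I i) := by
  refine isPreconnected_iUnion_cyclic (fun i => (convex_strip P hI i).isPreconnected)
    fun i => ⟨offset P t (finRotate n i), ?_, ?_⟩
  · have := (hP.mem_offset_segment_iff (hl i).le).1 (right_mem_segment ℝ _ _)
    exact ⟨by rw [this.1]; exact ht, this.2⟩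
  · have := (hP.mem_offset_segment_iff (hl (finRotate n i)).le).1 (left_mem_segment ℝ _ _)
    exact ⟨by rw [this.1]; exact ht, this.2⟩

/-- The segment from `x` to a nearest boundary point meets the boundary only at that end, which is
left out of `J`; close to this end it enters `U`. -/
theorem exists_mem_boundary_segment {x : ℂ} (hx : x ∉ P.boundary ℝ) {U : Set ℂ}
    (hU : ∀ y ∈ P.boundary ℝ, U ∈ 𝓝 y) :
    ∃ J, IsPreconnected J ∧ x ∈ J ∧ J ⊆ (P.boundary ℝ)ᶜ ∧ (J ∩ U).Nonempty := by
  have hne : (P.boundary ℝ).Nonempty :=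
    ⟨P ⟨0, by have := hP.three_le; omega⟩, left_mem_boundary P _⟩
  obtain ⟨y, hy, hxy⟩ := (isCompact_boundary P).exists_infDist_eq_dist hne x
  have hmin : ∀ z ∈ P.boundary ℝ, dist x y ≤ dist x z := fun z hz =>
    hxy ▸ Metric.infDist_le_dist_of_mem hz
  have hpos : 0 < dist x y := dist_pos.2 fun h => hx (h ▸ hy)
  let g : ℝ → ℂ := fun τ => y + τ * (x - y)
  have hg : Continuous g := by fun_prop
  refine ⟨g '' Ioc 0 1, isPreconnected_Ioc.image _ hg.continuousOn, ⟨1, by simp, by simp [g]⟩, ?_,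
    ?_⟩
  · rintro _ ⟨τ, hτ, rfl⟩ hmem
    have h1 := hmin _ hmem
    have h2 : dist x (g τ) = (1 - τ) * dist x y := by
      rw [dist_eq_norm, dist_eq_norm, show x - g τ = ((1 - τ : ℝ) : ℂ) * (x - y) by
        simp only [g]; push_cast; ring, norm_mul, Complex.norm_real,
        Real.norm_of_nonneg (by linarith [hτ.2])]
    rw [h2] at h1
    nlinarith [hτ.1]
  · have h0 : Tendsto g (𝓝[>] 0) (𝓝 y) := by
      have : g 0 = y := by simp [g]
      rw [← this]
      exact hg.continuousAt.tendsto.mono_left nhdsWithin_le_nhds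
    have h1 := h0.eventually (hU y hy)
    have h2 : ∀ᶠ τ in 𝓝[>] (0 : ℝ), τ ∈ Ioc (0 : ℝ) 1 := Ioc_mem_nhdsGT one_pos
    obtain ⟨τ, hτ1, hτ2⟩ := (h1.and h2).exists
    exact ⟨g τ, ⟨τ, hτ2, rfl⟩, hτ1⟩

/-- The winding numbers of a simple polygon are `0` and `1`, or `0` and `-1`, and the points of
winding number `0` lie in the unbounded component. -/
theorem jordan : ∃ k : ℤ, (k = 0 ∨ k = -1) ∧
    (∀ x ∉ P.boundary ℝ,
      argSum P x = 2 * Real.pi * k ∨ argSum P x = 2 * Real.pi * (k + 1 : ℤ)) ∧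
    ∀ x ∉ P.boundary ℝ, argSum P x = 0 →
      ¬ Bornology.IsBounded (connectedComponentIn (P.boundary ℝ)ᶜ x) := by
  obtain ⟨δ, hδ, h⟩ := Metric.eventually_nhds_iff.1 hP.eventually_offset_zero
  replace h : ∀ t ∈ Ioo (-δ) δ, (∀ i, 0 < lenAt P i t) ∧ IsSimple (offset P t) ∧
      (t ≠ 0 → ∀ z ∈ (offset P t).boundary ℝ, z ∉ P.boundary ℝ) := fun t ht => h (by
    rw [Real.dist_eq, sub_zero, abs_lt]; exact ht)
  -- The collars to the left (`A`) and to the right (`B`) of the polygon. Each is connected and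
  -- misses the polygon, so `argSum` is constant on it, and the two values differ by one turn.
  set A := ⋃ i, strip P (Ioo 0 δ) i with hA
  set B := ⋃ i, strip P (Ioo (-δ) 0) i with hB
  have hpA : δ / 2 ∈ Ioo 0 δ := ⟨by linarith, by linarith⟩
  have hpB : -(δ / 2) ∈ Ioo (-δ) 0 := ⟨by linarith, by linarith⟩
  have hAc : IsPreconnected A := hP.isPreconnected_iUnion_strip (convex_Ioo _ _) hpA
    (h _ ⟨by linarith, by linarith⟩).1
  have hBc : IsPreconnected B := hP.isPreconnected_iUnion_strip (convex_Ioo _ _) hpB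
    (h _ ⟨by linarith, by linarith⟩).1
  have hout : ∀ i z, z ∈ strip P (Ioo (-δ) δ) i → sdist P i z ≠ 0 → z ∉ P.boundary ℝ := by
    intro i z hz hne
    obtain ⟨h1, h2, h3⟩ := h _ hz.1
    exact h3 hne z ((hP.mem_offset_boundary_iff fun i => (h1 i).le).2 ⟨i, rfl, hz.2⟩)
  have hAΓ : ∀ z ∈ A, z ∉ P.boundary ℝ := by
    intro z hz
    obtain ⟨i, hi⟩ := mem_iUnion.1 hz
    exact hout i z ⟨⟨by linarith [hi.1.1], hi.1.2⟩, hi.2⟩ hi.1.1.ne'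
  have hBΓ : ∀ z ∈ B, z ∉ P.boundary ℝ := by
    intro z hz
    obtain ⟨i, hi⟩ := mem_iUnion.1 hz
    exact hout i z ⟨⟨hi.1.1, by linarith [hi.1.2]⟩, hi.2⟩ hi.1.2.ne
  -- every point off the polygon is joined to `A` or `B`
  have hjoin : ∀ x ∉ P.boundary ℝ, A ⊆ connectedComponentIn (P.boundary ℝ)ᶜ x ∨
      B ⊆ connectedComponentIn (P.boundary ℝ)ᶜ x := by
    intro x hx
    obtain ⟨J, hJ, hxJ, hJΓ, z, hzJ, i, hi⟩ := hP.exists_mem_boundary_segment hx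
      (U := {z | ∃ i, z ∈ strip P (Ioo (-δ) δ) i}) (fun y hy => hP.eventually_mem_strip hy hδ)
    rcases lt_trichotomy (sdist P i z) 0 with h0 | h0 | h0
    · right
      have hzB : z ∈ B := mem_iUnion.2 ⟨i, ⟨hi.1.1, h0⟩, hi.2⟩
      exact subset_union_right.trans ((hJ.union z hzJ hzB hBc).subset_connectedComponentIn
        (Or.inl hxJ) (union_subset hJΓ hBΓ))
    · exact (hJΓ hzJ (mem_boundary_iff.2 ⟨i, (hP.mem_segment_iff i).2 ⟨h0, hi.2⟩⟩)).elim
    · left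
      have hzA : z ∈ A := mem_iUnion.2 ⟨i, ⟨h0, hi.1.2⟩, hi.2⟩
      exact subset_union_right.trans ((hJ.union z hzJ hzA hAc).subset_connectedComponentIn
        (Or.inl hxJ) (union_subset hJΓ hAΓ))
  -- the values on `A` and `B`
  let i : Fin n := ⟨0, by have := hP.three_le; omega⟩
  have hl0 : ∀ i, 0 < lenAt P i 0 := (h 0 ⟨by linarith, hδ⟩).1
  obtain ⟨k, hk⟩ := hP.argSum_offset_jump (s := 0) (i := i) (y := midAt P i 0)
    (by rw [hP.offset_zero]; exact hP) hl0 (hP.sdist_midAt i 0)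
    (by rw [hP.side_midAt]; have := hl0 i; linarith)
    (by rw [hP.side_midAt']; have := hl0 i; linarith)
  have hk' : ∀ᶠ ε in 𝓝 (0 : ℝ), (0 < ε → argSum P (midAt P i ε) = 2 * Real.pi * (k + 1 : ℤ)) ∧
      (ε < 0 → argSum P (midAt P i ε) = 2 * Real.pi * k) := by
    have hc : Tendsto (fun ε : ℝ => ((0 : ℝ), midAt P i ε)) (𝓝 0) (𝓝 (0, midAt P i 0)) :=
      (continuous_const.prodMk (hP.continuous_midAt i)).tendsto 0
    filter_upwards [hc.eventually hk] with ε hε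
    simpa only [hP.sdist_midAt, hP.offset_zero] using hε
  have hmid : ∀ᶠ ε in 𝓝 (0 : ℝ), 0 < lenAt P i ε :=
    ((continuous_lenAt P i).tendsto 0).eventually (lt_mem_nhds (hl0 i))
  have hAv : ∀ z ∈ A, argSum P z = 2 * Real.pi * (k + 1 : ℤ) := by
    obtain ⟨ε, hε, hε2, hε3⟩ := (((hk'.and hmid).filter_mono (nhdsWithin_le_nhds (s := Ioi (0 : ℝ)))).and
      (Ioo_mem_nhdsGT hδ)).exists
    intro z hz
    rw [← hε.1.1 hε2]
    exact argSum_eq_of_isPreconnected hAc hAΓ hz (mem_iUnion.2 ⟨i,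
      hP.midAt_mem_strip ⟨hε2, hε3⟩ hε.2.le⟩)
  have hBv : ∀ z ∈ B, argSum P z = 2 * Real.pi * k := by
    obtain ⟨ε, hε, hε2, hε3⟩ := (((hk'.and hmid).filter_mono (nhdsWithin_le_nhds (s := Iio (0 : ℝ)))).and
      (Ioo_mem_nhdsLT (show -δ < 0 by linarith))).exists
    intro z hz
    rw [← hε.1.2 hε3]
    exact argSum_eq_of_isPreconnected hBc hBΓ hz (mem_iUnion.2 ⟨i,
      hP.midAt_mem_strip ⟨hε2, hε3⟩ hε.2.le⟩)
  have hAne : A.Nonempty := ⟨_, mem_iUnion.2 ⟨i, hP.midAt_mem_strip hpA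
    ((h _ ⟨by linarith, by linarith⟩).1 i).le⟩⟩
  have hBne : B.Nonempty := ⟨_, mem_iUnion.2 ⟨i, hP.midAt_mem_strip hpB
    ((h _ ⟨by linarith, by linarith⟩).1 i).le⟩⟩
  have hcomp : ∀ x ∉ P.boundary ℝ, ∀ z ∈ connectedComponentIn (P.boundary ℝ)ᶜ x,
      argSum P x = argSum P z := fun x hx z hz =>
    argSum_eq_of_isPreconnected isPreconnected_connectedComponentIn
      (fun w hw => connectedComponentIn_subset _ _ hw) (mem_connectedComponentIn hx) hz
  have hval : ∀ x ∉ P.boundary ℝ,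
      (A ⊆ connectedComponentIn (P.boundary ℝ)ᶜ x ∧ argSum P x = 2 * Real.pi * (k + 1 : ℤ)) ∨
      (B ⊆ connectedComponentIn (P.boundary ℝ)ᶜ x ∧ argSum P x = 2 * Real.pi * k) := by
    intro x hx
    rcases hjoin x hx with h1 | h1
    · obtain ⟨a, ha⟩ := hAne
      exact Or.inl ⟨h1, (hcomp x hx a (h1 ha)).trans (hAv a ha)⟩
    · obtain ⟨a, ha⟩ := hBne
      exact Or.inr ⟨h1, (hcomp x hx a (h1 ha)).trans (hBv a ha)⟩
  have hfar : ∀ᶠ x in Bornology.cobounded ℂ, x ∉ P.boundary ℝ ∧ argSum P x = 0 :=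
    Eventually.and (Bornology.isBounded_def.1 (isCompact_boundary P).isBounded)
      (argSum_cobounded P)
  have hpi := Real.pi_pos
  refine ⟨k, ?_, fun x hx => ?_, fun x hx h0 hbd => ?_⟩
  · obtain ⟨x, hx, hx0⟩ := hfar.exists
    rcases hval x hx with ⟨-, h1⟩ | ⟨-, h1⟩
    · right
      rw [hx0] at h1
      have : ((k + 1 : ℤ) : ℝ) = 0 := by
        rcases mul_eq_zero.1 h1.symm with h2 | h2
        · linarith
        · exact h2
      have : k + 1 = 0 := by exact_mod_cast this
      omega
    · left
      rw [hx0] at h1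
      have : (k : ℝ) = 0 := by
        rcases mul_eq_zero.1 h1.symm with h2 | h2
        · linarith
        · exact h2
      exact_mod_cast this
  · rcases hval x hx with ⟨-, h1⟩ | ⟨-, h1⟩
    · exact Or.inr h1
    · exact Or.inl h1
  -- A far point `x'` outside the bounded component also has winding number `0`. The collars carry
  -- different values, so `x` and `x'` reach the same collar and share a component.
  · obtain ⟨x', ⟨hx', hx0'⟩, hx2⟩ := (hfar.and (show ∀ᶠ x in Bornology.cobounded ℂ, x ∉ _ from
      Bornology.isBounded_def.1 hbd)).exists
    refine hx2 ?_
    have hsame : ∀ S : Set ℂ, S.Nonempty → S ⊆ connectedComponentIn (P.boundary ℝ)ᶜ x →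
        S ⊆ connectedComponentIn (P.boundary ℝ)ᶜ x' →
        x' ∈ connectedComponentIn (P.boundary ℝ)ᶜ x := by
      rintro S ⟨a, ha⟩ h1 h2
      rw [connectedComponentIn_eq (h1 ha), ← connectedComponentIn_eq (h2 ha)]
      exact mem_connectedComponentIn hx'
    have hkk : 2 * Real.pi * ((k + 1 : ℤ) : ℝ) ≠ 2 * Real.pi * k := by
      push_cast; intro h; nlinarith
    rcases hval x hx with ⟨h1, h2⟩ | ⟨h1, h2⟩ <;> rcases hval x' hx' with ⟨h3, h4⟩ | ⟨h3, h4⟩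
    · exact hsame A hAne h1 h3
    · exact (hkk (by linarith)).elim
    · exact (hkk (by linarith)).elim
    · exact hsame B hBne h1 h3

/-- From here on `fill` is handled through winding numbers, which, unlike components, can be
followed while the polygon moves. -/
theorem mem_fill_iff {x : ℂ} :
    x ∈ fill (P.boundary ℝ) ↔ x ∈ P.boundary ℝ ∨ argSum P x ≠ 0 := by
  obtain ⟨k, -, -, h⟩ := hP.jordan
  by_cases hx : x ∈ P.boundary ℝ
  · simp [fill, hx]
  · simp only [fill, mem_union, hx, false_or, mem_ofPred_eq, not_false_eq_true, true_and]
    exact ⟨fun h1 h2 => h x hx h2 h1, isBounded_connectedComponentIn_of_argSum_ne_zero hx⟩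

/-! ### Orientation: the inside of a counterclockwise polygon -/

theorem lenAt_zero_pos (i : Fin n) : 0 < lenAt P i 0 := by
  unfold lenAt; simpa using hP.edgeLen_pos i

theorem midAt_zero (i : Fin n) : midAt P i 0 = midpoint ℝ (P i) (P (finRotate n i)) := by
  unfold midAt lenAt
  have := hP.edgeLen_mul_edgeDir i
  rw [hP.offset_zero, midpoint_eq_smul_add]
  simp only [invOf_eq_inv, Complex.real_smul, mul_zero, sub_zero]
  push_cast
  linear_combination (1 / 2) * this

/-- Points just to the left of the midpoint are enclosed, so `k + 1 ≠ 0`. Both `k` and `k + 1` are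
among the two values `k'`, `k' + 1` with `k'` equal to `0` or `-1`; only `k = 0` remains. -/
theorem jump_zero_of_ccw (hc : IsCounterclockwise P) {i : Fin n} {k : ℤ}
    (hk : ∀ᶠ p : ℝ × ℂ in 𝓝 (0, midAt P i 0),
      (p.1 < sdist P i p.2 → argSum (offset P p.1) p.2 = 2 * Real.pi * (k + 1 : ℤ)) ∧
      (sdist P i p.2 < p.1 → argSum (offset P p.1) p.2 = 2 * Real.pi * k)) : k = 0 := by
  have hc' : Tendsto (fun ε : ℝ => ((0 : ℝ), midAt P i ε)) (𝓝 0) (𝓝 (0, midAt P i 0)) :=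
    (continuous_const.prodMk (hP.continuous_midAt i)).tendsto 0
  have hpi := Real.pi_pos
  let g : ℝ → ℂ := fun ε => midAt P i 0 + (ε : ℂ) * (Complex.I * (P (finRotate n i) - P i))
  have hg : Continuous g := by fun_prop
  have hg0 : g 0 = midAt P i 0 := by simp [g]
  have hsd : ∀ ε, sdist P i (g ε) = ε * edgeLen P i := by
    intro ε
    have hd := hP.edgeDir_ne_zero i
    have : (g ε - P i) / edgeDir P i =
        (midAt P i 0 - P i) / edgeDir P i + ((ε * edgeLen P i : ℝ) : ℂ) * Complex.I := by
      simp only [g]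
      rw [← hP.edgeLen_mul_edgeDir]; push_cast; field_simp; ring
    have h0 := hP.sdist_midAt i 0
    unfold sdist at h0 ⊢
    rw [this, Complex.add_im, h0]
    simp [-Complex.ofReal_mul]
  have hnb : ∀ᶠ ε in 𝓝[>] (0 : ℝ), g ε ∉ P.boundary ℝ ∧
      argSum P (g ε) = 2 * Real.pi * (k + 1 : ℤ) := by
    have h1 : Tendsto (fun ε => ((0 : ℝ), g ε)) (𝓝[>] 0) (𝓝 (0, midAt P i 0)) := by
      rw [← hg0]
      exact ((continuous_const.prodMk hg).tendsto 0).mono_left nhdsWithin_le_nhds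
    obtain ⟨δ, hδ, h⟩ := Metric.eventually_nhds_iff.1 hP.eventually_offset_zero
    have h2 : Tendsto g (𝓝[>] 0) (𝓝 (midAt P i 0)) := by
      rw [← hg0]; exact (hg.tendsto 0).mono_left nhdsWithin_le_nhds
    have hl := hP.lenAt_zero_pos i
    have h3 : ∀ᶠ z in 𝓝 (midAt P i 0), dist (sdist P i z) 0 < δ ∧ 0 < side P i z ∧
        side P (finRotate n i) z < 0 := by
      refine (((continuous_sdist P i).tendsto _).eventually
        (Metric.ball_mem_nhds _ hδ)).and ((((continuous_side P i).tendsto _).eventually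
        (lt_mem_nhds ?_)).and (((continuous_side P _).tendsto _).eventually
        (gt_mem_nhds ?_))) |>.mono fun z hz => ⟨?_, hz.2⟩
      · rw [hP.side_midAt]; linarith
      · rw [hP.side_midAt']; linarith
      · have := hz.1; rwa [hP.sdist_midAt] at this
    filter_upwards [h1.eventually hk, h2.eventually h3, self_mem_nhdsWithin] with ε h4 h5 h6
    have h6 : (0 : ℝ) < ε := h6
    have h7 : 0 < sdist P i (g ε) := by rw [hsd]; exact mul_pos h6 (hP.edgeLen_pos i)
    refine ⟨(h h5.1).2.2 h7.ne' _ ((hP.mem_offset_boundary_iff fun j => ((h h5.1).1 j).le).2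
      ⟨i, rfl, h5.2.1.le, h5.2.2.le⟩), ?_⟩
    have := h4.1 h7
    rwa [hP.offset_zero] at this
  obtain ⟨ε, ⟨h1, h2⟩, h3⟩ := (hnb.and (hc i)).exists
  rw [← hP.midAt_zero] at h3
  have h4 := (hP.mem_fill_iff.1 h3).resolve_left h1
  obtain ⟨k', hk', hv, -⟩ := hP.jordan
  have h5 : ∀ᶠ ε in 𝓝[<] (0 : ℝ), argSum P (midAt P i ε) = 2 * Real.pi * k := by
    filter_upwards [nhdsWithin_le_nhds (hc'.eventually hk), self_mem_nhdsWithin] with ε h6 h7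
    have := h6.2 (by rw [hP.sdist_midAt]; exact h7)
    rwa [hP.offset_zero] at this
  have h6 : ∀ᶠ ε in 𝓝[<] (0 : ℝ), midAt P i ε ∉ P.boundary ℝ := by
    filter_upwards [nhdsWithin_le_nhds hP.eventually_offset_zero, self_mem_nhdsWithin] with ε h6 h7
    exact h6.2.2 (ne_of_lt h7) _ ((hP.mem_offset_boundary_iff fun j => (h6.1 j).le).2
      ⟨i, hP.midAt_mem_strip rfl (h6.1 i).le⟩)
  obtain ⟨ε', h7, h8⟩ := (h5.and h6).exists
  have hcancel : ∀ a b : ℤ, 2 * Real.pi * (a : ℝ) = 2 * Real.pi * b → a = b := fun a b hab => by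
    exact_mod_cast mul_left_cancel₀ (by positivity) hab
  have hk1 : k + 1 ≠ 0 := by
    intro h0; rw [h2, h0] at h4; simp at h4
  have ha := hv _ h1
  have hb := hv _ h8
  rw [h2] at ha
  rw [h7] at hb
  have ha' : k + 1 = k' ∨ k + 1 = k' + 1 := ha.imp (hcancel _ _) (hcancel _ _)
  have hb' : k = k' ∨ k = k' + 1 := hb.imp (hcancel _ _) (hcancel _ _)
  omega

/-- For a counterclockwise polygon, the winding number is `1` to the left and `0` to the right of
each edge. -/
theorem argSum_left_right (hc : IsCounterclockwise P) {i : Fin n} {y : ℂ}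
    (h0 : sdist P i y = 0) (h1 : 0 < side P i y) (h2 : side P (finRotate n i) y < 0) :
    ∀ᶠ z in 𝓝 y, (0 < sdist P i z → z ∉ P.boundary ℝ ∧ argSum P z = 2 * Real.pi) ∧
      (sdist P i z < 0 → z ∉ P.boundary ℝ ∧ argSum P z = 0) := by
  have hP0 : IsSimple (offset P 0) := by rwa [hP.offset_zero]
  have hl := hP.lenAt_zero_pos
  obtain ⟨δ, hδ, h⟩ := Metric.eventually_nhds_iff.1 hP.eventually_offset_zero
  obtain ⟨k, hk⟩ := hP.argSum_offset_jump hP0 hl h0 h1 h2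
  obtain ⟨k₀, hk₀⟩ := hP.argSum_offset_jump hP0 hl (i := i) (y := midAt P i 0)
    (hP.sdist_midAt i 0) (by rw [hP.side_midAt]; have := hl i; linarith)
    (by rw [hP.side_midAt']; have := hl i; linarith)
  have hk0' := hP.jump_zero_of_ccw hc hk₀
  subst hk0'
  have hnear : ∀ w, sdist P i w = 0 → 0 < side P i w → side P (finRotate n i) w < 0 →
      ∀ᶠ z in 𝓝 w, dist (sdist P i z) 0 < δ ∧ 0 < side P i z ∧
        side P (finRotate n i) z < 0 := by
    intro w hw0 hw1 hw2
    refine (((continuous_sdist P i).tendsto _).eventually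
      (Metric.ball_mem_nhds _ hδ)).and ((((continuous_side P i).tendsto _).eventually
      (lt_mem_nhds hw1)).and (((continuous_side P _).tendsto _).eventually
      (gt_mem_nhds hw2))) |>.mono fun z hz => ⟨?_, hz.2⟩
    have := hz.1; rwa [hw0] at this
  have hnb : ∀ z, dist (sdist P i z) 0 < δ ∧ 0 < side P i z ∧
        side P (finRotate n i) z < 0 → sdist P i z ≠ 0 → z ∉ P.boundary ℝ := fun z hz hne =>
    (h hz.1).2.2 hne _ ((hP.mem_offset_boundary_iff fun j => ((h hz.1).1 j).le).2
      ⟨i, rfl, hz.2.1.le, hz.2.2.le⟩)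
  -- the left side of the edge near `y` is joined to the one near the midpoint
  have hk0 : k = 0 := by
    have hconv : Convex ℝ {z | (0 < sdist P i z ∧ sdist P i z < δ) ∧ 0 < side P i z ∧
        side P (finRotate n i) z < 0} := by
      intro z hz w hw a b ha hb hab
      simp only [mem_ofPred_eq, sdist_combo _ _ _ _ hab, side_combo _ _ _ _ hab] at hz hw ⊢
      rcases ha.lt_or_eq with ha | rfl
      · refine ⟨⟨?_, ?_⟩, ?_, ?_⟩ <;> nlinarith
      · have : b = 1 := by linarith
        subst this
        simpa using hw
    have hg : ∀ w, sdist P i w = 0 → 0 < side P i w → side P (finRotate n i) w < 0 →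
        ∀ l : ℤ, (∀ᶠ p : ℝ × ℂ in 𝓝 (0, w),
      (p.1 < sdist P i p.2 → argSum (offset P p.1) p.2 = 2 * Real.pi * (l + 1 : ℤ)) ∧
      (sdist P i p.2 < p.1 → argSum (offset P p.1) p.2 = 2 * Real.pi * l)) →
        ∃ z, ((0 < sdist P i z ∧ sdist P i z < δ) ∧ 0 < side P i z ∧
        side P (finRotate n i) z < 0) ∧ argSum P z = 2 * Real.pi * (l + 1 : ℤ) := by
      intro w hw0 hw1 hw2 l hl'
      let g : ℝ → ℂ := fun ε => w + ε * miter P i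
      have hg : Continuous g := by fun_prop
      have hg0 : g 0 = w := by simp [g]
      have hsd : ∀ ε, sdist P i (g ε) = ε := fun ε =>
        (hP.side_sdist_of_eq (ξ := side P i w) (by
          have := hP.eq_start i w
          rw [hw0] at this
          simp only [g]; push_cast at this ⊢; linear_combination this)).2
      have hge : Tendsto g (𝓝[>] 0) (𝓝 w) := by
        rw [← hg0]; exact (hg.tendsto 0).mono_left nhdsWithin_le_nhds
      have hge2 : Tendsto (fun ε => ((0 : ℝ), g ε)) (𝓝[>] 0) (𝓝 (0, w)) :=
        tendsto_const_nhds.prodMk_nhds hge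
      obtain ⟨ε, ⟨h5, h6⟩, h7⟩ := (((hge.eventually (hnear w hw0 hw1 hw2)).and
        (hge2.eventually hl')).and self_mem_nhdsWithin).exists
      have h7 : 0 < ε := h7
      have h8 := h5.1
      rw [hsd, dist_zero_right, Real.norm_of_nonneg h7.le] at h8
      refine ⟨g ε, ⟨⟨by rwa [hsd], by rwa [hsd]⟩, h5.2⟩, ?_⟩
      have := h6.1 (by rw [hsd]; exact h7)
      rwa [hP.offset_zero] at this
    obtain ⟨z, hz, hz'⟩ := hg y h0 h1 h2 k hk
    obtain ⟨w, hw, hw'⟩ := hg (midAt P i 0) (hP.sdist_midAt i 0)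
      (by rw [hP.side_midAt]; have := hl i; linarith)
      (by rw [hP.side_midAt']; have := hl i; linarith) 0 hk₀
    have := argSum_eq_of_isPreconnected (P := P) hconv.isPreconnected (fun x hx =>
      hnb x ⟨by rw [dist_zero_right, Real.norm_of_nonneg hx.1.1.le]; exact hx.1.2, hx.2⟩
        hx.1.1.ne') hz hw
    rw [hz', hw'] at this
    have := mul_left_cancel₀ (by have := Real.pi_pos; positivity) this
    have : k + 1 = 0 + 1 := by exact_mod_cast this
    omega
  subst hk0
  have h3 : Tendsto (fun z : ℂ => ((0 : ℝ), z)) (𝓝 y) (𝓝 (0, y)) :=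
    (continuous_const.prodMk continuous_id).tendsto y
  filter_upwards [h3.eventually hk, hnear y h0 h1 h2] with z hz hz2
  rw [hP.offset_zero] at hz
  refine ⟨fun h => ⟨hnb z hz2 h.ne', ?_⟩, fun h => ⟨hnb z hz2 h.ne, ?_⟩⟩
  · have := hz.1 h; simpa using this
  · have := hz.2 h; simpa using this

/-- The value `2 * π` does occur, just to the left of an edge, and this excludes the pair `-2 * π`,
`0`. -/
theorem argSum_eq_zero_or (hc : IsCounterclockwise P) {x : ℂ} (hx : x ∉ P.boundary ℝ) :
    argSum P x = 0 ∨ argSum P x = 2 * Real.pi := by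
  obtain ⟨k, hk, hv, -⟩ := hP.jordan
  let i : Fin n := ⟨0, by have := hP.three_le; omega⟩
  have hl := hP.lenAt_zero_pos i
  have h := hP.argSum_left_right hc (i := i) (y := midAt P i 0) (hP.sdist_midAt i 0)
    (by rw [hP.side_midAt]; linarith) (by rw [hP.side_midAt']; linarith)
  have h2 := (((hP.continuous_midAt i).tendsto 0).eventually h).filter_mono
    (nhdsWithin_le_nhds (s := Ioi 0))
  obtain ⟨ε, h3, h4⟩ := (h2.and self_mem_nhdsWithin).exists
  obtain ⟨h5, h6⟩ := h3.1 (by rw [hP.sdist_midAt]; exact h4)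
  have hpi := Real.pi_pos
  have h7 := hv _ h5
  rw [h6] at h7
  rcases hk with rfl | rfl
  · simpa using hv x hx
  · exfalso
    norm_num at h7
    linarith

theorem mem_fill_iff_of_ccw (hc : IsCounterclockwise P) {x : ℂ} :
    x ∈ fill (P.boundary ℝ) ↔ x ∈ P.boundary ℝ ∨ argSum P x = 2 * Real.pi := by
  rw [hP.mem_fill_iff]
  by_cases hx : x ∈ P.boundary ℝ
  · simp [hx]
  · simp only [hx, false_or]
    have := Real.pi_pos
    rcases hP.argSum_eq_zero_or hc hx with h | h <;> rw [h]
    · simp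
    · simp

end IsSimple

/-! ### The region swept by the mitered offset -/

namespace IsSimple

variable {n : ℕ} {P : Polygon ℂ n} (hP : IsSimple P) (hc : IsCounterclockwise P) {b : ℝ}
  (hb : IsMiteredOffset P b)
include hP hc hb

/-- Counterclockwise orientation persists during the motion. At each time the jump has a unique `k`;
the jump statement holds on a neighbourhood in time and space jointly, so `k` is locally constant in
time. It is `0` at time `0`, and the time interval is connected. -/
theorem jump_offset (i : Fin n) {s : ℝ} (hs : s ∈ Icc 0 b) :
    ∀ᶠ p : ℝ × ℂ in 𝓝 (s, midAt P i s),
      (p.1 < sdist P i p.2 → argSum (offset P p.1) p.2 = 2 * Real.pi) ∧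
      (sdist P i p.2 < p.1 → argSum (offset P p.1) p.2 = 0) := by
  let Q : ℤ → ℝ → Prop := fun k s => ∀ᶠ p : ℝ × ℂ in 𝓝 (s, midAt P i s),
      (p.1 < sdist P i p.2 → argSum (offset P p.1) p.2 = 2 * Real.pi * (k + 1 : ℤ)) ∧
      (sdist P i p.2 < p.1 → argSum (offset P p.1) p.2 = 2 * Real.pi * k)
  have hex : ∀ s ∈ Icc 0 b, ∃ k, Q k s := by
    intro s hs
    have hl := fun i => hP.lenAt_pos hb i hs
    exact hP.argSum_offset_jump (hb.2 s hs) hl (hP.sdist_midAt i s)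
      (by rw [hP.side_midAt]; have := hl i; linarith)
      (by rw [hP.side_midAt']; have := hl i; linarith)
  have hcm : Continuous fun s => (s, midAt P i s) :=
    continuous_id.prodMk (hP.continuous_midAt i)
  have huniq : ∀ k l s, Q k s → Q l s → k = l := by
    intro k l s hk hl
    have hc1 : Tendsto (fun ε => (s, midAt P i ε)) (𝓝[<] s) (𝓝 (s, midAt P i s)) :=
      ((continuous_const.prodMk (hP.continuous_midAt i)).tendsto s).mono_left nhdsWithin_le_nhds
    obtain ⟨ε, ⟨h1, h2⟩, h3⟩ := (((hc1.eventually hk).and (hc1.eventually hl)).and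
      self_mem_nhdsWithin).exists
    have h4 := (h1.2 (by rw [hP.sdist_midAt]; exact h3)).symm.trans
      (h2.2 (by rw [hP.sdist_midAt]; exact h3))
    have := mul_left_cancel₀ (by have := Real.pi_pos; positivity) h4
    exact_mod_cast this
  have hloc : ∀ k s, Q k s → ∀ᶠ s' in 𝓝 s, Q k s' := fun k s h =>
    (hcm.tendsto s).eventually (eventually_eventually_nhds.2 h)
  have h0 : Q 0 0 := by
    obtain ⟨k, hk⟩ := hex 0 ⟨le_rfl, hb.1.le⟩
    have := hP.jump_zero_of_ccw hc hk
    rwa [this] at hk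
  have key : Q 0 0 = Q 0 s := by
    refine eq_of_isPreconnected (f := Q 0) (isPreconnected_Icc (a := 0) (b := b))
      (fun x hx => ?_) ⟨le_rfl, hb.1.le⟩ hs
    obtain ⟨k, hk⟩ := hex x hx
    filter_upwards [nhdsWithin_le_nhds (hloc k x hk)] with y hy
    by_cases hk0 : k = 0
    · subst hk0; exact propext ⟨fun _ => hk, fun _ => hy⟩
    · exact propext ⟨fun h => (hk0 (huniq _ _ _ hy h)).elim,
        fun h => (hk0 (huniq _ _ _ hk h)).elim⟩
  have := key ▸ h0
  simpa [Q] using this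

/-- For nearby `t ≠ s` the curve at time `s` is a connected set missing the curve at time `t`. Hence
all its points have the same winding number, which is known at the midpoint of one edge. -/
theorem argSum_offset_near {s : ℝ} (hs : s ∈ Icc 0 b) {x : ℂ}
    (hx : x ∈ (offset P s).boundary ℝ) :
    ∀ᶠ t in 𝓝 s, (s < t → x ∉ (offset P t).boundary ℝ ∧ argSum (offset P t) x = 0) ∧
      (t < s → x ∉ (offset P t).boundary ℝ ∧ argSum (offset P t) x = 2 * Real.pi) := by
  let i : Fin n := ⟨0, by have := hP.three_le; omega⟩
  have hl := fun i => hP.lenAt_pos hb i hs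
  have h1 := hP.jump_offset hc hb i hs
  have h2 : Tendsto (fun t => (t, midAt P i s)) (𝓝 s) (𝓝 (s, midAt P i s)) :=
    (continuous_id.prodMk continuous_const).tendsto s
  filter_upwards [h2.eventually h1, hP.eventually_offset (hb.2 s hs) hl] with t h3 h4
  have hy : midAt P i s ∈ (offset P s).boundary ℝ :=
    (hP.mem_offset_boundary_iff fun i => (hl i).le).2 ⟨i, hP.midAt_mem_strip rfl (hl i).le⟩
  have hdis : t ≠ s → ∀ z ∈ (offset P s).boundary ℝ, z ∉ (offset P t).boundary ℝ :=
    fun hne z hz hz' => h4.2.2 hne z hz' hz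
  have heq : t ≠ s → argSum (offset P t) x = argSum (offset P t) (midAt P i s) := fun hne =>
    argSum_eq_of_isPreconnected (isPreconnected_boundary (offset P s)) (hdis hne) hx hy
  rw [hP.sdist_midAt] at h3
  exact ⟨fun h => ⟨hdis h.ne' x hx, (heq h.ne').trans (h3.2 h)⟩,
    fun h => ⟨hdis h.ne x hx, (heq h.ne).trans (h3.1 h)⟩⟩

/-- A point passed by the moving polygon stays outside. -/
theorem argSum_offset_after {s t : ℝ} (hs : 0 ≤ s) (hst : s < t) (ht : t ≤ b) {x : ℂ}
    (hx : x ∈ (offset P s).boundary ℝ) :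
    x ∉ (offset P t).boundary ℝ ∧ argSum (offset P t) x = 0 := by
  by_contra hbad
  -- The bad times after `s`. Their infimum exceeds `s`, because the claim holds immediately after
  -- the point has been passed.
  let B : Set ℝ := {t | s < t ∧ t ≤ b ∧
    ¬ (x ∉ (offset P t).boundary ℝ ∧ argSum (offset P t) x = 0)}
  have hne : B.Nonempty := ⟨t, hst, ht, hbad⟩
  have hbdd : BddBelow B := ⟨s, fun u hu => hu.1.le⟩
  set τ := sInf B with hτ
  have hτt : τ ≤ t := csInf_le hbdd ⟨hst, ht, hbad⟩
  have hsτ : s < τ := by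
    obtain ⟨ε, hε, h⟩ := Metric.eventually_nhds_iff.1
      (hP.argSum_offset_near hc hb ⟨hs, (hst.le.trans ht)⟩ hx)
    have : s + ε ≤ τ := le_csInf hne fun u hu => by
      by_contra hlt
      exact hu.2.2 ((h (by rw [Real.dist_eq, abs_of_pos (by linarith [hu.1])]; linarith)).1 hu.1)
    linarith
  have hτm : τ ∈ Icc 0 b := ⟨by linarith, by linarith⟩
  have hgood : ∀ u, s < u → u < τ →
      x ∉ (offset P u).boundary ℝ ∧ argSum (offset P u) x = 0 := by
    intro u h1 h2
    by_contra h3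
    exact (notMem_of_lt_csInf h2 hbdd) ⟨h1, by linarith [hτm.2], h3⟩
  have hIoo : ∀ᶠ u in 𝓝[<] τ, u ∈ Ioo s τ := Ioo_mem_nhdsLT hsτ
  -- If the point were hit again at `τ`, it would be enclosed just before `τ`, contrary to the claim
  -- there. If it is not hit, the claim extends beyond `τ`, contrary to the choice of `τ`.
  by_cases hmem : x ∈ (offset P τ).boundary ℝ
  · obtain ⟨u, h1, h2⟩ := (((hP.argSum_offset_near hc hb hτm hmem).filter_mono
      nhdsWithin_le_nhds).and hIoo).exists
    have h3 := (h1.2 h2.2).2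
    rw [(hgood u h2.1 h2.2).2] at h3
    linarith [Real.pi_pos]
  · have h1 := argSum_eventually_eq (V := fun t => offset P t) (y := fun _ => x) (s₀ := τ)
      (fun i => (hP.continuous_offset i).continuousAt) continuousAt_const hmem
    have h2 := eventually_notMem_boundary (V := fun t => offset P t) (y := fun _ => x) (s := τ)
      (fun i => (hP.continuous_offset i).continuousAt) continuousAt_const hmem
    obtain ⟨u, h3, h4⟩ := ((h1.filter_mono nhdsWithin_le_nhds).and hIoo).exists
    rw [(hgood u h4.1 h4.2).2] at h3
    obtain ⟨ε, hε, h⟩ := Metric.eventually_nhds_iff.1 (h1.and h2)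
    obtain ⟨v, hv, hvε⟩ := exists_lt_of_csInf_lt hne (show sInf B < τ + ε by linarith)
    have hτv : τ ≤ v := csInf_le hbdd hv
    obtain ⟨h5, h6⟩ := h (show dist v τ < ε by
      rw [Real.dist_eq, abs_of_nonneg (by linarith)]; linarith)
    exact hv.2.2 ⟨h6, h5.trans h3.symm⟩

/-- A point enclosed at time `s` was not passed earlier, since it would then be outside by now. So
its winding number is constant on `[0, s)`, and the value `0` is incompatible with lying on or
inside the curve at time `s`. -/
theorem interior_of_mem_fill_offset {s : ℝ} (hs : 0 < s) (hsb : s ≤ b) {x : ℂ}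
    (hx : x ∈ fill ((offset P s).boundary ℝ)) :
    x ∉ P.boundary ℝ ∧ argSum P x = 2 * Real.pi := by
  have hsm : s ∈ Icc 0 b := ⟨hs.le, hsb⟩
  rw [(hb.2 s hsm).mem_fill_iff] at hx
  have hnot : ∀ t, 0 ≤ t → t < s → x ∉ (offset P t).boundary ℝ := by
    intro t ht hts hmem
    obtain ⟨h1, h2⟩ := hP.argSum_offset_after hc hb ht hts hsb hmem
    exact hx.elim h1 fun h => h h2
  have h0 : x ∉ P.boundary ℝ := by
    have := hnot 0 le_rfl hs
    rwa [hP.offset_zero] at this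
  have hloc : ∀ t, x ∉ (offset P t).boundary ℝ →
      ∀ᶠ u in 𝓝 t, argSum (offset P u) x = argSum (offset P t) x := fun t ht =>
    argSum_eventually_eq (V := fun t => offset P t) (y := fun _ => x)
      (fun i => (hP.continuous_offset i).continuousAt) continuousAt_const ht
  refine ⟨h0, (hP.argSum_eq_zero_or hc h0).resolve_left fun hzero => ?_⟩
  have hconst : ∀ t ∈ Ico 0 s, argSum (offset P t) x = 0 := by
    intro t ht
    rw [← hzero]
    have := eq_of_isPreconnected (f := fun t => argSum (offset P t) x)
      (isPreconnected_Ico (a := 0) (b := s))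
      (fun u hu => nhdsWithin_le_nhds (hloc u (hnot u hu.1 hu.2))) ht ⟨le_rfl, hs⟩
    simpa only [hP.offset_zero] using this
  have hIco : ∀ᶠ u in 𝓝[<] s, u ∈ Ico 0 s := Ico_mem_nhdsLT hs
  by_cases hmem : x ∈ (offset P s).boundary ℝ
  · obtain ⟨u, h1, h2⟩ := (((hP.argSum_offset_near hc hb hsm hmem).filter_mono
      nhdsWithin_le_nhds).and hIco).exists
    have h3 := (h1.2 h2.2).2
    rw [hconst u h2] at h3
    linarith [Real.pi_pos]
  · obtain ⟨u, h1, h2⟩ := (((hloc s hmem).filter_mono nhdsWithin_le_nhds).and hIco).exists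
    rw [hconst u h2] at h1
    exact (hx.resolve_left hmem) h1.symm

/-- The strips swept by distinct edges meet only along the bisectors. -/
theorem strip_inter {i j : Fin n} {x : ℂ} (hi : x ∈ strip P (Icc 0 b) i)
    (hj : x ∈ strip P (Icc 0 b) j) :
    i = j ∨ (j = finRotate n i ∧ side P j x = 0) ∨ (i = finRotate n j ∧ side P i x = 0) := by
  have hmem : ∀ k, x ∈ strip P (Icc 0 b) k → x ∈ (offset P (sdist P k x)).boundary ℝ :=
    fun k hk => (hP.mem_offset_boundary_iff fun l => (hP.lenAt_pos hb l hk.1).le).2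
      ⟨k, rfl, hk.2⟩
  -- The point lies on the moving curve at both times, and a point passed at one time is not on the
  -- curve later.
  have hsame : sdist P i x = sdist P j x := by
    rcases lt_trichotomy (sdist P i x) (sdist P j x) with h | h | h
    · exact ((hP.argSum_offset_after hc hb hi.1.1 h hj.1.2 (hmem i hi)).1 (hmem j hj)).elim
    · exact h
    · exact ((hP.argSum_offset_after hc hb hj.1.1 h hi.1.2 (hmem j hj)).1 (hmem i hi)).elim
  by_cases h1 : i = j
  · exact Or.inl h1
  by_cases h2 : j = finRotate n i
  · subst h2
    exact Or.inr (Or.inl ⟨rfl, (hP.eq_offset_of_mem_strip hi hj).2.1⟩)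
  by_cases h3 : i = finRotate n j
  · subst h3
    exact Or.inr (Or.inr ⟨rfl, (hP.eq_offset_of_mem_strip hj hi).2.1⟩)
  have := (hb.2 _ hi.1).disjoint i j h1 h2 h3
  rw [edgeSet_eq_segment, edgeSet_eq_segment] at this
  refine (disjoint_left.1 this ((hP.mem_offset_segment_iff (hP.lenAt_pos hb i hi.1).le).2
    ⟨rfl, hi.2⟩) ((hP.mem_offset_segment_iff (hP.lenAt_pos hb j hi.1).le).2
    ⟨hsame.symm, hj.2⟩)).elim

/-- A point swept before time `b` is outside the curve at time `b`. -/
theorem strip_inter_fill {i : Fin n} {x : ℂ} (hi : x ∈ strip P (Icc 0 b) i)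
    (hx : x ∈ fill ((offset P b).boundary ℝ)) : sdist P i x = b := by
  rw [(hb.2 b ⟨hb.1.le, le_rfl⟩).mem_fill_iff] at hx
  by_contra hne
  obtain ⟨h1, h2⟩ := hP.argSum_offset_after hc hb hi.1.1 (lt_of_le_of_ne hi.1.2 hne) le_rfl
    ((hP.mem_offset_boundary_iff fun l => (hP.lenAt_pos hb l hi.1).le).2 ⟨i, rfl, hi.2⟩)
  exact hx.elim h1 fun h => h h2

theorem interior_of_mem_strip {i : Fin n} {x : ℂ} (hi : x ∈ strip P (Icc 0 b) i)
    (h0 : sdist P i x ≠ 0) : x ∉ P.boundary ℝ ∧ argSum P x = 2 * Real.pi :=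
  hP.interior_of_mem_fill_offset hc hb (lt_of_le_of_ne hi.1.1 h0.symm) hi.1.2
    (Or.inl ((hP.mem_offset_boundary_iff fun l => (hP.lenAt_pos hb l hi.1).le).2 ⟨i, rfl, hi.2⟩))

theorem mem_region_of_mem_strip {i : Fin n} {x : ℂ} (hi : x ∈ strip P (Icc 0 b) i) :
    x ∈ fill (P.boundary ℝ) := by
  rw [hP.mem_fill_iff_of_ccw hc]
  by_cases h0 : sdist P i x = 0
  · exact Or.inl (mem_boundary_iff.2 ⟨i, (hP.mem_segment_iff i).2 ⟨h0, hi.2⟩⟩)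
  · exact Or.inr (hP.interior_of_mem_strip hc hb hi h0).2

end IsSimple

/-! ### Polygonal cells that meet in faces -/

theorem IsSimple.edge_inter {n : ℕ} {P : Polygon ℂ n} (hP : IsSimple P) {i j : Fin n} {x : ℂ}
    (hi : x ∈ segment ℝ (P i) (P (finRotate n i))) (hj : x ∈ segment ℝ (P j) (P (finRotate n j))) :
    i = j ∨ (j = finRotate n i ∧ x = P j) ∨ (i = finRotate n j ∧ x = P i) := by
  by_cases h1 : i = j
  · exact Or.inl h1
  rw [← edgeSet_eq_segment] at hi hj
  by_cases h2 : j = finRotate n i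
  · subst h2
    exact Or.inr (Or.inl ⟨rfl, (hP.adjacent i).le ⟨hi, hj⟩⟩)
  by_cases h3 : i = finRotate n j
  · subst h3
    exact Or.inr (Or.inr ⟨rfl, (hP.adjacent j).le ⟨hj, hi⟩⟩)
  exact (disjoint_left.1 (hP.disjoint i j h1 h2 h3) hi hj).elim

theorem IsSimple.vertex_mem_edge {n : ℕ} {P : Polygon ℂ n} (hP : IsSimple P) {i j : Fin n}
    (h : P j ∈ segment ℝ (P i) (P (finRotate n i))) : j = i ∨ j = finRotate n i := by
  rcases hP.edge_inter h (left_mem_segment ℝ (P j) _) with h | ⟨h, -⟩ | ⟨-, h⟩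
  · exact Or.inl h.symm
  · exact Or.inr h
  · exact Or.inl (hP.injective h)

theorem IsSimple.side_of_openSegment {n : ℕ} {P : Polygon ℂ n} (hP : IsSimple P) {i : Fin n}
    {y : ℂ} (hy : y ∈ segment ℝ (P i) (P (finRotate n i))) (h1 : y ≠ P i)
    (h2 : y ≠ P (finRotate n i)) :
    sdist P i y = 0 ∧ 0 < side P i y ∧ side P (finRotate n i) y < 0 := by
  have hy' := (hP.mem_segment_iff i).1 hy
  have h0 : sdist P i y = 0 := hy'.1
  refine ⟨h0, lt_of_le_of_ne hy'.2.1 fun h => h1 ?_, lt_of_le_of_ne hy'.2.2 fun h => h2 ?_⟩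
  · have := hP.eq_offset h.symm
    rwa [h0, hP.offset_zero] at this
  · have := hP.eq_offset h
    rwa [hP.sdist_finRotate i h, h0, hP.offset_zero] at this

namespace PolygonCell

/-- The `i`-th edge of a polygonal cell. -/
def edge (P : PolygonCell) (i : Fin P.n) : Sym2 ℂ := s(P.bd i, P.bd (finRotate P.n i))

variable {P Q : PolygonCell}

theorem mem_edges_iff {e : Sym2 ℂ} : e ∈ P.edges ↔ ∃ i, e = P.edge i := Iff.rfl

theorem edge_mem_edges (i : Fin P.n) : P.edge i ∈ P.edges := ⟨i, rfl⟩

theorem edge_injective : Function.Injective P.edge := by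
  intro i j h
  rcases Sym2.eq_iff.1 h with ⟨h1, -⟩ | ⟨h1, h2⟩
  · exact P.simple.injective h1
  · have h1 := P.simple.injective h1
    have h2 := P.simple.injective h2
    exact (finRotate_finRotate_ne_self P.simple.three_le j (by rw [← h1, h2])).elim

/-- The open cell. -/
def inner (P : PolygonCell) : Set ℂ := {x | x ∉ P.bd.boundary ℝ ∧ argSum P.bd x = 2 * Real.pi}

theorem mem_region_iff {x : ℂ} : x ∈ P.region ↔ x ∈ P.bd.boundary ℝ ∨ x ∈ P.inner := by
  unfold region inner
  rw [P.simple.mem_fill_iff_of_ccw P.ccw]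
  by_cases hx : x ∈ P.bd.boundary ℝ
  · simp [hx]
  · simp [hx]

theorem boundary_subset_region : P.bd.boundary ℝ ⊆ P.region := fun _ h => Or.inl h

theorem segment_subset_boundary (i : Fin P.n) :
    segment ℝ (P.bd i) (P.bd (finRotate _ i)) ⊆ P.bd.boundary ℝ := fun _ h =>
  mem_boundary_iff.2 ⟨i, h⟩

theorem isOpen_inner : IsOpen P.inner := by
  rw [isOpen_iff_mem_nhds]
  intro x hx
  have h1 := argSum_eventually_eq (V := fun _ : ℂ => P.bd) (y := id) (s₀ := x)
    (fun _ => continuousAt_const) continuousAt_id hx.1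
  have h2 := (isCompact_boundary P.bd).isClosed.isOpen_compl.mem_nhds hx.1
  filter_upwards [h1, h2] with y hy1 hy2
  exact ⟨hy2, hy1.trans hx.2⟩

theorem isClosed_region : IsClosed P.region := by
  rw [← isOpen_compl_iff, isOpen_iff_mem_nhds]
  intro x hx
  rw [mem_compl_iff, mem_region_iff, not_or] at hx
  have h0 := (P.simple.argSum_eq_zero_or P.ccw hx.1).resolve_right fun h => hx.2 ⟨hx.1, h⟩
  have h1 := argSum_eventually_eq (V := fun _ : ℂ => P.bd) (y := id) (s₀ := x)
    (fun _ => continuousAt_const) continuousAt_id hx.1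
  have h2 := (isCompact_boundary P.bd).isClosed.isOpen_compl.mem_nhds hx.1
  filter_upwards [h1, h2] with y hy1 hy2
  rw [mem_compl_iff, mem_region_iff, not_or]
  refine ⟨hy2, fun h => ?_⟩
  have h3 := hy1.symm.trans h.2
  have h4 : argSum P.bd x = 2 * Real.pi := h3
  linarith [Real.pi_pos]

theorem MeetInFace.symm (h : P.MeetInFace Q) : Q.MeetInFace P := by
  unfold MeetInFace at h ⊢
  rwa [inter_comm Q.verts, inter_comm Q.edges, inter_comm Q.region]

theorem MeetInFace.mem_boundary (h : P.MeetInFace Q) {x : ℂ} (hP : x ∈ P.region)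
    (hQ : x ∈ Q.region) : x ∈ P.bd.boundary ℝ := by
  have hx : x ∈ P.region ∩ Q.region := ⟨hP, hQ⟩
  rcases h with h | ⟨v, ⟨⟨i, hv⟩, -⟩, h⟩ | ⟨e, ⟨⟨i, he⟩, -⟩, h⟩
  · rw [h] at hx; exact hx.elim
  · rw [h, mem_singleton_iff] at hx
    rw [hx, ← hv]; exact left_mem_boundary _ i
  · rw [h, he] at hx
    exact segment_subset_boundary i hx

theorem MeetInFace.notMem_of_mem_inner (h : P.MeetInFace Q) {x : ℂ} (hP : x ∈ P.inner) :
    x ∉ Q.region := fun hQ => hP.1 (h.mem_boundary (mem_region_iff.2 (Or.inr hP)) hQ)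

/-- A relatively interior point of an edge is no vertex of `P` and lies on no other edge of `P`, so
the common face through it can only be this edge. -/
theorem MeetInFace.edge_mem (h : P.MeetInFace Q) {i : Fin P.n} {x : ℂ}
    (hx : x ∈ segment ℝ (P.bd i) (P.bd (finRotate _ i))) (h1 : x ≠ P.bd i)
    (h2 : x ≠ P.bd (finRotate _ i)) (hQ : x ∈ Q.region) :
    P.edge i ∈ Q.edges ∧
      P.region ∩ Q.region = segment ℝ (P.bd i) (P.bd (finRotate _ i)) := by
  have hx' : x ∈ P.region ∩ Q.region :=
    ⟨boundary_subset_region (segment_subset_boundary i hx), hQ⟩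
  rcases h with h | ⟨v, ⟨⟨j, hv⟩, -⟩, h⟩ | ⟨e, ⟨⟨j, he⟩, heQ⟩, h⟩
  · rw [h] at hx'; exact hx'.elim
  · rw [h, mem_singleton_iff] at hx'
    subst hx'
    subst hv
    rcases P.simple.vertex_mem_edge hx with rfl | rfl
    · exact (h1 rfl).elim
    · exact (h2 rfl).elim
  · rw [h, he] at hx'
    rcases P.simple.edge_inter hx hx' with rfl | ⟨h3, h4⟩ | ⟨h3, h4⟩
    · exact ⟨by rw [edge, ← he]; exact heQ, by rw [h, he]; rfl⟩
    · exact (h2 (h4.trans (by rw [h3]))).elim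
    · exact (h1 h4).elim

/-- A vertex of one cell that lies in the other cell is a vertex of it. -/
theorem MeetInFace.vertex_mem (h : P.MeetInFace Q) {i : Fin P.n} (hQ : P.bd i ∈ Q.region) :
    P.bd i ∈ Q.verts := by
  have hx : P.bd i ∈ P.region ∩ Q.region := ⟨boundary_subset_region (left_mem_boundary _ i), hQ⟩
  rcases h with h | ⟨v, ⟨⟨j, hv⟩, hv'⟩, h⟩ | ⟨e, ⟨⟨j, he⟩, ⟨k, hk⟩⟩, h⟩
  · rw [h] at hx; exact hx.elim
  · rw [h, mem_singleton_iff] at hx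
    rwa [hx]
  · rw [h, he] at hx
    have hmem : P.bd i ∈ e := by
      rw [he]
      rcases P.simple.vertex_mem_edge hx with rfl | rfl
      · exact Sym2.mem_mk_left _ _
      · exact Sym2.mem_mk_right _ _
    rw [hk] at hmem
    rcases Sym2.mem_iff.1 hmem with h1 | h1 <;> rw [h1] <;> exact mem_range_self _

theorem midAt_mem_segment (i : Fin P.n) :
    midAt P.bd i 0 ∈ segment ℝ (P.bd i) (P.bd (finRotate _ i)) := by
  rw [P.simple.midAt_zero]; exact midpoint_mem_segment _ _

theorem midAt_ne (i : Fin P.n) : midAt P.bd i 0 ≠ P.bd i := by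
  rw [P.simple.midAt_zero]
  intro h
  exact P.simple.ne_finRotate i ((midpoint_eq_left_iff ℝ).1 h).symm

theorem midAt_ne' (i : Fin P.n) : midAt P.bd i 0 ≠ P.bd (finRotate _ i) := by
  rw [P.simple.midAt_zero]
  intro h
  exact P.simple.ne_finRotate i ((midpoint_eq_right_iff ℝ).1 h).symm

theorem MeetInFace.inter_eq_of_edge_mem (h : P.MeetInFace Q) {i : Fin P.n}
    (he : P.edge i ∈ Q.edges) :
    P.region ∩ Q.region = segment ℝ (P.bd i) (P.bd (finRotate _ i)) := by
  obtain ⟨j, hj⟩ := he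
  refine (h.edge_mem (midAt_mem_segment i) (midAt_ne i) (midAt_ne' i) ?_).2
  have h1 := midAt_mem_segment (P := P) i
  have h2 : seg id (P.edge i) = segment ℝ (P.bd i) (P.bd (finRotate _ i)) := rfl
  rw [← h2, hj] at h1
  exact boundary_subset_region (segment_subset_boundary j h1)

/-- Cells that meet in faces share at most one edge. -/
theorem MeetInFace.edge_unique (h : P.MeetInFace Q) {i j : Fin P.n} (hi : P.edge i ∈ Q.edges)
    (hj : P.edge j ∈ Q.edges) : i = j := by
  have h1 := (h.inter_eq_of_edge_mem hi).symm.trans (h.inter_eq_of_edge_mem hj)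
  have h2 := midAt_mem_segment (P := P) i
  rcases P.simple.edge_inter h2 (h1 ▸ h2) with h3 | ⟨h3, h4⟩ | ⟨h3, h4⟩
  · exact h3
  · exact (midAt_ne' i (by rw [h4, h3])).elim
  · exact (midAt_ne i h4).elim

theorem sdist_of_opposite {i : Fin P.n} {j : Fin Q.n} (h1 : P.bd i = Q.bd (finRotate _ j))
    (h2 : P.bd (finRotate _ i) = Q.bd j) : edgeDir Q.bd j = - edgeDir P.bd i ∧
    edgeLen Q.bd j = edgeLen P.bd i ∧ ∀ z, sdist Q.bd j z = - sdist P.bd i z := by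
  have hl : edgeLen Q.bd j = edgeLen P.bd i := by
    unfold edgeLen; rw [h1, h2, norm_sub_rev]
  have hd : edgeDir Q.bd j = - edgeDir P.bd i := by
    unfold edgeDir; rw [hl, h1, h2]; ring
  refine ⟨hd, hl, fun z => ?_⟩
  have h3 := P.simple.edgeLen_mul_edgeDir i
  have h4 := P.simple.edgeDir_ne_zero i
  unfold sdist
  rw [hd, ← h2, div_neg, Complex.neg_im]
  congr 1
  have : z - P.bd (finRotate _ i) = (z - P.bd i) - edgeLen P.bd i * edgeDir P.bd i := by
    rw [h3]; ring
  rw [this, sub_div, mul_div_assoc, div_self h4]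
  simp

/-- Cells that meet in faces traverse a common edge in opposite directions. -/
theorem MeetInFace.opposite (h : P.MeetInFace Q) {i : Fin P.n} {j : Fin Q.n}
    (he : P.edge i = Q.edge j) :
    P.bd i = Q.bd (finRotate _ j) ∧ P.bd (finRotate _ i) = Q.bd j := by
  rcases Sym2.eq_iff.1 he with ⟨h1, h2⟩ | h0
  -- Traversed in the same direction, the edge would have the interiors of both cells on its left,
  -- and these would overlap near the midpoint.
  · exfalso
    have hsd : ∀ z, sdist Q.bd j z = sdist P.bd i z := by
      intro z; unfold sdist edgeDir edgeLen; rw [h1, h2]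
    have hmid : midAt Q.bd j 0 = midAt P.bd i 0 := by
      rw [P.simple.midAt_zero, Q.simple.midAt_zero, h1, h2]
    have hl := P.simple.lenAt_zero_pos i
    have hl' := Q.simple.lenAt_zero_pos j
    have e1 := P.simple.argSum_left_right P.ccw (P.simple.sdist_midAt i 0)
      (by rw [P.simple.side_midAt]; linarith) (by rw [P.simple.side_midAt']; linarith)
    have e2 := Q.simple.argSum_left_right Q.ccw (Q.simple.sdist_midAt j 0)
      (by rw [Q.simple.side_midAt]; linarith) (by rw [Q.simple.side_midAt']; linarith)
    rw [hmid] at e2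
    have e3 : Tendsto (midAt P.bd i) (𝓝[>] 0) (𝓝 (midAt P.bd i 0)) :=
      ((P.simple.continuous_midAt i).tendsto 0).mono_left nhdsWithin_le_nhds
    obtain ⟨ε, ⟨h3, h4⟩, h5⟩ :=
      ((e3.eventually (e1.and e2)).and self_mem_nhdsWithin).exists
    have h5 : (0 : ℝ) < ε := h5
    have h6 := h3.1 (by rw [P.simple.sdist_midAt]; exact h5)
    have h7 := h4.1 (by rw [hsd, P.simple.sdist_midAt]; exact h5)
    exact h.notMem_of_mem_inner h6 (mem_region_iff.2 (Or.inr h7))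
  · exact h0

/-- Two cells sharing an edge cover a neighborhood of each interior point of the edge. -/
theorem MeetInFace.union_mem_nhds (h : P.MeetInFace Q) {i : Fin P.n} {j : Fin Q.n}
    (he : P.edge i = Q.edge j) {y : ℂ} (hy : y ∈ segment ℝ (P.bd i) (P.bd (finRotate _ i)))
    (h1 : y ≠ P.bd i) (h2 : y ≠ P.bd (finRotate _ i)) : P.region ∪ Q.region ∈ 𝓝 y := by
  obtain ⟨o1, o2⟩ := h.opposite he
  have hsd := (sdist_of_opposite o1 o2).2.2
  obtain ⟨s0, s1, s2⟩ := P.simple.side_of_openSegment hy h1 h2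
  have hyQ : y ∈ segment ℝ (Q.bd j) (Q.bd (finRotate _ j)) := by
    rw [← o1, ← o2, segment_symm]; exact hy
  obtain ⟨t0, t1, t2⟩ := Q.simple.side_of_openSegment hyQ (o2 ▸ h2) (o1 ▸ h1)
  filter_upwards [P.simple.argSum_left_right P.ccw s0 s1 s2,
    Q.simple.argSum_left_right Q.ccw t0 t1 t2,
    ((continuous_side P.bd i).tendsto y).eventually (lt_mem_nhds s1),
    ((continuous_side P.bd _).tendsto y).eventually (gt_mem_nhds s2)] with z z1 z2 z3 z4
  rcases lt_trichotomy (sdist P.bd i z) 0 with h0 | h0 | h0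
  · exact Or.inr (mem_region_iff.2 (Or.inr (z2.1 (by rw [hsd]; linarith))))
  · exact Or.inl (boundary_subset_region (segment_subset_boundary i
      ((P.simple.mem_segment_iff i).2 ⟨h0, z3.le, z4.le⟩)))
  · exact Or.inl (mem_region_iff.2 (Or.inr (z1.1 h0)))

/-- The angles of two cells at an end of a common edge add up to less than the full angle. -/
theorem MeetInFace.slope_add_pos (h : P.MeetInFace Q) {i : Fin P.n} {j : Fin Q.n}
    (he : P.edge i = Q.edge j) :
    0 < slope P.bd i + slope Q.bd (finRotate _ j) := by
  by_contra hneg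
  rw [not_lt] at hneg
  obtain ⟨o1, o2⟩ := h.opposite he
  obtain ⟨hd, -, -⟩ := sdist_of_opposite o1 o2
  obtain ⟨b, hb⟩ := P.simple.exists_isMiteredOffset
  obtain ⟨p, rfl⟩ : ∃ p, i = finRotate _ p :=
    ⟨(finRotate _).symm i, ((finRotate _).apply_symm_apply i).symm⟩
  set i := finRotate P.n p with hi
  set j' := finRotate Q.n j with hj
  set κ := slope P.bd i with hκ
  set κ' := slope Q.bd j' with hκ'
  have hd0 := P.simple.edgeDir_ne_zero i
  have hpos : (0 : ℝ) < 1 + κ' ^ 2 := by positivity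
  have hpos2 : (0 : ℝ) < 1 + κ ^ 2 := by positivity
  -- `g` runs from the common vertex along the next edge of `Q`. If the two cotangents had sum at
  -- most `0`, this edge would start out inside `P`.
  let g : ℝ → ℂ := fun ε => Q.bd j' + ε * edgeDir Q.bd j'
  have hg : Continuous g := by fun_prop
  have hw : edgeDir Q.bd j' = edgeDir P.bd i *
      (((κ' ^ 2 - 1) / (1 + κ' ^ 2) : ℝ) + ((-2 * κ') / (1 + κ' ^ 2) : ℝ) * Complex.I) := by
    have h1 := Q.simple.edgeDir_eq_mul j'
    rw [hj, Equiv.symm_apply_apply, hd, ← hj, ← hκ'] at h1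
    have h2 : ((κ' : ℂ) + Complex.I) ≠ 0 := fun hx => by
      have := congrArg Complex.im hx; simp at this
    apply mul_right_cancel₀ h2
    rw [h1]
    have h3 : (1 : ℂ) + (κ' : ℂ) ^ 2 ≠ 0 := by exact_mod_cast hpos.ne'
    push_cast
    field_simp
    linear_combination (-2 * (κ' : ℂ)) * (-1) * (Complex.I_sq)
  have hgP : ∀ ε : ℝ, (g ε - P.bd i) / edgeDir P.bd i =
      ((ε * ((κ' ^ 2 - 1) / (1 + κ' ^ 2)) : ℝ) : ℂ) +
        ((ε * ((-2 * κ') / (1 + κ' ^ 2)) : ℝ) : ℂ) * Complex.I := by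
    intro ε
    simp only [g]
    rw [hw, o1, add_sub_cancel_left, ← mul_assoc, mul_comm (ε : ℂ), mul_assoc,
      mul_div_cancel_left₀ _ hd0]
    push_cast; ring
  have hsd : ∀ ε, sdist P.bd i (g ε) = ε * ((-2 * κ') / (1 + κ' ^ 2)) := by
    intro ε; unfold sdist; rw [hgP]; simp [-Complex.ofReal_mul, -Complex.ofReal_div]
  have hside : ∀ ε, side P.bd i (g ε) =
      ε * ((κ' ^ 2 - 1 + 2 * κ * κ') / (1 + κ' ^ 2)) := by
    intro ε; unfold side; rw [hgP]
    simp [-Complex.ofReal_mul, -Complex.ofReal_div]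
    rw [← hκ]; ring
  have hsdp : ∀ ε, sdist P.bd p (g ε) =
      ε * (2 * (κ + κ') * (κ * κ' - 1) / ((1 + κ ^ 2) * (1 + κ' ^ 2))) := by
    intro ε
    have := P.simple.sdist_symm i (g ε)
    rw [hi, Equiv.symm_apply_apply, ← hi, hside, hsd, ← hκ] at this
    rw [eq_sub_iff_add_eq] at this
    rw [← this]; field_simp; ring
  have hg0 : g 0 = P.bd i := by simp [g, o1]
  have hs0 : side P.bd i (P.bd i) = 0 := by
    have := P.simple.side_offset 0 i; rwa [P.simple.offset_zero] at this
  have hd00 : sdist P.bd i (P.bd i) = 0 := by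
    have := P.simple.sdist_offset 0 i; rwa [P.simple.offset_zero] at this
  have hdp0 : sdist P.bd p (P.bd i) = 0 := by
    rw [← P.simple.sdist_finRotate p hs0, ← hi, hd00]
  have ev1 : ∀ᶠ ε in 𝓝[>] (0 : ℝ), side P.bd (finRotate _ i) (g ε) < 0 := by
    refine ((((continuous_side P.bd _).comp hg).tendsto 0).eventually
      (gt_mem_nhds ?_)).filter_mono nhdsWithin_le_nhds
    have := P.simple.side_sub_side i (P.bd i)
    rw [hs0, hd00] at this
    simp only [Function.comp, hg0]
    linarith [P.simple.lenAt_zero_pos i]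
  have ev2 : ∀ᶠ ε in 𝓝[>] (0 : ℝ), 0 < side P.bd p (g ε) := by
    refine ((((continuous_side P.bd _).comp hg).tendsto 0).eventually
      (lt_mem_nhds ?_)).filter_mono nhdsWithin_le_nhds
    have := P.simple.side_sub_side p (P.bd i)
    rw [← hi, hs0, hdp0] at this
    simp only [Function.comp, hg0]
    linarith [P.simple.lenAt_zero_pos p]
  have ev3 : ∀ᶠ ε in 𝓝[>] (0 : ℝ), sdist P.bd i (g ε) < b := by
    refine ((((continuous_sdist P.bd _).comp hg).tendsto 0).eventually
      (gt_mem_nhds ?_)).filter_mono nhdsWithin_le_nhds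
    simp only [Function.comp, hg0, hd00]; exact hb.1
  have ev4 : ∀ᶠ ε in 𝓝[>] (0 : ℝ), sdist P.bd p (g ε) < b := by
    refine ((((continuous_sdist P.bd _).comp hg).tendsto 0).eventually
      (gt_mem_nhds ?_)).filter_mono nhdsWithin_le_nhds
    simp only [Function.comp, hg0, hdp0]; exact hb.1
  have ev5 : ∀ᶠ ε in 𝓝[>] (0 : ℝ), ε ∈ Ioc 0 (edgeLen Q.bd j') :=
    Ioc_mem_nhdsGT (Q.simple.edgeLen_pos j')
  obtain ⟨ε, h1, h2, h3, h4, h5⟩ := (ev1.and (ev2.and (ev3.and (ev4.and ev5)))).exists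
  -- The sign of `side` at the vertex decides which of the two strips of `P` adjacent to its
  -- bisector is entered. In either case the assumption `κ + κ' ≤ 0` makes the distance from the
  -- corresponding edge nonnegative.
  have hregP : g ε ∈ P.region := by
    rcases le_or_gt 0 (κ' ^ 2 - 1 + 2 * κ * κ') with hc | hc
    · refine P.simple.mem_region_of_mem_strip P.ccw hb (i := i) ⟨⟨?_, h3.le⟩, ?_, h1.le⟩
      · rw [hsd]
        have : κ' ≤ 0 := by
          by_contra hk
          rw [not_le] at hk
          nlinarith
        exact mul_nonneg h5.1.le (div_nonneg (by linarith) hpos.le)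
      · rw [hside]
        exact mul_nonneg h5.1.le (div_nonneg hc hpos.le)
    · refine P.simple.mem_region_of_mem_strip P.ccw hb (i := p) ⟨⟨?_, h4.le⟩, h2.le, ?_⟩
      · rw [hsdp]
        refine mul_nonneg h5.1.le (div_nonneg ?_ (by positivity))
        have : κ * κ' ≤ 1 := by
          by_contra hk
          rw [not_le] at hk
          nlinarith [sq_nonneg κ']
        nlinarith
      · rw [← hi, hside]
        exact mul_nonpos_of_nonneg_of_nonpos h5.1.le (div_nonpos_of_nonpos_of_nonneg hc.le hpos.le)
  have hsegQ : g ε ∈ segment ℝ (Q.bd j') (Q.bd (finRotate _ j')) := by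
    convert mem_segment_of_real (u := Q.bd j') (d := edgeDir Q.bd j') h5.1.le h5.2 using 2
    rw [Q.simple.edgeLen_mul_edgeDir]; ring
  have hregQ : g ε ∈ Q.region := boundary_subset_region (segment_subset_boundary j' hsegQ)
  -- Points common to both cells lie on the shared edge `j`, while `g ε` is on the next edge of `Q`
  -- and different from the common end.
  have hmem := (h.symm.inter_eq_of_edge_mem (i := j) ⟨i, he.symm⟩).le ⟨hregQ, hregP⟩
  rcases Q.simple.edge_inter hmem hsegQ with h6 | ⟨-, h6⟩ | ⟨h6, -⟩
  · exact finRotate_ne_self Q.simple.three_le j h6.symm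
  · simp only [g, add_eq_left, mul_eq_zero] at h6
    rcases h6 with h6 | h6
    · exact h5.1.ne' (by exact_mod_cast h6)
    · exact Q.simple.edgeDir_ne_zero _ h6
  · exact finRotate_finRotate_ne_self Q.simple.three_le j h6.symm

end PolygonCell

/-! ### The cells at an edge and at a vertex -/

/-- The cell is a polygon of the complex, not a hole and not the outside cell. -/
def Cell.IsPoly {F H : Type*} (c : Cell F H) : Prop := ∃ f, c = .poly f

namespace Mesh

variable {F H : Type*} (K : Mesh F H)

/-- The polygons of the complex together with the holes. -/
def solid : F ⊕ H → PolygonCell := Sum.elim K.poly K.hole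

/-- The cells that are polygons. -/
def solidCell : F ⊕ H → Cell F H := Sum.elim .poly .hole

/-- The closed cells as point sets. -/
def cellRegion : Cell F H → Set ℂ
  | .poly f => (K.poly f).region
  | .hole h => (K.hole h).region
  | .outside => K.outside

variable {K}

theorem solidCell_injective : Function.Injective (solidCell : F ⊕ H → Cell F H) := by
  rintro (a | a) (b | b) h <;> simp_all [solidCell]

theorem cellEdges_solidCell (a : F ⊕ H) : K.cellEdges (solidCell a) = (K.solid a).edges := by
  cases a <;> rfl

theorem eq_outside_or (c : Cell F H) : c = .outside ∨ ∃ a, c = solidCell a := by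
  cases c with
  | poly f => exact Or.inr ⟨.inl f, rfl⟩
  | hole h => exact Or.inr ⟨.inr h, rfl⟩
  | outside => exact Or.inl rfl

theorem region_solid_subset (a : F ⊕ H) : (K.solid a).region ⊆ K.space ∪ K.holeSpace := by
  cases a with
  | inl f => exact (subset_iUnion (fun f => (K.poly f).region) f).trans subset_union_left
  | inr h => exact (subset_iUnion (fun h => (K.hole h).region) h).trans subset_union_right

theorem edge_mem_edges (f : F) (i : Fin (K.poly f).n) : (K.poly f).edge i ∈ K.edges :=
  mem_iUnion.2 ⟨f, PolygonCell.edge_mem_edges i⟩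

theorem mem_edges_iff {e : Sym2 ℂ} : e ∈ K.edges ↔ ∃ f i, e = (K.poly f).edge i := by
  simp only [edges, mem_iUnion, PolygonCell.mem_edges_iff]

namespace IsAdmissible

variable (hK : K.IsAdmissible)
include hK

theorem solid_meet {a b : F ⊕ H} (hab : a ≠ b) : (K.solid a).MeetInFace (K.solid b) := by
  rcases a with f | h <;> rcases b with g | h'
  · exact hK.meet f g fun h => hab (by rw [h])
  · exact hK.meet_hole f h'
  · exact (hK.meet_hole g h).symm
  · exact Or.inl (hK.hole_disjoint h h' fun h => hab (by rw [h])).inter_eq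

/-- Cells sharing an edge traverse it in opposite directions, and three cells cannot do so pairwise.
-/
theorem solid_edge_two {a b c : F ⊕ H} (hab : a ≠ b) {e : Sym2 ℂ} (ha : e ∈ (K.solid a).edges)
    (hb : e ∈ (K.solid b).edges) (hc : e ∈ (K.solid c).edges) : c = a ∨ c = b := by
  by_contra! hne
  obtain ⟨i, hi⟩ := ha
  obtain ⟨j, hj⟩ := hb
  obtain ⟨k, hk⟩ := hc
  obtain ⟨h1, h2⟩ := (hK.solid_meet hab).opposite (i := i) (j := j) (hi.symm.trans hj)
  obtain ⟨h3, h4⟩ := (hK.solid_meet hne.1.symm).opposite (i := i) (j := k) (hi.symm.trans hk)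
  obtain ⟨h5, h6⟩ := (hK.solid_meet hne.2.symm).opposite (i := j) (j := k) (hj.symm.trans hk)
  refine (K.solid a).simple.ne_finRotate i ?_
  rw [h3, h2, h5]

/-- The two cells cover a neighbourhood of the midpoint of the edge, which is therefore not a limit
of uncovered points. -/
theorem not_subset_outside {a b : F ⊕ H} (hab : a ≠ b) {e : Sym2 ℂ} (ha : e ∈ (K.solid a).edges)
    (hb : e ∈ (K.solid b).edges) : ¬ seg id e ⊆ K.outside := by
  obtain ⟨i, hi⟩ := ha
  obtain ⟨j, hj⟩ := hb
  intro hsub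
  have h1 := (hK.solid_meet hab).union_mem_nhds (i := i) (j := j) (hi.symm.trans hj)
    (PolygonCell.midAt_mem_segment i) (PolygonCell.midAt_ne i) (PolygonCell.midAt_ne' i)
  have h2 : midAt (K.solid a).bd i 0 ∈ K.outside :=
    hsub (by rw [hi]; exact PolygonCell.midAt_mem_segment i)
  obtain ⟨z, hz, hz'⟩ := mem_closure_iff_nhds.1 h2 _ h1
  exact hz' (hz.elim (fun h => region_solid_subset a h) fun h => region_solid_subset b h)

/-- An interior point `y` of the edge lies in no other polygon or hole. These are finitely many
closed sets, so points close to `y` on the right of the edge are uncovered. The ends of the edge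
follow since the outside cell is closed. -/
theorem subset_outside [Finite F] [Finite H] (f : F) (i : Fin (K.poly f).n)
    (h : ∀ a, a ≠ Sum.inl f → (K.poly f).edge i ∉ (K.solid a).edges) :
    seg id ((K.poly f).edge i) ⊆ K.outside := by
  let P := K.poly f
  have hopen : openSegment ℝ (P.bd i) (P.bd (finRotate _ i)) ⊆ K.outside := by
    intro y hy
    have hys := openSegment_subset_segment ℝ _ _ hy
    have hne := P.simple.ne_finRotate i
    have h1 : y ≠ P.bd i := by
      rintro rfl
      exact hne (left_mem_openSegment_iff.1 hy).symm
    have h2 : y ≠ P.bd (finRotate _ i) := by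
      rintro rfl
      exact hne (right_mem_openSegment_iff.1 hy).symm
    obtain ⟨s0, s1, s2⟩ := P.simple.side_of_openSegment hys h1 h2
    have hlr := P.simple.argSum_left_right P.ccw s0 s1 s2
    have hoth : ∀ᶠ z in 𝓝 y, ∀ a, a ≠ Sum.inl f → z ∉ (K.solid a).region := by
      refine eventually_all.2 fun a => ?_
      by_cases ha : a = Sum.inl f
      · exact Eventually.of_forall fun z h => (h ha).elim
      · have : y ∉ (K.solid a).region := fun hmem =>
          h a ha ((hK.solid_meet (Ne.symm ha) : P.MeetInFace _).edge_mem hys h1 h2 hmem).1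
        filter_upwards [(K.solid a).isClosed_region.isOpen_compl.mem_nhds this] with z hz _
        exact hz
    let g : ℝ → ℂ := fun ε => y + ε * miter P.bd i
    have hg : Continuous g := by fun_prop
    have hg0 : g 0 = y := by simp [g]
    have hsd : ∀ ε, sdist P.bd i (g ε) = ε := fun ε =>
      (P.simple.side_sdist_of_eq (ξ := side P.bd i y) (by
        have := P.simple.eq_start i y
        rw [s0] at this
        simp only [g]; push_cast at this ⊢; linear_combination this)).2
    have hge : Tendsto g (𝓝[<] 0) (𝓝 y) := by
      rw [← hg0]; exact (hg.tendsto 0).mono_left nhdsWithin_le_nhds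
    refine mem_closure_of_tendsto hge ?_
    filter_upwards [hge.eventually hlr, hge.eventually hoth, self_mem_nhdsWithin] with ε e1 e2 e3
    have e4 := e1.2 (by rw [hsd]; exact e3)
    have e5 : g ε ∉ P.region := by
      rw [PolygonCell.mem_region_iff, not_or]
      refine ⟨e4.1, fun h => ?_⟩
      have := h.2
      rw [e4.2] at this
      linarith [Real.pi_pos]
    rintro (hmem | hmem)
    · obtain ⟨g', hg'⟩ := mem_iUnion.1 hmem
      by_cases hgf : g' = f
      · subst hgf; exact e5 hg'
      · exact e2 (.inl g') (fun h => hgf (Sum.inl.inj h)) hg'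
    · obtain ⟨h', hh'⟩ := mem_iUnion.1 hmem
      exact e2 (.inr h') (by simp) hh'
  exact segment_subset_closure_openSegment.trans (closure_minimal hopen isClosed_closure)

/-- Each edge of a polygon of the complex belongs to exactly one other cell. -/
theorem exists_across [Finite F] [Finite H] (f : F) (i : Fin (K.poly f).n) :
    ∃ c, c ≠ Cell.poly f ∧
      ∀ d, (K.poly f).edge i ∈ K.cellEdges d ↔ d = Cell.poly f ∨ d = c := by
  have hf : (K.poly f).edge i ∈ (K.solid (.inl f)).edges := PolygonCell.edge_mem_edges i
  have hfc : (K.poly f).edge i ∈ K.cellEdges (.poly f) := PolygonCell.edge_mem_edges i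
  by_cases h : ∃ a, a ≠ Sum.inl f ∧ (K.poly f).edge i ∈ (K.solid a).edges
  · obtain ⟨a, ha, hae⟩ := h
    refine ⟨solidCell a, fun h => ha (solidCell_injective h), fun d => ⟨fun hd => ?_, ?_⟩⟩
    · rcases eq_outside_or d with rfl | ⟨c, rfl⟩
      · exact (hK.not_subset_outside ha hae hf hd.2).elim
      · rw [cellEdges_solidCell] at hd
        rcases hK.solid_edge_two ha.symm hf hae hd with rfl | rfl
        · exact Or.inl rfl
        · exact Or.inr rfl
    · rintro (rfl | rfl)
      · exact hfc
      · rwa [cellEdges_solidCell]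
  · push Not at h
    refine ⟨.outside, by simp, fun d => ⟨fun hd => ?_, ?_⟩⟩
    · rcases eq_outside_or d with rfl | ⟨c, rfl⟩
      · exact Or.inr rfl
      · rw [cellEdges_solidCell] at hd
        by_cases hc : c = .inl f
        · subst hc; exact Or.inl rfl
        · exact (h c hc hd).elim
    · rintro (rfl | rfl)
      · exact hfc
      · exact ⟨edge_mem_edges f i, hK.subset_outside f i h⟩

/-- The cell on the other side of the `i`-th edge of the polygon `f`. -/
def across [Finite F] [Finite H] (f : F) (i : Fin (K.poly f).n) : Cell F H :=
  (hK.exists_across f i).choose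

variable [Finite F] [Finite H]

theorem across_ne (f : F) (i : Fin (K.poly f).n) : hK.across f i ≠ .poly f :=
  (hK.exists_across f i).choose_spec.1

theorem mem_cellEdges_iff {f : F} {i : Fin (K.poly f).n} {d : Cell F H} :
    (K.poly f).edge i ∈ K.cellEdges d ↔ d = .poly f ∨ d = hK.across f i :=
  (hK.exists_across f i).choose_spec.2 d

theorem across_eq_poly_iff {f g : F} {i : Fin (K.poly f).n} :
    hK.across f i = .poly g ↔ g ≠ f ∧ ∃ j, (K.poly f).edge i = (K.poly g).edge j := by
  constructor
  · intro h
    refine ⟨fun hgf => hK.across_ne f i (by rw [h, hgf]), ?_⟩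
    exact hK.mem_cellEdges_iff.2 (Or.inr h.symm)
  · rintro ⟨h1, h2⟩
    have h3 : (K.poly f).edge i ∈ K.cellEdges (.poly g) := h2
    rcases hK.mem_cellEdges_iff.1 h3 with h4 | h4
    · exact (h1 (by simpa using h4)).elim
    · exact h4.symm

theorem across_symm {f g : F} {i : Fin (K.poly f).n} {j : Fin (K.poly g).n} (hfg : f ≠ g)
    (h : (K.poly f).edge i = (K.poly g).edge j) : hK.across g j = .poly f :=
  hK.across_eq_poly_iff.2 ⟨hfg, i, h.symm⟩

-- Holes and the outside cell are pairwise disjoint, so at most one cell through a given point is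
-- not a polygon of `K`. Hence a vertex of `K` has at most one undisplaced copy.
omit [Finite F] [Finite H] in
theorem eq_of_not_isPoly {c d : Cell F H} (hc : ¬ c.IsPoly) (hd : ¬ d.IsPoly) {v : ℂ}
    (hvc : v ∈ K.cellRegion c) (hvd : v ∈ K.cellRegion d) : c = d := by
  cases c with
  | poly f => exact (hc ⟨f, rfl⟩).elim
  | hole h =>
    cases d with
    | poly f => exact (hd ⟨f, rfl⟩).elim
    | hole h' =>
      by_contra hne
      exact disjoint_left.1 (hK.hole_disjoint h h' fun h => hne (by rw [h])) hvc hvd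
    | outside => exact (disjoint_left.1 (hK.hole_outside h) hvc hvd).elim
  | outside =>
    cases d with
    | poly f => exact (hd ⟨f, rfl⟩).elim
    | hole h' => exact (disjoint_left.1 (hK.hole_outside h') hvd hvc).elim
    | outside => rfl

omit hK [Finite F] [Finite H] in
theorem _root_.EulerTransform.PolygonCell.mem_region_of_mem_edge {P : PolygonCell} {e : Sym2 ℂ}
    (he : e ∈ P.edges) {v : ℂ} (hv : v ∈ e) : v ∈ P.region := by
  obtain ⟨i, rfl⟩ := he
  rcases Sym2.mem_iff.1 hv with rfl | rfl <;>
    exact PolygonCell.boundary_subset_region (left_mem_boundary _ _)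

omit hK [Finite F] [Finite H] in
theorem _root_.EulerTransform.mem_seg_of_mem {V : Type*} (φ : V → ℂ) {e : Sym2 V} {v : V}
    (hv : v ∈ e) : φ v ∈ seg φ e := by
  induction e with
  | _ a b =>
    rcases Sym2.mem_iff.1 hv with rfl | rfl
    · exact left_mem_segment ℝ _ _
    · exact right_mem_segment ℝ _ _

omit hK [Finite F] [Finite H] in
theorem _root_.EulerTransform.Mesh.mem_cellRegion_of_mem_edge {c : Cell F H} {e : Sym2 ℂ}
    (he : e ∈ K.cellEdges c) {v : ℂ} (hv : v ∈ e) : v ∈ K.cellRegion c := by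
  cases c with
  | poly f => exact PolygonCell.mem_region_of_mem_edge he hv
  | hole h => exact PolygonCell.mem_region_of_mem_edge he hv
  | outside => exact he.2 (mem_seg_of_mem id hv)

theorem edge_mem_across (f : F) (i : Fin (K.poly f).n) :
    (K.poly f).edge i ∈ K.cellEdges (hK.across f i) :=
  hK.mem_cellEdges_iff.2 (Or.inr rfl)

/-- At a vertex of a polygon, at least one of the two edges is shared with another polygon. -/
theorem isPoly_across (f : F) (i : Fin (K.poly f).n) :
    (hK.across f i).IsPoly ∨ (hK.across f (finRotate _ i)).IsPoly := by
  by_contra! h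
  have h1 := hK.edge_mem_across f i
  have h2 := hK.edge_mem_across f (finRotate _ i)
  -- Both cells contain the common vertex, so they are the same cell. A hole would share two edges
  -- with `f`, and the outside cell would contain two adjacent edges of `f`.
  have heq : hK.across f i = hK.across f (finRotate _ i) :=
    hK.eq_of_not_isPoly h.1 h.2 (v := (K.poly f).bd (finRotate _ i))
      (mem_cellRegion_of_mem_edge h1 (Sym2.mem_mk_right _ _))
      (mem_cellRegion_of_mem_edge h2 (Sym2.mem_mk_left _ _))
  rw [← heq] at h2
  generalize hK.across f i = c at h h1 h2
  cases c with
  | poly g => exact h.1 ⟨g, rfl⟩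
  | hole h' =>
    exact finRotate_ne_self (K.poly f).simple.three_le i
      ((hK.meet_hole f h').edge_unique h1 h2).symm
  | outside =>
    refine hK.outside_edges f i ⟨?_, ?_⟩
    · rw [edgeSet_eq_segment]; exact h1.2
    · rw [edgeSet_eq_segment]; exact h2.2

end IsAdmissible

/-! ### Vertices and facets of the transformed complex -/

theorem HatVertex.ext_cell_base {x y : K.HatVertex} (hc : x.cell = y.cell)
    (hb : x.base = y.base) : x = y := by
  cases x with
  | poly f i =>
    cases y with
    | poly g j =>
      simp only [HatVertex.cell, Cell.poly.injEq] at hc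
      subst hc
      rw [(K.poly f).simple.injective hb]
    | hole h j => simp [HatVertex.cell] at hc
    | outside v hv => simp [HatVertex.cell] at hc
  | hole h i =>
    cases y with
    | poly g j => simp [HatVertex.cell] at hc
    | hole h' j =>
      simp only [HatVertex.cell, Cell.hole.injEq] at hc
      subst hc
      rw [(K.hole h).simple.injective hb]
    | outside v hv => simp [HatVertex.cell] at hc
  | outside v hv =>
    cases y with
    | poly g j => simp [HatVertex.cell] at hc
    | hole h j => simp [HatVertex.cell] at hc
    | outside w hw =>
      simp only [HatVertex.base] at hb
      subst hb
      rfl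

theorem mem_verts_of_mem_edge {e : Sym2 ℂ} (he : e ∈ K.edges) {v : ℂ} (hv : v ∈ e) :
    v ∈ K.verts := by
  obtain ⟨f, i, rfl⟩ := mem_edges_iff.1 he
  refine mem_iUnion.2 ⟨f, ?_⟩
  rcases Sym2.mem_iff.1 hv with rfl | rfl <;> exact mem_range_self _

theorem exists_hatVertex {c : Cell F H} {e : Sym2 ℂ} (he : e ∈ K.cellEdges c) {v : ℂ}
    (hv : v ∈ e) : ∃ x : K.HatVertex, x.cell = c ∧ x.base = v := by
  cases c with
  | poly f =>
    obtain ⟨i, rfl⟩ := he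
    rcases Sym2.mem_iff.1 hv with rfl | rfl
    · exact ⟨.poly f i, rfl, rfl⟩
    · exact ⟨.poly f _, rfl, rfl⟩
  | hole h =>
    obtain ⟨i, rfl⟩ := he
    rcases Sym2.mem_iff.1 hv with rfl | rfl
    · exact ⟨.hole h i, rfl, rfl⟩
    · exact ⟨.hole h _, rfl, rfl⟩
  | outside =>
    exact ⟨.outside v ⟨mem_verts_of_mem_edge he.1 hv, mem_cellRegion_of_mem_edge he hv⟩, rfl, rfl⟩

theorem HatVertex.base_mem_cellRegion (x : K.HatVertex) : x.base ∈ K.cellRegion x.cell := by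
  cases x with
  | poly f i => exact PolygonCell.boundary_subset_region (left_mem_boundary _ _)
  | hole h i => exact PolygonCell.boundary_subset_region (left_mem_boundary _ _)
  | outside v hv => exact hv.2

theorem HatVertex.place_of_not_isPoly {x : K.HatVertex} (hx : ¬ x.cell.IsPoly) (b : F → ℝ) :
    K.place b x = x.base := by
  cases x with
  | poly f i => exact (hx ⟨f, rfl⟩).elim
  | hole h i => rfl
  | outside v hv => rfl

end Mesh

/-! ### Filled star-shaped curves and convex quadrilaterals -/

/-- From a point outside `S` the ray leading away from `v` never enters `S`. It escapes to infinity
without meeting `Γ`, so the component of the point is unbounded. -/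
theorem fill_subset_of_starConvex {Γ S : Set ℂ} {v : ℂ} (hv : v ∈ S) (hS : StarConvex ℝ v S)
    (h : Γ ⊆ S) : fill Γ ⊆ S := by
  rintro x (hx | ⟨hx, hb⟩)
  · exact h hx
  by_contra hxS
  let g : ℝ → ℂ := fun l => v + l * (x - v)
  have hg : Continuous g := by fun_prop
  have hne : x - v ≠ 0 := sub_ne_zero.2 fun h => hxS (h ▸ hv)
  have hsub : g '' Ici 1 ⊆ Γᶜ := by
    rintro _ ⟨l, hl, rfl⟩ hmem
    have hl : (1 : ℝ) ≤ l := hl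
    apply hxS
    have h1 := hS (h hmem) (a := 1 - 1 / l) (b := 1 / l)
      (by rw [sub_nonneg, div_le_one (by linarith)]; exact hl) (by positivity) (by ring)
    convert h1 using 1
    have : (l : ℂ) ≠ 0 := by exact_mod_cast (by linarith : l ≠ 0)
    simp only [g, Complex.real_smul]
    push_cast
    field_simp
    ring
  have hcomp : g '' Ici 1 ⊆ connectedComponentIn Γᶜ x :=
    (isPreconnected_Ici.image _ hg.continuousOn).subset_connectedComponentIn
      ⟨1, by simp, by simp [g]⟩ hsub
  obtain ⟨R, hR⟩ := (hb.subset hcomp).exists_norm_le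
  have hpos : 0 < ‖x - v‖ := norm_pos_iff.2 hne
  -- Chosen so that `l * ‖x - v‖` exceeds the bound `|R| + ‖v‖`.
  set l : ℝ := 1 + (|R| + ‖v‖) / ‖x - v‖ with hl
  have hl1 : 1 ≤ l := by
    rw [hl]; have : 0 ≤ (|R| + ‖v‖) / ‖x - v‖ := by positivity
    linarith
  have h1 := hR (g l) ⟨l, hl1, rfl⟩
  have h2 : ‖(l : ℂ) * (x - v)‖ ≤ ‖g l‖ + ‖v‖ := by
    have := norm_sub_le (g l) v
    simpa [g] using this
  rw [norm_mul, Complex.norm_real, Real.norm_of_nonneg (by linarith)] at h2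
  have h3 : l * ‖x - v‖ = ‖x - v‖ + (|R| + ‖v‖) := by rw [hl]; field_simp
  have h4 := le_abs_self R
  linarith

/-- The signed area of the parallelogram spanned by two vectors. -/
def cross (z w : ℂ) : ℝ := z.re * w.im - z.im * w.re

theorem cross_combo (d p z w : ℂ) {a b : ℝ} (h : a + b = 1) :
    cross d (a • z + b • w - p) = a * cross d (z - p) + b * cross d (w - p) := by
  have hb : b = 1 - a := by linarith
  subst hb
  unfold cross
  simp
  ring

theorem exists_real_of_cross_eq_zero {d w : ℂ} (hd : d ≠ 0) (h : cross d w = 0) :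
    ∃ t : ℝ, w = t * d := by
  refine ⟨(w / d).re, ?_⟩
  have h1 : (w / d).im = 0 := by
    rw [Complex.div_im]
    unfold cross at h
    rw [div_sub_div_same, div_eq_zero_iff]
    left; linarith
  have h2 : w / d = ((w / d).re : ℂ) := Complex.ext (by simp) (by simp [h1])
  rw [← h2]; field_simp

/-! ### Strictly convex quadrilaterals: every vertex off an edge is strictly to its left -/

section Quad

variable {C : Fin 4 → ℂ}
  (h : ∀ i k, k ≠ i → k ≠ finRotate 4 i → 0 < cross (C (finRotate 4 i) - C i) (C k - C i))
include h

theorem quad_ne (i : Fin 4) : C (finRotate 4 i) ≠ C i := by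
  intro h0
  have := h i (finRotate 4 (finRotate 4 i)) (finRotate_finRotate_ne_self (by norm_num) i)
    (finRotate_ne_self (by norm_num) _)
  rw [h0] at this
  simp [cross] at this

omit h in
theorem quad_cross_eq_zero {i : Fin 4} {z : ℂ}
    (hz : z ∈ segment ℝ (C i) (C (finRotate 4 i))) :
    cross (C (finRotate 4 i) - C i) (z - C i) = 0 := by
  obtain ⟨a, b, ha, hb, hab, rfl⟩ := hz
  rw [cross_combo _ _ _ _ hab]
  simp [cross]
  right; ring

/-- The functional `cross` of edge `i` vanishes on that edge and is positive at the two other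
vertices. So it is positive on the opposite edge, and on an adjacent edge it vanishes only at the
common end. -/
theorem quad_isSimple : IsSimple (⟨C⟩ : Polygon ℂ 4) where
  three_le := by norm_num
  injective := by
    intro i k hik
    have hik : C i = C k := hik
    by_contra hne
    by_cases h1 : k = finRotate 4 i
    · subst h1; exact quad_ne h i hik.symm
    · have := h i k (Ne.symm hne) h1
      rw [hik] at this
      simp [cross] at this
  adjacent := by
    intro i
    rw [edgeSet_eq_segment, edgeSet_eq_segment]
    ext z
    simp only [mem_inter_iff, mem_singleton_iff]
    constructor
    · rintro ⟨h1, h2⟩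
      have h3 := quad_cross_eq_zero h1
      obtain ⟨a, b, ha, hb, hab, rfl⟩ := h2
      have hz1 : cross (C (finRotate 4 i) - C i) (C (finRotate 4 i) - C i) = 0 := by
        unfold cross; ring
      have hpos := h i (finRotate 4 (finRotate 4 i))
        (finRotate_finRotate_ne_self (by norm_num) i) (finRotate_ne_self (by norm_num) _)
      have h4 : a * cross (C (finRotate 4 i) - C i) (C (finRotate 4 i) - C i) +
        b * cross (C (finRotate 4 i) - C i) (C (finRotate 4 (finRotate 4 i)) - C i) = 0 := by
        rw [← cross_combo _ _ _ _ hab]; exact h3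
      rw [hz1, mul_zero, zero_add] at h4
      have hb0 : b = 0 := (mul_eq_zero.1 h4).resolve_right hpos.ne'
      have ha1 : a = 1 := by linarith
      rw [hb0, ha1]; simp
    · rintro rfl
      exact ⟨right_mem_segment ℝ _ _, left_mem_segment ℝ _ _⟩
  disjoint := by
    intro i j h1 h2 h3
    rw [edgeSet_eq_segment, edgeSet_eq_segment, disjoint_left]
    intro z hz hz'
    have h4 := quad_cross_eq_zero hz
    obtain ⟨a, b, ha, hb, hab, rfl⟩ := hz'
    have h5 := h i j h1.symm h2
    have h6 := h i (finRotate 4 j) h3.symm fun h => h1 ((finRotate 4).injective h).symm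
    have h7 : a * cross (C (finRotate 4 i) - C i) (C j - C i) +
      b * cross (C (finRotate 4 i) - C i) (C (finRotate 4 j) - C i) = 0 := by
      rw [← cross_combo _ _ _ _ hab]; exact h4
    rcases ha.lt_or_eq with ha | rfl
    · have := mul_pos ha h5
      have := mul_nonneg hb h6.le
      linarith
    · have : b = 1 := by linarith
      rw [this] at h7; linarith

/-- The sum of the functionals of the two edges at a vertex vanishes there and is positive at the
three other vertices, hence on their convex hull. -/
theorem quad_convexIndependent : ConvexIndependent ℝ C := by
  rw [convexIndependent_iff_notMem_convexHull_sdiff]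
  intro i s hmem
  obtain ⟨p, rfl⟩ : ∃ p, i = finRotate 4 p :=
    ⟨(finRotate 4).symm i, ((finRotate 4).apply_symm_apply i).symm⟩
  set i := finRotate 4 p with hi
  let g : ℂ → ℝ := fun z => cross (C (finRotate 4 i) - C i) (z - C i) + cross (C i - C p) (z - C p)
  have hconv : Convex ℝ {z | 0 < g z} := by
    intro z hz w hw a b ha hb hab
    show 0 < g (a • z + b • w)
    have hz : 0 < g z := hz
    have hw : 0 < g w := hw
    have e : g (a • z + b • w) = a * g z + b * g w := by
      simp only [g]; rw [cross_combo _ _ _ _ hab, cross_combo _ _ _ _ hab]; ring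
    rw [e]
    rcases ha.lt_or_eq with ha | rfl
    · have := mul_pos ha hz
      have := mul_nonneg hb hw.le
      linarith
    · have : b = 1 := by linarith
      rw [this]; linarith
  have hsub : C '' (s \ {i}) ⊆ {z | 0 < g z} := by
    rintro _ ⟨k, ⟨-, hk⟩, rfl⟩
    have hk : k ≠ i := hk
    show 0 < g (C k)
    have n1 : finRotate 4 i ≠ p := finRotate_finRotate_ne_self (by norm_num) p
    have z1 : ∀ a b, cross (C a - C b) (C a - C b) = 0 := fun a b => by unfold cross; ring
    have z2 : ∀ a b c, cross (C a - C b) (C c - C c) = 0 := fun a b c => by unfold cross; simp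
    simp only [g]
    by_cases h1 : k = finRotate 4 i
    · have h2 := h p k (by rw [h1]; exact n1) hk
      rw [h1] at h2 ⊢
      rw [z1]; linarith
    · have h2 := h i k hk h1
      by_cases h3 : k = p
      · rw [h3] at h2 ⊢; rw [z2]; linarith
      · have h4 := h p k h3 hk
        linarith
  have := convexHull_min hsub hconv hmem
  have h0 : 0 < g (C i) := this
  simp only [g, cross] at h0
  simp at h0
  nlinarith

/-- On the line of an edge, lying to the left of the preceding and of the following edge confines a
point to the segment between its ends. -/
theorem quad_segment_of_cross_eq_zero {i : Fin 4} {z : ℂ}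
    (hz : ∀ i, 0 ≤ cross (C (finRotate 4 i) - C i) (z - C i))
    (h0 : cross (C (finRotate 4 i) - C i) (z - C i) = 0) :
    z ∈ segment ℝ (C i) (C (finRotate 4 i)) := by
  obtain ⟨t, ht⟩ := exists_real_of_cross_eq_zero (sub_ne_zero.2 (quad_ne h i)) h0
  obtain ⟨p, rfl⟩ : ∃ p, i = finRotate 4 p :=
    ⟨(finRotate 4).symm i, ((finRotate 4).apply_symm_apply i).symm⟩
  set i := finRotate 4 p with hi
  have hzt : z = (1 - t) • C i + t • C (finRotate 4 i) := by
    simp only [Complex.real_smul]; push_cast; linear_combination ht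
  have h1 := hz p
  have h2 := hz (finRotate 4 i)
  rw [hzt, cross_combo _ _ _ _ (by ring)] at h1 h2
  have h3 := h p (finRotate 4 i) (finRotate_finRotate_ne_self (by norm_num) p)
    (finRotate_ne_self (by norm_num) _)
  have h4 := h (finRotate 4 i) i (finRotate_ne_self (by norm_num) _).symm
    (finRotate_finRotate_ne_self (by norm_num) i).symm
  have z1 : cross (C (finRotate 4 p) - C p) (C i - C p) = 0 := by
    rw [← hi]; unfold cross; ring
  have z2 : cross (C (finRotate 4 (finRotate 4 i)) - C (finRotate 4 i))
      (C (finRotate 4 i) - C (finRotate 4 i)) = 0 := by unfold cross; simp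
  rw [z1] at h1
  rw [z2] at h2
  have ht0 : 0 ≤ t := by
    by_contra hneg
    rw [not_le] at hneg
    have := mul_neg_of_neg_of_pos hneg h3
    linarith
  have ht1 : 0 ≤ 1 - t := by
    by_contra hneg
    rw [not_le] at hneg
    have := mul_neg_of_neg_of_pos hneg h4
    linarith
  rw [hzt]
  exact ⟨1 - t, t, ht1, ht0, by ring, rfl⟩

omit h in
theorem quad_convex : Convex ℝ {z | ∀ i, 0 ≤ cross (C (finRotate 4 i) - C i) (z - C i)} := by
  intro z hz w hw a b ha hb hab i
  rw [cross_combo _ _ _ _ hab]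
  exact add_nonneg (mul_nonneg ha (hz i)) (mul_nonneg hb (hw i))

/-- The four values of `cross` at `z` add up to the constant `A`, twice the area. All are
nonnegative, so each is at most `A`; those of two adjacent edges are affine coordinates of `z`. -/
theorem quad_isBounded :
    Bornology.IsBounded {z | ∀ i, 0 ≤ cross (C (finRotate 4 i) - C i) (z - C i)} := by
  have hr0 : finRotate 4 0 = 1 := rfl
  have hr1 : finRotate 4 1 = 2 := rfl
  have hr2 : finRotate 4 2 = 3 := rfl
  have hr3 : finRotate 4 3 = 0 := rfl
  set A : ℝ := cross (C 1 - C 0) (C 2 - C 0) + cross (C 2 - C 0) (C 3 - C 0) with hA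
  set Δ : ℝ := cross (C 1 - C 0) (C 2 - C 0) with hΔ
  have hΔ0 : 0 < Δ := h 0 2 (by decide) (by decide)
  refine (Metric.isBounded_iff_subset_closedBall (C 1)).2
    ⟨(A * ‖C 2 - C 1‖ + A * ‖C 1 - C 0‖) / Δ, fun z hz => ?_⟩
  have h0 := hz 0
  have h1 := hz 1
  have h2 := hz 2
  have h3 := hz 3
  rw [hr0] at h0; rw [hr1] at h1; rw [hr2] at h2; rw [hr3] at h3
  set a := cross (C 1 - C 0) (z - C 0) with ha
  set c := cross (C 2 - C 1) (z - C 1) with hc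
  have hsum : a + c + cross (C 3 - C 2) (z - C 2) + cross (C 0 - C 3) (z - C 3) = A := by
    rw [ha, hc, hA, hΔ]; unfold cross; simp; ring
  have key : (Δ : ℂ) * (z - C 1) = a * (C 2 - C 1) - c * (C 1 - C 0) := by
    apply Complex.ext
    · rw [ha, hc, hΔ]; unfold cross; simp; ring
    · rw [ha, hc, hΔ]; unfold cross; simp; ring
  rw [mem_closedBall_iff_norm, le_div_iff₀ hΔ0]
  have e1 : ‖z - C 1‖ * Δ = ‖(Δ : ℂ) * (z - C 1)‖ := by
    rw [norm_mul, Complex.norm_real, Real.norm_of_nonneg hΔ0.le]; ring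
  rw [e1, key]
  refine (norm_sub_le _ _).trans ?_
  rw [norm_mul, norm_mul, Complex.norm_real, Complex.norm_real, Real.norm_of_nonneg h0,
    Real.norm_of_nonneg h1]
  gcongr
  · linarith
  · linarith

/-- One inclusion is star-shapedness. For the other, the closed set `Q` without the boundary is the
open set `O`, so a component of the complement that meets `O` stays in `O`, which is bounded. -/
theorem quad_fill : fill ((⟨C⟩ : Polygon ℂ 4).boundary ℝ) =
    {z | ∀ i, 0 ≤ cross (C (finRotate 4 i) - C i) (z - C i)} := by
  set Q := {z | ∀ i, 0 ≤ cross (C (finRotate 4 i) - C i) (z - C i)} with hQ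
  have hconv : Convex ℝ Q := quad_convex
  have hCQ : ∀ k, C k ∈ Q := by
    intro k i
    by_cases h1 : k = i
    · rw [h1]; simp [cross]
    by_cases h2 : k = finRotate 4 i
    · rw [h2]; unfold cross; nlinarith
    · exact (h i k h1 h2).le
  have hΓ : (⟨C⟩ : Polygon ℂ 4).boundary ℝ ⊆ Q := by
    intro z hz
    obtain ⟨i, hi⟩ := mem_boundary_iff.1 hz
    exact hconv.segment_subset (hCQ _) (hCQ _) hi
  apply Subset.antisymm
  · exact fill_subset_of_starConvex (hCQ 0) (hconv.starConvex (hCQ 0)) hΓ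
  · intro x hx
    by_cases hxΓ : x ∈ (⟨C⟩ : Polygon ℂ 4).boundary ℝ
    · exact Or.inl hxΓ
    refine Or.inr ⟨hxΓ, (quad_isBounded h).subset ?_⟩
    set O := {z | ∀ i, 0 < cross (C (finRotate 4 i) - C i) (z - C i)} with hO
    have hcont : ∀ i, Continuous fun z => cross (C (finRotate 4 i) - C i) (z - C i) := fun i => by
      unfold cross; fun_prop
    have hOo : IsOpen O := by
      rw [hO, ofPred_forall]
      exact isOpen_iInter_of_finite fun i => isOpen_lt continuous_const (hcont i)
    have hQc : IsClosed Q := by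
      rw [hQ, ofPred_forall]
      exact isClosed_iInter fun i => isClosed_le continuous_const (hcont i)
    have hQO : ∀ z ∈ Q, z ∉ (⟨C⟩ : Polygon ℂ 4).boundary ℝ → z ∈ O := by
      intro z hz hzΓ i
      refine lt_of_le_of_ne (hz i) fun h0 => hzΓ ?_
      exact mem_boundary_iff.2 ⟨i, quad_segment_of_cross_eq_zero h hz h0.symm⟩
    have hcomp : connectedComponentIn ((⟨C⟩ : Polygon ℂ 4).boundary ℝ)ᶜ x ⊆ O := by
      refine isPreconnected_connectedComponentIn.subset_left_of_subset_union hOo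
        hQc.isOpen_compl ?_ ?_ ⟨x, mem_connectedComponentIn hxΓ, hQO x hx hxΓ⟩
      · exact disjoint_left.2 fun z hz hz' => hz' fun i => (hz i).le
      · intro z hz
        by_cases hzQ : z ∈ Q
        · exact Or.inl (hQO z hzQ (connectedComponentIn_subset _ _ hz))
        · exact Or.inr hzQ
    exact hcomp.trans fun z hz i => (hz i).le

end Quad

/-- The vertices of a trapezoid with sides parallel to `d`. -/
def trapezoid (u d : ℂ) (x₀ x₁ x₂ x₃ y₀ y₁ : ℝ) : Fin 4 → ℂ :=
  ![u + d * (x₀ + y₀ * Complex.I), u + d * (x₁ + y₀ * Complex.I),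
    u + d * (x₂ + y₁ * Complex.I), u + d * (x₃ + y₁ * Complex.I)]

theorem cross_frame (d z w : ℂ) : cross (d * z) (d * w) = Complex.normSq d * cross z w := by
  unfold cross; simp [Complex.normSq_apply]; ring

theorem forall_fin_four {p : Fin 4 → Prop} (h0 : p 0) (h1 : p 1) (h2 : p 2) (h3 : p 3) :
    ∀ i, p i := by
  intro i; fin_cases i <;> assumption

section Trapezoid

variable {u d : ℂ} {x₀ x₁ x₂ x₃ y₀ y₁ : ℝ}

theorem trapezoid_cross (hd : d ≠ 0) (h0 : x₀ < x₁) (h1 : x₃ < x₂) (hy : y₀ < y₁) :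
    ∀ i k, k ≠ i → k ≠ finRotate 4 i →
      0 < cross (trapezoid u d x₀ x₁ x₂ x₃ y₀ y₁ (finRotate 4 i) -
          trapezoid u d x₀ x₁ x₂ x₃ y₀ y₁ i)
        (trapezoid u d x₀ x₁ x₂ x₃ y₀ y₁ k - trapezoid u d x₀ x₁ x₂ x₃ y₀ y₁ i) := by
  have hr0 : finRotate 4 0 = 1 := rfl
  have hr1 : finRotate 4 1 = 2 := rfl
  have hr2 : finRotate 4 2 = 3 := rfl
  have hr3 : finRotate 4 3 = 0 := rfl
  have hA := mul_pos (sub_pos.2 h0) (sub_pos.2 hy)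
  have hB := mul_pos (sub_pos.2 h1) (sub_pos.2 hy)
  have hpos : 0 < Complex.normSq d := Complex.normSq_pos.2 hd
  have e : ∀ a b a' b' : ℝ, (u + d * (a + b * Complex.I)) - (u + d * (a' + b' * Complex.I)) =
      d * (((a - a' : ℝ) : ℂ) + ((b - b' : ℝ) : ℂ) * Complex.I) := by
    intros; push_cast; ring
  have c : ∀ a b a' b' : ℝ, cross ((a : ℂ) + b * Complex.I) ((a' : ℂ) + b' * Complex.I) =
      a * b' - b * a' := by
    intros; unfold cross; simp
  apply forall_fin_four <;> apply forall_fin_four <;>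
    simp only [hr0, hr1, hr2, hr3, trapezoid, Matrix.cons_val, e, cross_frame, c] <;>
    intro hk1 hk2 <;>
    first
    | exact (hk1 rfl).elim
    | exact (hk2 rfl).elim
    | exact mul_pos hpos (by nlinarith [hA, hB])

theorem trapezoid_bounds (hd : d ≠ 0) (h0 : x₀ < x₁) (h1 : x₃ < x₂) {x y : ℝ} {z : ℂ}
    (hz : z = u + d * (x + y * Complex.I))
    (h : ∀ i, 0 ≤ cross (trapezoid u d x₀ x₁ x₂ x₃ y₀ y₁ (finRotate 4 i) -
          trapezoid u d x₀ x₁ x₂ x₃ y₀ y₁ i) (z - trapezoid u d x₀ x₁ x₂ x₃ y₀ y₁ i)) :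
    y₀ ≤ y ∧ y ≤ y₁ ∧ (x₃ - x₀) * (y - y₁) ≤ (y₁ - y₀) * (x - x₃) ∧
      (y₁ - y₀) * (x - x₂) ≤ (x₂ - x₁) * (y - y₁) := by
  have hr0 : finRotate 4 0 = 1 := rfl
  have hr1 : finRotate 4 1 = 2 := rfl
  have hr2 : finRotate 4 2 = 3 := rfl
  have hr3 : finRotate 4 3 = 0 := rfl
  have hpos : 0 < Complex.normSq d := Complex.normSq_pos.2 hd
  have e : ∀ a b a' b' : ℝ, (u + d * (a + b * Complex.I)) - (u + d * (a' + b' * Complex.I)) =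
      d * (((a - a' : ℝ) : ℂ) + ((b - b' : ℝ) : ℂ) * Complex.I) := by
    intros; push_cast; ring
  have c : ∀ a b a' b' : ℝ, cross ((a : ℂ) + b * Complex.I) ((a' : ℂ) + b' * Complex.I) =
      a * b' - b * a' := by
    intros; unfold cross; simp
  subst hz
  have k0 := h 0
  have k1 := h 1
  have k2 := h 2
  have k3 := h 3
  simp only [hr0, hr1, hr2, hr3, trapezoid, Matrix.cons_val, e, cross_frame, c] at k0 k1 k2 k3
  have k0 := nonneg_of_mul_nonneg_right k0 hpos
  have k1 := nonneg_of_mul_nonneg_right k1 hpos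
  have k2 := nonneg_of_mul_nonneg_right k2 hpos
  have k3 := nonneg_of_mul_nonneg_right k3 hpos
  refine ⟨?_, ?_, by linarith, by linarith⟩
  · have : 0 ≤ (x₁ - x₀) * (y - y₀) := by linarith
    linarith [nonneg_of_mul_nonneg_right this (by linarith)]
  · have : 0 ≤ (x₂ - x₃) * (y₁ - y) := by linarith
    linarith [nonneg_of_mul_nonneg_right this (by linarith)]

end Trapezoid

/-! ### Cutting the strips of a mitered offset

The strip swept by an edge is cut by two segments, joining the ends of the offset edge to the
points at distance `c` and `c'` from the ends of the edge, into a middle part and two corners. -/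

section Cut

variable {n : ℕ} (P : Polygon ℂ n) (b c c' : ℝ) (i : Fin n)

/-- The cut from the offset vertex (`side = 0`, `sdist = b`) to the point at distance `c` on the
edge (`side = c`, `sdist = 0`) has the equation `b * side = c * (b - sdist)`. At the far end `side`
is negated. -/
def midStrip : Set ℂ := {z | z ∈ strip P (Icc 0 b) i ∧ c * (b - sdist P i z) ≤ b * side P i z ∧
  c' * (b - sdist P i z) ≤ - (b * side P (finRotate n i) z)}

def leftCorner : Set ℂ :=
  {z | z ∈ strip P (Icc 0 b) i ∧ b * side P i z ≤ c * (b - sdist P i z)}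

def rightCorner : Set ℂ :=
  {z | z ∈ strip P (Icc 0 b) i ∧ - (b * side P (finRotate n i) z) ≤ c' * (b - sdist P i z)}

theorem convex_leftCorner : Convex ℝ (leftCorner P b c i) := by
  intro z hz w hw s t hs ht hst
  refine ⟨convex_strip P (convex_Icc 0 b) i hz.1 hw.1 hs ht hst, ?_⟩
  rw [sdist_combo _ _ _ _ hst, side_combo _ _ _ _ hst]
  have h1 := mul_le_mul_of_nonneg_left hz.2 hs
  have h2 := mul_le_mul_of_nonneg_left hw.2 ht
  have : s = 1 - t := by linarith
  subst this
  linarith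

theorem convex_rightCorner : Convex ℝ (rightCorner P b c' i) := by
  intro z hz w hw s t hs ht hst
  refine ⟨convex_strip P (convex_Icc 0 b) i hz.1 hw.1 hs ht hst, ?_⟩
  rw [sdist_combo _ _ _ _ hst, side_combo _ _ _ _ hst]
  have h1 := mul_le_mul_of_nonneg_left hz.2 hs
  have h2 := mul_le_mul_of_nonneg_left hw.2 ht
  have : s = 1 - t := by linarith
  subst this
  linarith

end Cut

namespace IsSimple

variable {n : ℕ} {P : Polygon ℂ n} (hP : IsSimple P) {b c c' : ℝ} {i j : Fin n} {z : ℂ}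
include hP

theorem sdist_left (i : Fin n) : sdist P i (P i) = 0 := by
  have := hP.sdist_offset 0 i
  rwa [hP.offset_zero] at this

theorem side_left (i : Fin n) : side P i (P i) = 0 := by
  have := hP.side_offset 0 i
  rwa [hP.offset_zero] at this

theorem left_mem_strip (hb : 0 ≤ b) (i : Fin n) : P i ∈ strip P (Icc 0 b) i := by
  have := (hP.mem_segment_iff i).1 (left_mem_segment ℝ _ _)
  exact ⟨by rw [show sdist P i (P i) = 0 from this.1]; exact ⟨le_rfl, hb⟩, this.2⟩

theorem right_mem_strip (hb : 0 ≤ b) (i : Fin n) : P (finRotate n i) ∈ strip P (Icc 0 b) i := by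
  have := (hP.mem_segment_iff i).1 (right_mem_segment ℝ _ _)
  exact ⟨by rw [show sdist P i (P (finRotate n i)) = 0 from this.1]; exact ⟨le_rfl, hb⟩, this.2⟩

theorem sdist_right (i : Fin n) : sdist P i (P (finRotate n i)) = 0 :=
  ((hP.mem_segment_iff i).1 (right_mem_segment ℝ _ _)).1

theorem left_mem_leftCorner (hb : 0 ≤ b) (hc : 0 ≤ c) (i : Fin n) :
    P i ∈ leftCorner P b c i := by
  refine ⟨hP.left_mem_strip hb i, ?_⟩
  rw [hP.side_left, hP.sdist_left, mul_zero, sub_zero]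
  positivity

theorem right_mem_rightCorner (hb : 0 ≤ b) (hc : 0 ≤ c') (i : Fin n) :
    P (finRotate n i) ∈ rightCorner P b c' i := by
  refine ⟨hP.right_mem_strip hb i, ?_⟩
  rw [hP.side_left, hP.sdist_right, mul_zero, sub_zero, neg_zero]
  positivity

theorem mem_segment_of_cut_left (hb : 0 < b) (hz : sdist P i z ∈ Icc 0 b)
    (h : b * side P i z = c * (b - sdist P i z)) :
    z ∈ segment ℝ (offset P b i) (P i + c * edgeDir P i) := by
  have h0 := hP.eq_start i z
  refine ⟨sdist P i z / b, 1 - sdist P i z / b, div_nonneg hz.1 hb.le, ?_, by ring, ?_⟩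
  · rw [sub_nonneg, div_le_one hb]; exact hz.2
  · have hb' : (b : ℂ) ≠ 0 := by exact_mod_cast hb.ne'
    have h' : (b : ℂ) * side P i z = c * (b - sdist P i z) := by exact_mod_cast h
    rw [hP.offset_apply]
    simp only [Complex.real_smul]
    push_cast
    apply mul_left_cancel₀ hb'
    field_simp
    linear_combination -b * h0 - edgeDir P i * h'

theorem mem_segment_of_cut_right (hb : 0 < b) (hz : sdist P i z ∈ Icc 0 b)
    (h : - (b * side P (finRotate n i) z) = c' * (b - sdist P i z)) :
    z ∈ segment ℝ (offset P b (finRotate n i)) (P (finRotate n i) - c' * edgeDir P i) := by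
  have h0 := hP.eq_start i z
  have hs := hP.side_finRotate i z
  refine ⟨sdist P i z / b, 1 - sdist P i z / b, div_nonneg hz.1 hb.le, ?_, by ring, ?_⟩
  · rw [sub_nonneg, div_le_one hb]; exact hz.2
  · have hb' : (b : ℂ) ≠ 0 := by exact_mod_cast hb.ne'
    have h' : -((b : ℂ) * side P (finRotate n i) z) = c' * (b - sdist P i z) := by exact_mod_cast h
    have hs' : (side P (finRotate n i) z : ℂ) = side P i z +
      (slope P i + slope P (finRotate n i)) * sdist P i z - edgeLen P i := by exact_mod_cast hs
    have hl := hP.edgeLen_mul_edgeDir i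
    rw [hP.offset_apply, hP.miter_finRotate]
    unfold miter at h0
    simp only [Complex.real_smul]
    push_cast
    apply mul_left_cancel₀ hb'
    field_simp
    linear_combination -b * h0 + edgeDir P i * h' + b * edgeDir P i * hs' - b * hl

theorem segment_subset_leftCorner (hb : 0 < b) (hm : IsMiteredOffset P b) (hc : 0 ≤ c)
    (hcl : c ≤ edgeLen P i) :
    segment ℝ (offset P b i) (P i + c * edgeDir P i) ⊆ leftCorner P b c i := by
  refine (convex_leftCorner P b c i).segment_subset ⟨?_, ?_⟩ ?_
  · have := (hP.mem_offset_segment_iff (hP.lenAt_pos hm i ⟨hb.le, le_rfl⟩).le).1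
      (left_mem_segment ℝ _ _)
    exact ⟨by rw [show sdist P i _ = b from this.1]; exact ⟨hb.le, le_rfl⟩, this.2⟩
  · rw [hP.side_offset, hP.sdist_offset]; simp
  · obtain ⟨h1, h2⟩ := hP.side_sdist_of_eq (i := i) (z := P i + c * edgeDir P i) (ξ := c) (t := 0)
      (by simp)
    have h3 := hP.side_finRotate i (P i + c * edgeDir P i)
    rw [h1, h2] at h3
    exact ⟨⟨by rw [h2]; exact ⟨le_rfl, hb.le⟩, by rwa [h1], by linarith⟩,
      by rw [h1, h2]; linarith⟩

theorem segment_subset_rightCorner (hb : 0 < b) (hm : IsMiteredOffset P b) (hc : 0 ≤ c')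
    (hcl : c' ≤ edgeLen P i) :
    segment ℝ (offset P b (finRotate n i)) (P (finRotate n i) - c' * edgeDir P i) ⊆
      rightCorner P b c' i := by
  refine (convex_rightCorner P b c' i).segment_subset ⟨?_, ?_⟩ ?_
  · have := (hP.mem_offset_segment_iff (hP.lenAt_pos hm i ⟨hb.le, le_rfl⟩).le).1
      (right_mem_segment ℝ _ _)
    exact ⟨by rw [show sdist P i _ = b from this.1]; exact ⟨hb.le, le_rfl⟩, this.2⟩
  · have := (hP.mem_offset_segment_iff (hP.lenAt_pos hm i ⟨hb.le, le_rfl⟩).le).1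
      (right_mem_segment ℝ _ _)
    rw [hP.side_offset, show sdist P i _ = b from this.1]; simp
  · obtain ⟨h1, h2⟩ := hP.side_sdist_of_eq (i := i) (z := P (finRotate n i) - c' * edgeDir P i)
      (ξ := edgeLen P i - c') (t := 0)
      (by push_cast; linear_combination -hP.edgeLen_mul_edgeDir i)
    have h3 := hP.side_finRotate i (P (finRotate n i) - c' * edgeDir P i)
    rw [h1, h2] at h3
    exact ⟨⟨by rw [h2]; exact ⟨le_rfl, hb.le⟩, by rw [h1]; linarith, by linarith⟩,
      by rw [h2]; linear_combination -b * h3⟩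

/-- On the common bisector `side` vanishes, so a positive cut on either side of it leaves only the
point with `sdist = b`. With both cuts equal to `0` the middle parts would share a whole stretch of
the bisector. -/
theorem offset_of_midStrip (hz : z ∈ midStrip P b c c' i) {d d' : ℝ}
    (hz' : z ∈ midStrip P b d d' (finRotate n i)) (hcd : 0 < c' ∨ 0 < d) :
    z = offset P b (finRotate n i) := by
  have h := hP.eq_offset_of_mem_strip hz.1 hz'.1
  have h1 := hz.2.2
  have h2 := hz'.2.1
  rw [h.2.1] at h1 h2
  rw [← h.1] at h2
  have h3 : sdist P i z = b := by
    have h4 := hz.1.1.2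
    apply le_antisymm h4
    rcases hcd with h5 | h5
    · exact sub_nonpos.1 (nonpos_of_mul_nonpos_right (by linarith) h5)
    · exact sub_nonpos.1 (nonpos_of_mul_nonpos_right (by linarith) h5)
  rw [h.2.2, h3]

variable (hm : IsMiteredOffset P b)
include hm

/-- The width of the strip is affine in the depth, from `edgeLen` down or up to the positive length
at depth `b`, while the widths cut off are proportional to `b - sdist`. It suffices to compare at
the two extremes. -/
theorem cut_lt (h : c + c' < edgeLen P i) (hz : sdist P i z ∈ Icc 0 b) :
    (c + c') * (b - sdist P i z) < b * lenAt P i (sdist P i z) := by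
  have h0 := hm.1
  have h1 := hP.lenAt_pos hm i ⟨h0.le, le_rfl⟩
  have e : b * lenAt P i (sdist P i z) =
      (b - sdist P i z) * edgeLen P i + sdist P i z * lenAt P i b := by
    unfold lenAt; ring
  rw [e]
  rcases hz.2.lt_or_eq with h2 | h2
  · have := mul_lt_mul_of_pos_right h (sub_pos.2 h2)
    have := mul_nonneg hz.1 h1.le
    linarith
  · rw [h2]
    have := mul_pos h0 h1
    linarith

theorem leftCorner_inter_rightCorner (h : c + c' < edgeLen P i) (hz : z ∈ leftCorner P b c i)
    (hz' : z ∈ rightCorner P b c' i) : False := by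
  have h1 := hP.cut_lt hm h hz.1.1
  have h2 := hP.side_sub_side i z
  have h3 := hz.2
  have h4 := hz'.2
  rw [← h2] at h1
  linarith

variable (hcc : IsCounterclockwise P)
include hcc

theorem strip_of_leftCorner (h : c < edgeLen P i) (hz : z ∈ leftCorner P b c i)
    (hz' : z ∈ strip P (Icc 0 b) j) : j = i ∨ (i = finRotate n j ∧ side P i z = 0) := by
  rcases hP.strip_inter hcc hm hz.1 hz' with h1 | ⟨rfl, h1⟩ | h1
  · exact Or.inl h1.symm
  -- The bisector at the far end counts as a right corner with cut `0`, and a left corner does not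
  -- reach that far.
  · exact (hP.leftCorner_inter_rightCorner hm (c' := 0) (by linarith) hz
      ⟨hz.1, by rw [h1]; simp⟩).elim
  · exact Or.inr h1

theorem strip_of_rightCorner (h : c' < edgeLen P i) (hz : z ∈ rightCorner P b c' i)
    (hz' : z ∈ strip P (Icc 0 b) j) : j = i ∨ (j = finRotate n i ∧ side P j z = 0) := by
  rcases hP.strip_inter hcc hm hz.1 hz' with h1 | h1 | ⟨rfl, h1⟩
  · exact Or.inl h1.symm
  · exact Or.inr h1
  · exact (hP.leftCorner_inter_rightCorner hm (c := 0) (by linarith)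
      ⟨hz.1, by rw [h1]; simp⟩ hz).elim

theorem segment_of_fill_offset (hz : z ∈ fill ((offset P b).boundary ℝ))
    (hz' : z ∈ strip P (Icc 0 b) i) :
    z ∈ segment ℝ (offset P b i) (offset P b (finRotate n i)) :=
  (hP.mem_offset_segment_iff (hP.lenAt_pos hm i ⟨hm.1.le, le_rfl⟩).le).2
    ⟨hP.strip_inter_fill hcc hm hz' hz, hz'.2⟩

theorem eq_of_fill_offset_leftCorner (hz : z ∈ fill ((offset P b).boundary ℝ))
    (hz' : z ∈ leftCorner P b c i) : z = offset P b i := by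
  have h := hP.strip_inter_fill hcc hm hz'.1 hz
  have h1 := hz'.2
  rw [h, sub_self, mul_zero] at h1
  have h2 : side P i z = 0 := le_antisymm (nonpos_of_mul_nonpos_right h1 hm.1) hz'.1.2.1
  have := hP.eq_offset h2
  rwa [h] at this

theorem eq_of_fill_offset_rightCorner (hz : z ∈ fill ((offset P b).boundary ℝ))
    (hz' : z ∈ rightCorner P b c' i) : z = offset P b (finRotate n i) := by
  have h := hP.strip_inter_fill hcc hm hz'.1 hz
  have h1 := hz'.2
  rw [h, sub_self, mul_zero] at h1
  have h2 : side P (finRotate n i) z = 0 :=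
    le_antisymm hz'.1.2.2 (by nlinarith [hm.1])
  have := hP.eq_offset h2
  rwa [hP.sdist_finRotate i h2, h] at this

end IsSimple

/-! ### The copies of an edge and the new edges across it -/

/-- The offset edge of the neighbour, in the frame of `P`: reversing the edge turns depth `t` into
height `-t` and exchanges the two ends. -/
theorem PolygonCell.offset_of_opposite {P Q : PolygonCell} {i : Fin P.n} {j : Fin Q.n}
    (h1 : P.bd i = Q.bd (finRotate _ j)) (h2 : P.bd (finRotate _ i) = Q.bd j) (t : ℝ) :
    offset Q.bd t (finRotate _ j) = P.bd i + edgeDir P.bd i *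
      (((t * slope Q.bd (finRotate _ j) : ℝ) : ℂ) + ((-t : ℝ) : ℂ) * Complex.I) ∧
    offset Q.bd t j = P.bd i + edgeDir P.bd i *
      (((edgeLen P.bd i - t * slope Q.bd j : ℝ) : ℂ) + ((-t : ℝ) : ℂ) * Complex.I) := by
  obtain ⟨hd, hl, -⟩ := sdist_of_opposite h1 h2
  have h3 := P.simple.edgeLen_mul_edgeDir i
  constructor
  · rw [Q.simple.offset_apply, Q.simple.miter_finRotate, hd, ← h1]
    push_cast; ring
  · rw [Q.simple.offset_apply, miter, hd, ← h2]
    push_cast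
    linear_combination -h3

theorem IsSimple.side_sdist_frame {n : ℕ} {P : Polygon ℂ n} (hP : IsSimple P) {i : Fin n} {z : ℂ}
    {x y : ℝ} (h : z = P i + edgeDir P i * ((x : ℂ) + (y : ℂ) * Complex.I)) :
    side P i z = x - slope P i * y ∧ sdist P i z = y ∧
      side P (finRotate n i) z = x + slope P (finRotate n i) * y - edgeLen P i := by
  obtain ⟨h1, h2⟩ := hP.side_sdist_of_eq (i := i) (z := z) (ξ := x - slope P i * y) (t := y)
    (by rw [h]; unfold miter; push_cast; ring)
  refine ⟨h1, h2, ?_⟩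
  rw [hP.side_finRotate, h1, h2]; ring

namespace Mesh
variable {F H : Type*} {K : Mesh F H}
namespace IsAdmissible

variable [Finite F] [Finite H] (hK : K.IsAdmissible)

/-- The copy of the first end of the `i`-th edge of `f` in the cell on the other side. -/
def nbStart (f : F) (i : Fin (K.poly f).n) : K.HatVertex :=
  (exists_hatVertex (hK.edge_mem_across f i) (Sym2.mem_mk_left _ _)).choose

/-- The copy of the second end of the `i`-th edge of `f` in the cell on the other side. -/
def nbEnd (f : F) (i : Fin (K.poly f).n) : K.HatVertex :=
  (exists_hatVertex (hK.edge_mem_across f i) (Sym2.mem_mk_right _ _)).choose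

theorem cell_nbStart (f : F) (i : Fin (K.poly f).n) : (hK.nbStart f i).cell = hK.across f i :=
  (exists_hatVertex (hK.edge_mem_across f i) (Sym2.mem_mk_left _ _)).choose_spec.1

theorem base_nbStart (f : F) (i : Fin (K.poly f).n) : (hK.nbStart f i).base = (K.poly f).bd i :=
  (exists_hatVertex (hK.edge_mem_across f i) (Sym2.mem_mk_left _ _)).choose_spec.2

theorem cell_nbEnd (f : F) (i : Fin (K.poly f).n) : (hK.nbEnd f i).cell = hK.across f i :=
  (exists_hatVertex (hK.edge_mem_across f i) (Sym2.mem_mk_right _ _)).choose_spec.1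

theorem base_nbEnd (f : F) (i : Fin (K.poly f).n) :
    (hK.nbEnd f i).base = (K.poly f).bd (finRotate _ i) :=
  (exists_hatVertex (hK.edge_mem_across f i) (Sym2.mem_mk_right _ _)).choose_spec.2

theorem nbStart_eq {f g : F} {i : Fin (K.poly f).n} {j : Fin (K.poly g).n} (hfg : f ≠ g)
    (he : (K.poly f).edge i = (K.poly g).edge j) :
    hK.nbStart f i = .poly g (finRotate _ j) :=
  HatVertex.ext_cell_base (by rw [cell_nbStart, hK.across_symm hfg.symm he.symm]; rfl)
    (by rw [base_nbStart]; exact ((hK.meet f g hfg).opposite he).1)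

theorem nbEnd_eq {f g : F} {i : Fin (K.poly f).n} {j : Fin (K.poly g).n} (hfg : f ≠ g)
    (he : (K.poly f).edge i = (K.poly g).edge j) : hK.nbEnd f i = .poly g j :=
  HatVertex.ext_cell_base (by rw [cell_nbEnd, hK.across_symm hfg.symm he.symm]; rfl)
    (by rw [base_nbEnd]; exact ((hK.meet f g hfg).opposite he).2)

theorem exists_of_isPoly {f : F} {i : Fin (K.poly f).n} (h : (hK.across f i).IsPoly) :
    ∃ g j, f ≠ g ∧ (K.poly f).edge i = (K.poly g).edge j := by
  obtain ⟨g, hg⟩ := h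
  obtain ⟨h1, j, h2⟩ := hK.across_eq_poly_iff.1 hg
  exact ⟨g, j, h1.symm, h2⟩

theorem isPoly_of_edge_eq {f g : F} {i : Fin (K.poly f).n} {j : Fin (K.poly g).n} (hfg : f ≠ g)
    (he : (K.poly f).edge i = (K.poly g).edge j) : (hK.across f i).IsPoly :=
  ⟨g, hK.across_symm hfg.symm he.symm⟩

theorem place_nbStart {f : F} {i : Fin (K.poly f).n} (h : ¬ (hK.across f i).IsPoly) (b : F → ℝ) :
    K.place b (hK.nbStart f i) = (K.poly f).bd i := by
  rw [HatVertex.place_of_not_isPoly (by rwa [cell_nbStart]), base_nbStart]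

theorem place_nbEnd {f : F} {i : Fin (K.poly f).n} (h : ¬ (hK.across f i).IsPoly) (b : F → ℝ) :
    K.place b (hK.nbEnd f i) = (K.poly f).bd (finRotate _ i) := by
  rw [HatVertex.place_of_not_isPoly (by rwa [cell_nbEnd]), base_nbEnd]

/-! ### Where the new edges cross the edges of the complex -/

variable (b : F → ℝ)

/-- The distance from the first end of the `i`-th edge of `f` at which the new edge joining the
copies of this end crosses the edge. -/
def cutStart (f : F) (i : Fin (K.poly f).n) : ℝ :=
  b f * side (K.poly f).bd i (K.place b (hK.nbStart f i)) /
    (b f - sdist (K.poly f).bd i (K.place b (hK.nbStart f i)))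

/-- The distance from the second end of the `i`-th edge of `f` at which the new edge joining the
copies of this end crosses the edge. -/
def cutEnd (f : F) (i : Fin (K.poly f).n) : ℝ :=
  - (b f * side (K.poly f).bd (finRotate _ i) (K.place b (hK.nbEnd f i))) /
    (b f - sdist (K.poly f).bd i (K.place b (hK.nbEnd f i)))

variable {b} (hb : K.IsOffsetChoice b)
include hb

/-- The copies of an edge on the other side, in coordinates along the edge. -/
theorem exists_frame (f : F) (i : Fin (K.poly f).n) : ∃ b' k k' : ℝ,
    K.place b (hK.nbStart f i) = (K.poly f).bd i + edgeDir (K.poly f).bd i *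
      (((b' * k : ℝ) : ℂ) + ((-b' : ℝ) : ℂ) * Complex.I) ∧
    K.place b (hK.nbEnd f i) = (K.poly f).bd i + edgeDir (K.poly f).bd i *
      (((edgeLen (K.poly f).bd i - b' * k' : ℝ) : ℂ) + ((-b' : ℝ) : ℂ) * Complex.I) ∧
    0 ≤ b' ∧ b' * k + b' * k' < edgeLen (K.poly f).bd i ∧
    ((hK.across f i).IsPoly → 0 < b' ∧ 0 < slope (K.poly f).bd i + k ∧
      0 < slope (K.poly f).bd (finRotate _ i) + k') ∧
    (¬ (hK.across f i).IsPoly → b' = 0) ∧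
    ∀ (g : F) (j : Fin (K.poly g).n), f ≠ g → (K.poly f).edge i = (K.poly g).edge j →
      b' = b g ∧ k = slope (K.poly g).bd (finRotate _ j) ∧ k' = slope (K.poly g).bd j := by
  by_cases h : (hK.across f i).IsPoly
  · obtain ⟨g, j, hfg, he⟩ := hK.exists_of_isPoly h
    obtain ⟨o1, o2⟩ := (hK.meet f g hfg).opposite he
    obtain ⟨e1, e2⟩ := PolygonCell.offset_of_opposite o1 o2 (b g)
    refine ⟨b g, slope (K.poly g).bd (finRotate _ j), slope (K.poly g).bd j, ?_, ?_, (hb g).1.le,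
      ?_, fun _ => ⟨(hb g).1, (hK.meet f g hfg).slope_add_pos he, ?_⟩, fun h' => (h' h).elim, ?_⟩
    · rw [hK.nbStart_eq hfg he]; exact e1
    · rw [hK.nbEnd_eq hfg he]; exact e2
    · have := (K.poly g).simple.lenAt_pos (hb g) j ⟨(hb g).1.le, le_rfl⟩
      unfold lenAt at this
      rw [(PolygonCell.sdist_of_opposite o1 o2).2.1] at this
      linarith
    · rw [add_comm]; exact (hK.meet f g hfg).symm.slope_add_pos he.symm
    · intro g' j' hfg' he'
      have h1 := hK.across_symm hfg.symm he.symm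
      have h2 := hK.across_symm hfg'.symm he'.symm
      rw [h1] at h2
      cases h2
      rw [PolygonCell.edge_injective (he.symm.trans he')]
      exact ⟨rfl, rfl, rfl⟩
  -- A hole or the outside cell behaves like a neighbour with offset distance `0`; the two slopes
  -- are then irrelevant.
  · refine ⟨0, 0, 0, ?_, ?_, le_rfl, ?_, fun h' => (h h').elim, fun _ => rfl, ?_⟩
    · rw [hK.place_nbStart h]; simp
    · rw [hK.place_nbEnd h]
      have := (K.poly f).simple.edgeLen_mul_edgeDir i
      push_cast
      linear_combination -this
    · simpa using (K.poly f).simple.edgeLen_pos i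
    · intro g j hfg he
      exact (h (hK.isPoly_of_edge_eq hfg he)).elim

/-- The segment from `(b κ, b)` to `(b' k, -b')` reaches height `0` with weights `b' / (b + b')` and
`b / (b + b')`. The result is symmetric in the two cells, which is why both sides of an edge see the
same cuts. -/
theorem cut_eq {f : F} {i : Fin (K.poly f).n} {b' k k' : ℝ}
    (h1 : K.place b (hK.nbStart f i) = (K.poly f).bd i + edgeDir (K.poly f).bd i *
      (((b' * k : ℝ) : ℂ) + ((-b' : ℝ) : ℂ) * Complex.I))
    (h2 : K.place b (hK.nbEnd f i) = (K.poly f).bd i + edgeDir (K.poly f).bd i *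
      (((edgeLen (K.poly f).bd i - b' * k' : ℝ) : ℂ) + ((-b' : ℝ) : ℂ) * Complex.I))
    (h0 : 0 ≤ b') :
    hK.cutStart b f i * (b f + b') = b f * b' * (slope (K.poly f).bd i + k) ∧
    hK.cutEnd b f i * (b f + b') = b f * b' * (slope (K.poly f).bd (finRotate _ i) + k') := by
  obtain ⟨s1, s2, -⟩ := (K.poly f).simple.side_sdist_frame h1
  obtain ⟨-, t2, t3⟩ := (K.poly f).simple.side_sdist_frame h2
  have hf := (hb f).1
  have hne : b f + b' ≠ 0 := by positivity
  unfold cutStart cutEnd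
  rw [s1, s2, t2, t3, sub_neg_eq_add, div_mul_cancel₀ _ hne, div_mul_cancel₀ _ hne]
  constructor <;> ring

theorem cut_nonneg (f : F) (i : Fin (K.poly f).n) :
    0 ≤ hK.cutStart b f i ∧ 0 ≤ hK.cutEnd b f i := by
  obtain ⟨b', k, k', h1, h2, h3, h4, h5, h6, -⟩ := hK.exists_frame hb f i
  obtain ⟨c1, c2⟩ := hK.cut_eq hb h1 h2 h3
  have hf := (hb f).1
  have hpos : 0 < b f + b' := by positivity
  by_cases h : (hK.across f i).IsPoly
  · obtain ⟨p0, p1, p2⟩ := h5 h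
    constructor
    · exact nonneg_of_mul_nonneg_left (c1 ▸ by positivity) hpos
    · exact nonneg_of_mul_nonneg_left (c2 ▸ by positivity) hpos
  · rw [h6 h] at c1 c2 hpos
    constructor
    · exact nonneg_of_mul_nonneg_left (c1 ▸ by simp) hpos
    · exact nonneg_of_mul_nonneg_left (c2 ▸ by simp) hpos

theorem cut_pos {f : F} {i : Fin (K.poly f).n} (h : (hK.across f i).IsPoly) :
    0 < hK.cutStart b f i ∧ 0 < hK.cutEnd b f i := by
  obtain ⟨b', k, k', h1, h2, h3, h4, h5, h6, -⟩ := hK.exists_frame hb f i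
  obtain ⟨c1, c2⟩ := hK.cut_eq hb h1 h2 h3
  have hf := (hb f).1
  have hpos : 0 < b f + b' := by positivity
  obtain ⟨p0, p1, p2⟩ := h5 h
  constructor
  · exact pos_of_mul_pos_left (c1 ▸ by positivity) hpos.le
  · exact pos_of_mul_pos_left (c2 ▸ by positivity) hpos.le

/-- Neither offset edge collapses: `b f` times the sum of the slopes in `f`, and `b'` times the sum
of those across, are both below the length of the edge. Adding `b'` times the first bound and `b f`
times the second gives the claim. -/
theorem cut_add_lt (f : F) (i : Fin (K.poly f).n) :
    hK.cutStart b f i + hK.cutEnd b f i < edgeLen (K.poly f).bd i := by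
  obtain ⟨b', k, k', h1, h2, h3, h4, h5, h6, -⟩ := hK.exists_frame hb f i
  obtain ⟨c1, c2⟩ := hK.cut_eq hb h1 h2 h3
  have hf := (hb f).1
  have hpos : 0 < b f + b' := by positivity
  have hl := (K.poly f).simple.lenAt_pos (hb f) i ⟨hf.le, le_rfl⟩
  unfold lenAt at hl
  refine lt_of_mul_lt_mul_right ?_ hpos.le
  rw [add_mul, c1, c2]
  have e1 := mul_nonneg h3 hl.le
  have e2 := mul_lt_mul_of_pos_left h4 hf
  linarith

theorem cutStart_lt (f : F) (i : Fin (K.poly f).n) :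
    hK.cutStart b f i < edgeLen (K.poly f).bd i := by
  linarith [hK.cut_add_lt hb f i, (hK.cut_nonneg hb f i).2]

theorem cutEnd_lt (f : F) (i : Fin (K.poly f).n) :
    hK.cutEnd b f i < edgeLen (K.poly f).bd i := by
  linarith [hK.cut_add_lt hb f i, (hK.cut_nonneg hb f i).1]

theorem cutStart_eq_cutEnd {f g : F} {i : Fin (K.poly f).n} {j : Fin (K.poly g).n} (hfg : f ≠ g)
    (he : (K.poly f).edge i = (K.poly g).edge j) : hK.cutStart b f i = hK.cutEnd b g j := by
  obtain ⟨b', k, k', h1, h2, h3, -, -, -, h4⟩ := hK.exists_frame hb f i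
  obtain ⟨c', l, l', g1, g2, g3, -, -, -, g4⟩ := hK.exists_frame hb g j
  obtain ⟨c1, c2⟩ := hK.cut_eq hb h1 h2 h3
  obtain ⟨d1, d2⟩ := hK.cut_eq hb g1 g2 g3
  obtain ⟨rfl, rfl, rfl⟩ := h4 g j hfg he
  obtain ⟨rfl, rfl, rfl⟩ := g4 f i hfg.symm he.symm
  have := (hb f).1
  have := (hb g).1
  have hne : b f + b g ≠ 0 := by positivity
  apply mul_right_cancel₀ hne
  rw [c1, add_comm (b f), d2]
  ring

/-- The point where the new edge at the first end of an edge crosses the edge. -/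
theorem cutStart_mem_segment (f : F) (i : Fin (K.poly f).n) :
    (K.poly f).bd i + hK.cutStart b f i * edgeDir (K.poly f).bd i ∈
      segment ℝ (offset (K.poly f).bd (b f) i) (K.place b (hK.nbStart f i)) := by
  obtain ⟨b', k, k', h1, h2, h3, -⟩ := hK.exists_frame hb f i
  obtain ⟨c1, -⟩ := hK.cut_eq hb h1 h2 h3
  have hf := (hb f).1
  have hpos : 0 < b f + b' := by positivity
  refine ⟨b' / (b f + b'), b f / (b f + b'), by positivity, by positivity, by field_simp; ring, ?_⟩
  have hne : ((b f + b' : ℝ) : ℂ) ≠ 0 := by exact_mod_cast hpos.ne'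
  have c1' : (hK.cutStart b f i : ℂ) * (b f + b') =
    b f * b' * (slope (K.poly f).bd i + k) := by exact_mod_cast c1
  rw [h1, (K.poly f).simple.offset_apply, miter]
  simp only [Complex.real_smul]
  push_cast at hne ⊢
  apply mul_left_cancel₀ hne
  field_simp
  linear_combination -edgeDir (K.poly f).bd i * c1'

theorem cutEnd_mem_segment (f : F) (i : Fin (K.poly f).n) :
    (K.poly f).bd (finRotate _ i) - hK.cutEnd b f i * edgeDir (K.poly f).bd i ∈
      segment ℝ (offset (K.poly f).bd (b f) (finRotate _ i)) (K.place b (hK.nbEnd f i)) := by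
  obtain ⟨b', k, k', h1, h2, h3, -⟩ := hK.exists_frame hb f i
  obtain ⟨-, c2⟩ := hK.cut_eq hb h1 h2 h3
  have hf := (hb f).1
  have hpos : 0 < b f + b' := by positivity
  refine ⟨b' / (b f + b'), b f / (b f + b'), by positivity, by positivity, by field_simp; ring, ?_⟩
  have hne : ((b f + b' : ℝ) : ℂ) ≠ 0 := by exact_mod_cast hpos.ne'
  have c2' : (hK.cutEnd b f i : ℂ) * (b f + b') =
    b f * b' * (slope (K.poly f).bd (finRotate _ i) + k') := by exact_mod_cast c2
  have hl := (K.poly f).simple.edgeLen_mul_edgeDir i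
  rw [h2, (K.poly f).simple.offset_apply, (K.poly f).simple.miter_finRotate]
  simp only [Complex.real_smul]
  push_cast at hne ⊢
  apply mul_left_cancel₀ hne
  field_simp
  linear_combination edgeDir (K.poly f).bd i * c2' + b f * hl

end IsAdmissible
end Mesh

/-! ### The pieces of the polygons -/

theorem PolygonCell.mem_edge_symm {P : PolygonCell} (i : Fin P.n) :
    P.bd i ∈ P.edge ((finRotate _).symm i) := by
  unfold PolygonCell.edge
  rw [Equiv.apply_symm_apply]
  exact Sym2.mem_mk_right _ _

namespace Mesh
variable {F H : Type*} {K : Mesh F H}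

theorem strip_subset_region {P : PolygonCell} {b : ℝ} (hb : IsMiteredOffset P.bd b)
    {i : Fin P.n} {z : ℂ} (hz : z ∈ strip P.bd (Icc 0 b) i) : z ∈ P.region :=
  P.simple.mem_region_of_mem_strip P.ccw hb hz

variable (K) in
/-- What remains of a polygon when the strips along its edges are removed. -/
def core (b : F → ℝ) (f : F) : Set ℂ := fill ((offset (K.poly f).bd (b f)).boundary ℝ)

namespace IsAdmissible

variable [Finite F] [Finite H] (hK : K.IsAdmissible) (b : F → ℝ)

/-- The part of the strip along an edge of a polygon that lies between the new edges. -/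
def midPiece (f : F) (i : Fin (K.poly f).n) : Set ℂ :=
  midStrip (K.poly f).bd (b f) (hK.cutStart b f i) (hK.cutEnd b f i) i

/-- The part of the strip along an edge that is cut off at the first end. -/
def startPiece (f : F) (i : Fin (K.poly f).n) : Set ℂ :=
  leftCorner (K.poly f).bd (b f) (hK.cutStart b f i) i

/-- The part of the strip along an edge that is cut off at the second end. -/
def endPiece (f : F) (i : Fin (K.poly f).n) : Set ℂ :=
  rightCorner (K.poly f).bd (b f) (hK.cutEnd b f i) i

/-- The part of a polygon that is cut off at a vertex. -/
def corner (f : F) (i : Fin (K.poly f).n) : Set ℂ :=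
  hK.startPiece b f i ∪ hK.endPiece b f ((finRotate _).symm i)

variable {b} (hb : K.IsOffsetChoice b)
include hb

theorem start_inter_end {f : F} {i : Fin (K.poly f).n} {z : ℂ} (h1 : z ∈ hK.startPiece b f i)
    (h2 : z ∈ hK.endPiece b f i) : False :=
  (K.poly f).simple.leftCorner_inter_rightCorner (hb f) (hK.cut_add_lt hb f i) h1 h2

theorem eq_of_startPiece {f : F} {i j : Fin (K.poly f).n} {z : ℂ} (h1 : z ∈ hK.startPiece b f i)
    (h2 : z ∈ strip (K.poly f).bd (Icc 0 (b f)) j) :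
    j = i ∨ (i = finRotate _ j ∧ side (K.poly f).bd i z = 0) :=
  (K.poly f).simple.strip_of_leftCorner (hb f) (K.poly f).ccw (hK.cutStart_lt hb f i) h1 h2

theorem eq_of_endPiece {f : F} {i j : Fin (K.poly f).n} {z : ℂ} (h1 : z ∈ hK.endPiece b f i)
    (h2 : z ∈ strip (K.poly f).bd (Icc 0 (b f)) j) :
    j = i ∨ (j = finRotate _ i ∧ side (K.poly f).bd j z = 0) :=
  (K.poly f).simple.strip_of_rightCorner (hb f) (K.poly f).ccw (hK.cutEnd_lt hb f i) h1 h2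

theorem start_inter_start {f : F} {i j : Fin (K.poly f).n} {z : ℂ}
    (h1 : z ∈ hK.startPiece b f i) (h2 : z ∈ hK.startPiece b f j) : i = j := by
  rcases hK.eq_of_startPiece hb h1 h2.1 with h | ⟨h, -⟩
  · exact h.symm
  rcases hK.eq_of_startPiece hb h2 h1.1 with h' | ⟨h', -⟩
  · exact h'
  · exact (finRotate_finRotate_ne_self (K.poly f).simple.three_le j (by rw [← h, ← h'])).elim

theorem end_inter_end {f : F} {i j : Fin (K.poly f).n} {z : ℂ}
    (h1 : z ∈ hK.endPiece b f i) (h2 : z ∈ hK.endPiece b f j) : i = j := by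
  rcases hK.eq_of_endPiece hb h1 h2.1 with h | ⟨h, -⟩
  · exact h.symm
  rcases hK.eq_of_endPiece hb h2 h1.1 with h' | ⟨h', -⟩
  · exact h'
  · exact (finRotate_finRotate_ne_self (K.poly f).simple.three_le j (by rw [← h', ← h])).elim

theorem start_inter_end' {f : F} {i j : Fin (K.poly f).n} {z : ℂ}
    (h1 : z ∈ hK.startPiece b f i) (h2 : z ∈ hK.endPiece b f j) : i = finRotate _ j := by
  rcases hK.eq_of_startPiece hb h1 h2.1 with rfl | ⟨h, -⟩
  · exact (hK.start_inter_end hb h1 h2).elim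
  · exact h

theorem corner_inter_corner {f : F} {i j : Fin (K.poly f).n} {z : ℂ} (h1 : z ∈ hK.corner b f i)
    (h2 : z ∈ hK.corner b f j) : i = j := by
  rcases h1 with h1 | h1 <;> rcases h2 with h2 | h2
  · exact hK.start_inter_start hb h1 h2
  · have := hK.start_inter_end' hb h1 h2
    rwa [Equiv.apply_symm_apply] at this
  · have := hK.start_inter_end' hb h2 h1
    rw [Equiv.apply_symm_apply] at this
    exact this.symm
  · exact (finRotate _).symm.injective (hK.end_inter_end hb h1 h2)

theorem segment_of_start_mid {f : F} {i : Fin (K.poly f).n} {z : ℂ}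
    (hz : sdist (K.poly f).bd i z ∈ Icc 0 (b f))
    (h : b f * side (K.poly f).bd i z = hK.cutStart b f i * (b f - sdist (K.poly f).bd i z)) :
    z ∈ segment ℝ (offset (K.poly f).bd (b f) i) (K.place b (hK.nbStart f i)) :=
  (convex_segment _ _).segment_subset (left_mem_segment ℝ _ _) (hK.cutStart_mem_segment hb f i)
    ((K.poly f).simple.mem_segment_of_cut_left (hb f).1 hz h)

theorem segment_of_end_mid {f : F} {i : Fin (K.poly f).n} {z : ℂ}
    (hz : sdist (K.poly f).bd i z ∈ Icc 0 (b f))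
    (h : -(b f * side (K.poly f).bd (finRotate _ i) z) =
      hK.cutEnd b f i * (b f - sdist (K.poly f).bd i z)) :
    z ∈ segment ℝ (offset (K.poly f).bd (b f) (finRotate _ i)) (K.place b (hK.nbEnd f i)) :=
  (convex_segment _ _).segment_subset (left_mem_segment ℝ _ _) (hK.cutEnd_mem_segment hb f i)
    ((K.poly f).simple.mem_segment_of_cut_right (hb f).1 hz h)

/-- Corner and middle part of one strip satisfy opposite inequalities, so a common point lies on the
cut. If they belong to neighbouring strips, the point is on the bisector, where `side` is `0` and
the reverse inequality holds by nonnegativity of the cut. -/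
theorem corner_inter_mid {f : F} {i j : Fin (K.poly f).n} {z : ℂ} (h1 : z ∈ hK.corner b f i)
    (h2 : z ∈ hK.midPiece b f j) :
    (j = i ∧ z ∈ segment ℝ (offset (K.poly f).bd (b f) i) (K.place b (hK.nbStart f i))) ∨
    (finRotate _ j = i ∧
      z ∈ segment ℝ (offset (K.poly f).bd (b f) i) (K.place b (hK.nbEnd f j))) := by
  have hs := h2.1.1
  have hsub : 0 ≤ b f - sdist (K.poly f).bd j z := sub_nonneg.2 hs.2
  have c0 := mul_nonneg (hK.cut_nonneg hb f j).1 hsub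
  have c1 := mul_nonneg (hK.cut_nonneg hb f j).2 hsub
  have m1 := h2.2.1
  have m2 := h2.2.2
  rcases h1 with h1 | h1
  · rcases hK.eq_of_startPiece hb h1 h2.1 with rfl | ⟨rfl, h⟩
    · exact Or.inl ⟨rfl, hK.segment_of_start_mid hb hs (le_antisymm h1.2 h2.2.1)⟩
    · refine Or.inr ⟨rfl, hK.segment_of_end_mid hb hs (le_antisymm ?_ h2.2.2)⟩
      rw [h]; linarith
  · obtain ⟨k, rfl⟩ : ∃ k, i = finRotate _ k := ⟨_, ((finRotate _).apply_symm_apply i).symm⟩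
    rw [Equiv.symm_apply_apply] at h1
    rcases hK.eq_of_endPiece hb h1 h2.1 with rfl | ⟨rfl, h⟩
    · exact Or.inr ⟨rfl, hK.segment_of_end_mid hb hs (le_antisymm h1.2 h2.2.2)⟩
    · refine Or.inl ⟨rfl, hK.segment_of_start_mid hb hs (le_antisymm ?_ h2.2.1)⟩
      rw [h]; linarith

theorem mid_inter_mid {f : F} {i j : Fin (K.poly f).n} (hij : i ≠ j) {z : ℂ}
    (h1 : z ∈ hK.midPiece b f i) (h2 : z ∈ hK.midPiece b f j) :
    (j = finRotate _ i ∧ z = offset (K.poly f).bd (b f) j) ∨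
    (i = finRotate _ j ∧ z = offset (K.poly f).bd (b f) i) := by
  -- One of the two edges at each vertex is shared with another polygon, and there the cut is
  -- positive.
  have hpos : ∀ k, 0 < hK.cutEnd b f k ∨ 0 < hK.cutStart b f (finRotate _ k) := fun k =>
    (hK.isPoly_across f k).imp (fun h => (hK.cut_pos hb h).2) fun h => (hK.cut_pos hb h).1
  rcases (K.poly f).simple.strip_inter (K.poly f).ccw (hb f) h1.1 h2.1 with h | ⟨rfl, -⟩ | ⟨rfl, -⟩
  · exact (hij h).elim
  · exact Or.inl ⟨rfl, (K.poly f).simple.offset_of_midStrip h1 h2 (hpos i)⟩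
  · exact Or.inr ⟨rfl, (K.poly f).simple.offset_of_midStrip h2 h1 (hpos j)⟩

theorem core_inter_corner {f : F} {i : Fin (K.poly f).n} {z : ℂ} (h1 : z ∈ K.core b f)
    (h2 : z ∈ hK.corner b f i) : z = offset (K.poly f).bd (b f) i := by
  rcases h2 with h2 | h2
  · exact (K.poly f).simple.eq_of_fill_offset_leftCorner (hb f) (K.poly f).ccw h1 h2
  · have := (K.poly f).simple.eq_of_fill_offset_rightCorner (hb f) (K.poly f).ccw h1 h2
    rwa [Equiv.apply_symm_apply] at this

theorem core_inter_mid {f : F} {i : Fin (K.poly f).n} {z : ℂ} (h1 : z ∈ K.core b f)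
    (h2 : z ∈ hK.midPiece b f i) : z ∈ segment ℝ (offset (K.poly f).bd (b f) i)
      (offset (K.poly f).bd (b f) (finRotate _ i)) :=
  (K.poly f).simple.segment_of_fill_offset (hb f) (K.poly f).ccw h1 h2.1

omit [Finite F] [Finite H] hK in
theorem core_subset_inner {f : F} {z : ℂ} (hz : z ∈ K.core b f) : z ∈ (K.poly f).inner :=
  (K.poly f).simple.interior_of_mem_fill_offset (K.poly f).ccw (hb f) (hb f).1 le_rfl hz

theorem midPiece_subset_region {f : F} {i : Fin (K.poly f).n} {z : ℂ}
    (hz : z ∈ hK.midPiece b f i) : z ∈ (K.poly f).region :=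
  strip_subset_region (hb f) hz.1

theorem corner_subset_region {f : F} {i : Fin (K.poly f).n} {z : ℂ}
    (hz : z ∈ hK.corner b f i) : z ∈ (K.poly f).region := by
  rcases hz with hz | hz <;> exact strip_subset_region (hb f) hz.1

/-! ### Pieces of two different polygons -/

omit [Finite F] [Finite H] in
include hK in
theorem core_inter_region {f g : F} (hfg : f ≠ g) {z : ℂ} (hz : z ∈ K.core b f) :
    z ∉ (K.poly g).region :=
  (hK.meet f g hfg).notMem_of_mem_inner (core_subset_inner hb hz)

-- Points of a strip at positive depth are interior to `f`, and another polygon meets `f` only in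
-- its boundary.
omit [Finite F] [Finite H] in
include hK in
theorem sdist_eq_zero_of_strip {f g : F} (hfg : f ≠ g) {i : Fin (K.poly f).n} {z : ℂ}
    (hz : z ∈ strip (K.poly f).bd (Icc 0 (b f)) i) (hg : z ∈ (K.poly g).region) :
    sdist (K.poly f).bd i z = 0 := by
  by_contra h
  exact ((K.poly f).simple.interior_of_mem_strip (K.poly f).ccw (hb f) hz h).1
    ((hK.meet f g hfg).mem_boundary (strip_subset_region (hb f) hz) hg)

omit [Finite F] [Finite H] in
include hK in
/-- Strips of distinct polygons meet in a common edge or in common ends of their edges. -/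
theorem strip_inter_strip {f g : F} (hfg : f ≠ g) {i : Fin (K.poly f).n} {j : Fin (K.poly g).n}
    {z : ℂ} (hf : z ∈ strip (K.poly f).bd (Icc 0 (b f)) i)
    (hg : z ∈ strip (K.poly g).bd (Icc 0 (b g)) j) :
    (K.poly f).edge i = (K.poly g).edge j ∨ (z ∈ (K.poly f).edge i ∧ z ∈ (K.poly g).edge j) := by
  have f0 := hK.sdist_eq_zero_of_strip hb hfg hf (strip_subset_region (hb g) hg)
  have g0 := hK.sdist_eq_zero_of_strip hb hfg.symm hg (strip_subset_region (hb f) hf)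
  have hzf := ((K.poly f).simple.mem_segment_iff i).2 ⟨f0, hf.2⟩
  have hzg := ((K.poly g).simple.mem_segment_iff j).2 ⟨g0, hg.2⟩
  have hrf := strip_subset_region (hb f) hf
  have hrg := strip_subset_region (hb g) hg
  by_cases hend : z ∈ (K.poly f).edge i
  · right
    refine ⟨hend, ?_⟩
    have hv : z ∈ (K.poly g).verts := by
      rcases Sym2.mem_iff.1 hend with h | h <;> rw [h] <;>
        exact (hK.meet f g hfg).vertex_mem (by rwa [← h])
    obtain ⟨k, hk⟩ := hv
    have hk' : (K.poly g).bd k = z := hk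
    rcases (K.poly g).simple.vertex_mem_edge (hk'.symm ▸ hzg) with h | h
    · rw [← hk', h]; exact Sym2.mem_mk_left _ _
    · rw [← hk', h]; exact Sym2.mem_mk_right _ _
  · left
    have h12 : z ≠ (K.poly f).bd i ∧ z ≠ (K.poly f).bd (finRotate _ i) :=
      ⟨fun h => hend (h ▸ Sym2.mem_mk_left _ _), fun h => hend (h ▸ Sym2.mem_mk_right _ _)⟩
    obtain ⟨⟨k, hk⟩, -⟩ := (hK.meet f g hfg).edge_mem hzf h12.1 h12.2 hrg
    have hk : (K.poly f).edge i = (K.poly g).edge k := hk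
    have hzk : z ∈ segment ℝ ((K.poly g).bd k) ((K.poly g).bd (finRotate _ k)) := by
      have : z ∈ seg id ((K.poly f).edge i) := hzf
      rw [hk] at this
      exact this
    rcases (K.poly g).simple.edge_inter hzk hzg with h | ⟨h, h'⟩ | ⟨h, h'⟩
    · rw [hk, h]
    · refine (hend ?_).elim
      rw [hk, h', h]; exact Sym2.mem_mk_right _ _
    · refine (hend ?_).elim
      rw [hk, h']; exact Sym2.mem_mk_left _ _

omit [Finite F] [Finite H] hb in
include hK in
theorem side_of_edge_eq {f g : F} (hfg : f ≠ g) {i : Fin (K.poly f).n} {j : Fin (K.poly g).n}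
    (he : (K.poly f).edge i = (K.poly g).edge j) {z : ℂ} (hz : sdist (K.poly f).bd i z = 0) :
    sdist (K.poly g).bd j z = 0 ∧
    side (K.poly g).bd (finRotate _ j) z = - side (K.poly f).bd i z ∧
    side (K.poly g).bd j z = - side (K.poly f).bd (finRotate _ i) z := by
  obtain ⟨o1, o2⟩ := (hK.meet f g hfg).opposite he
  obtain ⟨d1, d2, d3⟩ := PolygonCell.sdist_of_opposite o1 o2
  have e1 := (K.poly f).simple.eq_start i z
  have l1 := (K.poly f).simple.edgeLen_mul_edgeDir i
  rw [hz] at e1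
  have e2 : z = (K.poly g).bd j + ((edgeLen (K.poly f).bd i - side (K.poly f).bd i z : ℝ) : ℂ) *
      edgeDir (K.poly g).bd j + ((0 : ℝ) : ℂ) * miter (K.poly g).bd j := by
    rw [d1, ← o2]
    push_cast at e1 ⊢
    linear_combination e1 + l1
  obtain ⟨s1, s2⟩ := (K.poly g).simple.side_sdist_of_eq e2
  have s3 := (K.poly g).simple.side_finRotate j z
  have s4 := (K.poly f).simple.side_finRotate i z
  rw [s1, s2, d2] at s3
  rw [hz] at s4
  refine ⟨s2, by linarith, by linarith⟩

/-- Common points of the two strips lie on the common edge, where depth is `0` and positions are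
compared with the cut alone. The two polygons use the same cut there, and what is the first end for
one is the second for the other. -/
theorem start_opposite {f g : F} (hfg : f ≠ g) {i : Fin (K.poly f).n} {j : Fin (K.poly g).n}
    (he : (K.poly f).edge i = (K.poly g).edge j) {z : ℂ} (hz : z ∈ hK.startPiece b f i)
    (hg : z ∈ strip (K.poly g).bd (Icc 0 (b g)) j) : z ∈ hK.endPiece b g j := by
  have f0 := hK.sdist_eq_zero_of_strip hb hfg hz.1 (strip_subset_region (hb g) hg)
  obtain ⟨s1, s2, s3⟩ := hK.side_of_edge_eq hfg he f0
  have h2 := hz.2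
  rw [f0, sub_zero, hK.cutStart_eq_cutEnd hb hfg he, mul_comm (hK.cutEnd b g j)] at h2
  refine ⟨hg, ?_⟩
  rw [s1, s2, sub_zero, mul_comm (hK.cutEnd b g j), mul_neg, neg_neg]
  exact mul_le_mul_of_nonneg_left (le_of_mul_le_mul_left h2 (hb f).1) (hb g).1.le

theorem end_opposite {f g : F} (hfg : f ≠ g) {i : Fin (K.poly f).n} {j : Fin (K.poly g).n}
    (he : (K.poly f).edge i = (K.poly g).edge j) {z : ℂ} (hz : z ∈ hK.endPiece b f i)
    (hg : z ∈ strip (K.poly g).bd (Icc 0 (b g)) j) : z ∈ hK.startPiece b g j := by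
  have f0 := hK.sdist_eq_zero_of_strip hb hfg hz.1 (strip_subset_region (hb g) hg)
  obtain ⟨s1, s2, s3⟩ := hK.side_of_edge_eq hfg he f0
  have h2 := hz.2
  rw [f0, sub_zero, ← hK.cutStart_eq_cutEnd hb hfg.symm he.symm, ← mul_neg, ← s3,
    mul_comm (hK.cutStart b g j)] at h2
  refine ⟨hg, ?_⟩
  rw [s1, sub_zero, mul_comm (hK.cutStart b g j)]
  exact mul_le_mul_of_nonneg_left (le_of_mul_le_mul_left h2 (hb f).1) (hb g).1.le

theorem mid_opposite {f g : F} (hfg : f ≠ g) {i : Fin (K.poly f).n} {j : Fin (K.poly g).n}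
    (he : (K.poly f).edge i = (K.poly g).edge j) {z : ℂ} (hz : z ∈ hK.midPiece b f i)
    (hg : z ∈ strip (K.poly g).bd (Icc 0 (b g)) j) : z ∈ hK.midPiece b g j := by
  have f0 := hK.sdist_eq_zero_of_strip hb hfg hz.1 (strip_subset_region (hb g) hg)
  obtain ⟨s1, s2, s3⟩ := hK.side_of_edge_eq hfg he f0
  have h1 := hz.2.1
  have h2 := hz.2.2
  rw [f0, sub_zero, hK.cutStart_eq_cutEnd hb hfg he, mul_comm (hK.cutEnd b g j)] at h1
  rw [f0, sub_zero, ← hK.cutStart_eq_cutEnd hb hfg.symm he.symm, ← mul_neg, ← s3,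
    mul_comm (hK.cutStart b g j)] at h2
  refine ⟨hg, ?_, ?_⟩
  · rw [s1, sub_zero, mul_comm (hK.cutStart b g j)]
    exact mul_le_mul_of_nonneg_left (le_of_mul_le_mul_left h2 (hb f).1) (hb g).1.le
  · rw [s1, s2, sub_zero, mul_comm (hK.cutEnd b g j), mul_neg, neg_neg]
    exact mul_le_mul_of_nonneg_left (le_of_mul_le_mul_left h1 (hb f).1) (hb g).1.le

theorem eq_of_mem_edge_start {f : F} {i : Fin (K.poly f).n} {z : ℂ}
    (hz : z ∈ hK.startPiece b f i) (he : z ∈ (K.poly f).edge i) : z = (K.poly f).bd i := by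
  rcases Sym2.mem_iff.1 he with h | rfl
  · exact h
  · exact (hK.start_inter_end hb hz ((K.poly f).simple.right_mem_rightCorner (hb f).1.le
      (hK.cut_nonneg hb f i).2 i)).elim

theorem eq_of_mem_edge_end {f : F} {i : Fin (K.poly f).n} {z : ℂ}
    (hz : z ∈ hK.endPiece b f i) (he : z ∈ (K.poly f).edge i) :
    z = (K.poly f).bd (finRotate _ i) := by
  rcases Sym2.mem_iff.1 he with rfl | h
  · exact (hK.start_inter_end hb ((K.poly f).simple.left_mem_leftCorner (hb f).1.le
      (hK.cut_nonneg hb f i).1 i) hz).elim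
  · exact h

/-- A positive cut removes the end of the edge from the middle part, and cuts are positive on edges
shared by two polygons. -/
theorem not_isPoly_of_mem_edge_mid {f : F} {i : Fin (K.poly f).n} {z : ℂ}
    (hz : z ∈ hK.midPiece b f i) (he : z ∈ (K.poly f).edge i) : ¬ (hK.across f i).IsPoly := by
  intro h
  obtain ⟨c0, c1⟩ := hK.cut_pos hb h
  have h1 := hz.2.1
  have h2 := hz.2.2
  have hf := (hb f).1
  rcases Sym2.mem_iff.1 he with rfl | rfl
  · rw [(K.poly f).simple.sdist_left, (K.poly f).simple.side_left, sub_zero] at h1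
    have := mul_pos c0 hf
    linarith
  · rw [(K.poly f).simple.sdist_right, (K.poly f).simple.side_left, sub_zero] at h2
    have := mul_pos c1 hf
    linarith

/-- A corner piece at the `i`-th vertex lies in the strip of an edge at that vertex. -/
theorem exists_of_corner {f : F} {i : Fin (K.poly f).n} {z : ℂ} (hz : z ∈ hK.corner b f i) :
    ∃ k, z ∈ strip (K.poly f).bd (Icc 0 (b f)) k ∧ (K.poly f).bd i ∈ (K.poly f).edge k ∧
      (z ∈ (K.poly f).edge k → z = (K.poly f).bd i) := by
  rcases hz with hz | hz
  · exact ⟨i, hz.1, Sym2.mem_mk_left _ _, hK.eq_of_mem_edge_start hb hz⟩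
  · refine ⟨_, hz.1, ?_, fun h => ?_⟩
    · exact PolygonCell.mem_edge_symm i
    · have := hK.eq_of_mem_edge_end hb hz h
      rwa [Equiv.apply_symm_apply] at this

/-- Either the strips belong to a common edge and the two corners face each other at the same end of
it, or `z` is an end of both edges, and then it is the vertex at which each corner is cut off. -/
theorem corner_inter_corner' {f g : F} (hfg : f ≠ g) {i : Fin (K.poly f).n}
    {j : Fin (K.poly g).n} {z : ℂ} (hf : z ∈ hK.corner b f i) (hg : z ∈ hK.corner b g j) :
    (K.poly f).bd i = (K.poly g).bd j ∧ (z = (K.poly f).bd i ∨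
      ∃ e ∈ (K.poly f).edges ∩ (K.poly g).edges, (K.poly f).bd i ∈ e) := by
  rcases hf with hf | hf <;> rcases hg with hg | hg <;>
    rcases hK.strip_inter_strip hb hfg hf.1 hg.1 with he | ⟨h1, h2⟩
  · exact (hK.start_inter_end hb hg (hK.start_opposite hb hfg he hf hg.1)).elim
  · have e1 := hK.eq_of_mem_edge_start hb hf h1
    have e2 := hK.eq_of_mem_edge_start hb hg h2
    exact ⟨e1 ▸ e2, Or.inl e1⟩
  · have o := ((hK.meet f g hfg).opposite he).1
    rw [Equiv.apply_symm_apply] at o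
    exact ⟨o, Or.inr ⟨_, ⟨⟨i, rfl⟩, ⟨_, he⟩⟩, Sym2.mem_mk_left _ _⟩⟩
  · have e1 := hK.eq_of_mem_edge_start hb hf h1
    have e2 := hK.eq_of_mem_edge_end hb hg h2
    rw [Equiv.apply_symm_apply] at e2
    exact ⟨e1 ▸ e2, Or.inl e1⟩
  · have o := ((hK.meet f g hfg).opposite he).2
    rw [Equiv.apply_symm_apply] at o
    refine ⟨o, Or.inr ⟨_, ⟨⟨_, rfl⟩, ⟨j, he⟩⟩, ?_⟩⟩
    exact PolygonCell.mem_edge_symm i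
  · have e1 := hK.eq_of_mem_edge_end hb hf h1
    have e2 := hK.eq_of_mem_edge_start hb hg h2
    rw [Equiv.apply_symm_apply] at e1
    exact ⟨e1 ▸ e2, Or.inl e1⟩
  · exact (hK.start_inter_end hb (hK.end_opposite hb hfg he hf hg.1) hg).elim
  · have e1 := hK.eq_of_mem_edge_end hb hf h1
    have e2 := hK.eq_of_mem_edge_end hb hg h2
    rw [Equiv.apply_symm_apply] at e1 e2
    exact ⟨e1 ▸ e2, Or.inl e1⟩

theorem corner_inter_mid' {f g : F} (hfg : f ≠ g) {i : Fin (K.poly f).n}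
    {j : Fin (K.poly g).n} {z : ℂ} (hf : z ∈ hK.corner b f i) (hg : z ∈ hK.midPiece b g j) :
    (∃ k, (K.poly f).edge k = (K.poly g).edge j ∧ z ∈ hK.midPiece b f k) ∨
    (z = (K.poly f).bd i ∧ z ∈ (K.poly g).edge j ∧ ¬ (hK.across g j).IsPoly) := by
  obtain ⟨k, h1, h2, h3⟩ := hK.exists_of_corner hb hf
  rcases hK.strip_inter_strip hb hfg h1 hg.1 with he | ⟨h4, h5⟩
  · exact Or.inl ⟨k, he, hK.mid_opposite hb hfg.symm he.symm hg h1⟩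
  · exact Or.inr ⟨h3 h4, h5, hK.not_isPoly_of_mem_edge_mid hb hg h5⟩

theorem mid_inter_mid' {f g : F} (hfg : f ≠ g) {i : Fin (K.poly f).n}
    {j : Fin (K.poly g).n} (he : (K.poly f).edge i ≠ (K.poly g).edge j) {z : ℂ}
    (hf : z ∈ hK.midPiece b f i) (hg : z ∈ hK.midPiece b g j) :
    z ∈ (K.poly f).edge i ∧ z ∈ (K.poly g).edge j ∧
      ¬ (hK.across f i).IsPoly ∧ ¬ (hK.across g j).IsPoly := by
  rcases hK.strip_inter_strip hb hfg hf.1 hg.1 with h | ⟨h1, h2⟩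
  · exact (he h).elim
  · exact ⟨h1, h2, hK.not_isPoly_of_mem_edge_mid hb hf h1, hK.not_isPoly_of_mem_edge_mid hb hg h2⟩

end IsAdmissible

/-! ### The cells generated by edges -/

theorem HatCell.iUnion_facets {c : K.HatCell} {φ : K.HatVertex → ℂ} {n : ℕ}
    {q : Fin n → K.HatVertex} (h : c.facets = cycleEdges q) :
    ⋃ e ∈ c.facets, seg φ e = (⟨fun i => φ (q i)⟩ : Polygon ℂ n).boundary ℝ := by
  ext z
  rw [mem_boundary_iff, h]
  simp only [mem_iUnion, cycleEdges]
  constructor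
  · rintro ⟨e, ⟨i, rfl⟩, hz⟩
    exact ⟨i, hz⟩
  · rintro ⟨i, hz⟩
    exact ⟨_, ⟨i, rfl⟩, hz⟩

namespace IsAdmissible

variable [Finite F] [Finite H] (hK : K.IsAdmissible)

/-- The four vertices of the cell generated by an edge. -/
def quad (f : F) (i : Fin (K.poly f).n) : Fin 4 → K.HatVertex :=
  ![hK.nbStart f i, hK.nbEnd f i, .poly f (finRotate _ i), .poly f i]

theorem mem_cycleEdges_quad {f : F} {i : Fin (K.poly f).n} {E : Sym2 K.HatVertex} :
    E ∈ cycleEdges (hK.quad f i) ↔ E = s(hK.nbStart f i, hK.nbEnd f i) ∨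
      E = s(hK.nbEnd f i, .poly f (finRotate _ i)) ∨
      E = s(.poly f (finRotate _ i), .poly f i) ∨ E = s(.poly f i, hK.nbStart f i) := by
  have hr0 : finRotate 4 0 = 1 := rfl
  have hr1 : finRotate 4 1 = 2 := rfl
  have hr2 : finRotate 4 2 = 3 := rfl
  have hr3 : finRotate 4 3 = 0 := rfl
  constructor
  · rintro ⟨m, rfl⟩
    revert m
    apply forall_fin_four
    · rw [hr0]; exact Or.inl rfl
    · rw [hr1]; exact Or.inr (Or.inl rfl)
    · rw [hr2]; exact Or.inr (Or.inr (Or.inl rfl))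
    · rw [hr3]; exact Or.inr (Or.inr (Or.inr rfl))
  · rintro (rfl | rfl | rfl | rfl)
    · exact ⟨0, by rw [hr0]; rfl⟩
    · exact ⟨1, by rw [hr1]; rfl⟩
    · exact ⟨2, by rw [hr2]; rfl⟩
    · exact ⟨3, by rw [hr3]; rfl⟩

theorem facets_ofEdge (f : F) (i : Fin (K.poly f).n) (he : (K.poly f).edge i ∈ K.edges) :
    (HatCell.ofEdge _ he).facets = cycleEdges (hK.quad f i) := by
  -- The edge belongs to just two cells, and a copy is determined by its cell and base vertex. So
  -- only the four vertices of the quadrilateral can occur.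
  have hcell : ∀ x : K.HatVertex, (K.poly f).edge i ∈ K.cellEdges x.cell →
      (x.base = (K.poly f).bd i → x = .poly f i ∨ x = hK.nbStart f i) ∧
      (x.base = (K.poly f).bd (finRotate _ i) →
        x = .poly f (finRotate _ i) ∨ x = hK.nbEnd f i) := by
    intro x hx
    rcases hK.mem_cellEdges_iff.1 hx with h | h
    · exact ⟨fun h' => Or.inl (HatVertex.ext_cell_base h h'),
        fun h' => Or.inl (HatVertex.ext_cell_base h h')⟩
    · exact ⟨fun h' => Or.inr (HatVertex.ext_cell_base (by rw [h, cell_nbStart])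
          (by rw [h', base_nbStart])),
        fun h' => Or.inr (HatVertex.ext_cell_base (by rw [h, cell_nbEnd])
          (by rw [h', base_nbEnd]))⟩
  have hne : hK.across f i ≠ .poly f := hK.across_ne f i
  have hf : (K.poly f).edge i ∈ K.cellEdges (.poly f : Cell F H) := ⟨i, rfl⟩
  have ha := hK.edge_mem_across f i
  have cs := hK.cell_nbStart f i
  have ce := hK.cell_nbEnd f i
  have bs := hK.base_nbStart f i
  have be := hK.base_nbEnd f i
  ext E
  rw [mem_cycleEdges_quad]
  constructor
  · rintro (h | h)
    · obtain ⟨c, hc, x, y, hx, hy, hxy, rfl⟩ := mem_iUnion.1 h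
      subst hx
      have hc' := hc
      rw [← hy] at hc'
      rcases Sym2.eq_iff.1 hxy with ⟨h1, h2⟩ | ⟨h1, h2⟩
      · rcases (hcell x hc).1 h1 with rfl | rfl <;> rcases (hcell y hc').2 h2 with rfl | rfl
        · exact Or.inr (Or.inr (Or.inl Sym2.eq_swap))
        · rw [ce] at hy; exact (hne hy).elim
        · rw [cs] at hy; exact (hne hy.symm).elim
        · exact Or.inl rfl
      · rcases (hcell x hc).2 h1 with rfl | rfl <;> rcases (hcell y hc').1 h2 with rfl | rfl
        · exact Or.inr (Or.inr (Or.inl rfl))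
        · rw [cs] at hy; exact (hne hy).elim
        · rw [ce] at hy; exact (hne hy.symm).elim
        · exact Or.inl Sym2.eq_swap
    · obtain ⟨v, hv, x, y, hx, hy, hxy, hex, hey, rfl⟩ := mem_iUnion.1 h
      rcases Sym2.mem_iff.1 hv with rfl | rfl
      · rcases (hcell x hex).1 hx with rfl | rfl <;> rcases (hcell y hey).1 hy with rfl | rfl
        · exact (hxy rfl).elim
        · exact Or.inr (Or.inr (Or.inr rfl))
        · exact Or.inr (Or.inr (Or.inr Sym2.eq_swap))
        · exact (hxy rfl).elim
      · rcases (hcell x hex).2 hx with rfl | rfl <;> rcases (hcell y hey).2 hy with rfl | rfl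
        · exact (hxy rfl).elim
        · exact Or.inr (Or.inl Sym2.eq_swap)
        · exact Or.inr (Or.inl rfl)
        · exact (hxy rfl).elim
  · rintro (rfl | rfl | rfl | rfl)
    · exact Or.inl (mem_iUnion.2 ⟨hK.across f i, ha, _, _, cs, ce, by rw [bs, be]; rfl, rfl⟩)
    · refine Or.inr (mem_iUnion.2 ⟨(K.poly f).bd (finRotate _ i), Sym2.mem_mk_right _ _, _,
        .poly f (finRotate _ i), be, rfl, ?_, by rwa [ce], hf, rfl⟩)
      rw [ce]; exact hne
    · exact Or.inl (mem_iUnion.2 ⟨.poly f, hf, _, _, rfl, rfl, Sym2.eq_swap, rfl⟩)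
    · refine Or.inr (mem_iUnion.2 ⟨(K.poly f).bd i, Sym2.mem_mk_left _ _, .poly f i, _,
        rfl, bs, ?_, hf, by rwa [cs], rfl⟩)
      rw [cs]; exact hne.symm

/-- A region that contains the cell generated by the edge `e`. -/
def edgeZone (b : F → ℝ) (e : Sym2 ℂ) : Set ℂ :=
  {z | ∃ f i, (K.poly f).edge i = e ∧ z ∈ hK.midPiece b f i}

variable {b : F → ℝ} (hb : K.IsOffsetChoice b)
include hb

/-- Both copies of the edge stay parallel to it, at the heights `-b'` and `b f`, so the four points
form a trapezoid; strict convexity only needs that neither parallel side has collapsed. -/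
theorem exists_place_quad (f : F) (i : Fin (K.poly f).n) : ∃ b' k k' : ℝ,
    (fun m => K.place b (hK.quad f i m)) = trapezoid ((K.poly f).bd i) (edgeDir (K.poly f).bd i)
      (b' * k) (edgeLen (K.poly f).bd i - b' * k')
      (edgeLen (K.poly f).bd i - b f * slope (K.poly f).bd (finRotate _ i))
      (b f * slope (K.poly f).bd i) (-b') (b f) ∧
    0 ≤ b' ∧ b' * k < edgeLen (K.poly f).bd i - b' * k' ∧
    b f * slope (K.poly f).bd i <
      edgeLen (K.poly f).bd i - b f * slope (K.poly f).bd (finRotate _ i) ∧ -b' < b f ∧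
    (¬ (hK.across f i).IsPoly → b' = 0) ∧
    hK.cutStart b f i * (b f + b') = b f * b' * (slope (K.poly f).bd i + k) ∧
    hK.cutEnd b f i * (b f + b') = b f * b' * (slope (K.poly f).bd (finRotate _ i) + k') := by
  obtain ⟨b', k, k', h1, h2, h3, h4, h5, h6, -⟩ := hK.exists_frame hb f i
  have hf := (hb f).1
  have hl := (K.poly f).simple.lenAt_pos (hb f) i ⟨hf.le, le_rfl⟩
  unfold lenAt at hl
  refine ⟨b', k, k', ?_, h3, by linarith, by linarith, by linarith, h6, hK.cut_eq hb h1 h2 h3⟩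
  funext m
  revert m
  apply forall_fin_four
  · exact h1
  · exact h2
  · show offset (K.poly f).bd (b f) (finRotate _ i) = (K.poly f).bd i + edgeDir (K.poly f).bd i * _
    rw [(K.poly f).simple.offset_finRotate, (K.poly f).simple.offset_apply, miter, lenAt]
    push_cast; ring
  · show offset (K.poly f).bd (b f) i = (K.poly f).bd i + edgeDir (K.poly f).bd i * _
    rw [(K.poly f).simple.offset_apply, miter]
    push_cast; ring

theorem quad_cross (f : F) (i : Fin (K.poly f).n) :
    ∀ m k, k ≠ m → k ≠ finRotate 4 m →
      0 < cross (K.place b (hK.quad f i (finRotate 4 m)) - K.place b (hK.quad f i m))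
        (K.place b (hK.quad f i k) - K.place b (hK.quad f i m)) := by
  obtain ⟨b', k, k', h1, h2, h3, h4, h5, -⟩ := hK.exists_place_quad hb f i
  have := trapezoid_cross (u := (K.poly f).bd i) ((K.poly f).simple.edgeDir_ne_zero i) h3 h4 h5
  rw [← h1] at this
  exact this

theorem isDrawnAs_quad (f : F) (i : Fin (K.poly f).n) (he : (K.poly f).edge i ∈ K.edges) :
    (HatCell.ofEdge _ he).IsDrawnAs (K.place b) (hK.quad f i) :=
  ⟨hK.facets_ofEdge f i he,
    quad_isSimple (C := fun m => K.place b (hK.quad f i m)) (hK.quad_cross hb f i)⟩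

theorem region_ofEdge (f : F) (i : Fin (K.poly f).n) (he : (K.poly f).edge i ∈ K.edges) :
    (HatCell.ofEdge _ he).region (K.place b) = {z | ∀ m,
      0 ≤ cross (K.place b (hK.quad f i (finRotate 4 m)) - K.place b (hK.quad f i m))
        (z - K.place b (hK.quad f i m))} := by
  unfold HatCell.region
  rw [HatCell.iUnion_facets (hK.facets_ofEdge f i he)]
  exact quad_fill (C := fun m => K.place b (hK.quad f i m)) (hK.quad_cross hb f i)

/-- The slanted sides of the trapezoid are the new edges. Their inequalities, multiplied by `b f`,
are those of the cuts multiplied by `b f + b'`. -/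
theorem midPiece_of_region {f : F} {i : Fin (K.poly f).n} {he : (K.poly f).edge i ∈ K.edges}
    {z : ℂ} (hz : z ∈ (HatCell.ofEdge _ he).region (K.place b)) :
    (0 ≤ sdist (K.poly f).bd i z → z ∈ hK.midPiece b f i) ∧
    (¬ (hK.across f i).IsPoly → 0 ≤ sdist (K.poly f).bd i z) := by
  rw [hK.region_ofEdge hb] at hz
  obtain ⟨b', k, k', h1, h2, h3, h4, h5, h6, c1, c2⟩ := hK.exists_place_quad hb f i
  let P := (K.poly f).bd
  have hP : IsSimple P := (K.poly f).simple
  set x : ℝ := side P i z + slope P i * sdist P i z with hx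
  set y : ℝ := sdist P i z with hy
  have hzx : z = P i + edgeDir P i * ((x : ℂ) + (y : ℂ) * Complex.I) := by
    have := hP.eq_start i z
    rw [hx]
    unfold miter at this
    push_cast
    linear_combination this
  have hz' : ∀ m, 0 ≤ cross ((fun m => K.place b (hK.quad f i m)) (finRotate 4 m) -
      (fun m => K.place b (hK.quad f i m)) m) (z - (fun m => K.place b (hK.quad f i m)) m) := hz
  rw [h1] at hz'
  obtain ⟨t1, t2, t3, t4⟩ := trapezoid_bounds (hP.edgeDir_ne_zero i) h3 h4 hzx hz'
  obtain ⟨s1, -, s3⟩ := hP.side_sdist_frame hzx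
  have hf := (hb f).1
  obtain ⟨n1, n2⟩ := hK.cut_nonneg hb f i
  have hpos : 0 < b f + b' := by positivity
  refine ⟨fun hy0 => ?_, fun h => by rw [h6 h] at t1; linarith⟩
  have hby : 0 ≤ b f - y := by linarith
  have m1 : hK.cutStart b f i * (b f - y) ≤ b f * side P i z := by
    refine le_of_mul_le_mul_right ?_ hpos
    have := mul_le_mul_of_nonneg_left t3 hf.le
    rw [s1]
    have e : hK.cutStart b f i * (b f - y) * (b f + b') =
      (b f * b' * (slope P i + k)) * (b f - y) := by rw [← c1]; ring
    rw [e]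
    linarith
  have m2 : hK.cutEnd b f i * (b f - y) ≤ -(b f * side P (finRotate _ i) z) := by
    refine le_of_mul_le_mul_right ?_ hpos
    have := mul_le_mul_of_nonneg_left t4 hf.le
    rw [s3]
    have e : hK.cutEnd b f i * (b f - y) * (b f + b') =
      (b f * b' * (slope P (finRotate _ i) + k')) * (b f - y) := by rw [← c2]; ring
    rw [e]
    linarith
  refine ⟨⟨⟨hy0, t2⟩, ?_, ?_⟩, m1, m2⟩
  · exact nonneg_of_mul_nonneg_right ((mul_nonneg n1 hby).trans m1) hf
  · have := (mul_nonneg n2 hby).trans m2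
    have : 0 ≤ b f * (-side P (finRotate _ i) z) := by linarith
    linarith [nonneg_of_mul_nonneg_right this hf]

/-- The part of the quadrilateral on the side of `f` lies in the middle piece of `f`. The other part
is treated in the same way after describing the same cell from the polygon across; without such a
polygon there is no other part. -/
theorem region_ofEdge_subset {e : Sym2 ℂ} {he : e ∈ K.edges} :
    (HatCell.ofEdge e he).region (K.place b) ⊆ hK.edgeZone b e := by
  intro z hz
  obtain ⟨f, i, rfl⟩ := mem_edges_iff.1 he
  have h1 := hK.midPiece_of_region hb hz
  by_cases hs : 0 ≤ sdist (K.poly f).bd i z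
  · exact ⟨f, i, rfl, h1.1 hs⟩
  by_cases hp : (hK.across f i).IsPoly
  · obtain ⟨g, j, hfg, hj⟩ := hK.exists_of_isPoly hp
    have hz' : z ∈ (HatCell.ofEdge _ (hj ▸ he)).region (K.place b) := by
      convert hz using 3
      exact hj.symm
    obtain ⟨o1, o2⟩ := (hK.meet f g hfg).opposite hj
    refine ⟨g, j, hj.symm, (hK.midPiece_of_region hb hz').1 ?_⟩
    rw [(PolygonCell.sdist_of_opposite o1 o2).2.2]
    linarith
  · exact (hs (h1.2 hp)).elim

include hK in
theorem exists_quad {e : Sym2 ℂ} (he : e ∈ K.edges) : ∃ q : Fin 4 → K.HatVertex,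
    (HatCell.ofEdge e he).IsDrawnAs (K.place b) q ∧ ConvexIndependent ℝ (fun i => K.place b (q i)) ∧
      Convex ℝ ((HatCell.ofEdge e he).region (K.place b)) := by
  obtain ⟨f, i, rfl⟩ := mem_edges_iff.1 he
  refine ⟨hK.quad f i, hK.isDrawnAs_quad hb f i he,
    quad_convexIndependent (hK.quad_cross hb f i), ?_⟩
  rw [hK.region_ofEdge hb]
  exact quad_convex (C := fun m => K.place b (hK.quad f i m))

end IsAdmissible

/-! ### The drawing of the graph -/

theorem HatCell.seg_subset_region {c : K.HatCell} {φ : K.HatVertex → ℂ} {E : Sym2 K.HatVertex}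
    (hE : E ∈ c.facets) : seg φ E ⊆ c.region φ := fun _ hz =>
  Or.inl (mem_iUnion₂.2 ⟨E, hE, hz⟩)

theorem HatCell.mem_region_of_facet {c : K.HatCell} {φ : K.HatVertex → ℂ} {x : K.HatVertex}
    (hx : ∃ E ∈ c.facets, x ∈ E) : φ x ∈ c.region φ := by
  obtain ⟨E, hE, hx⟩ := hx
  exact HatCell.seg_subset_region hE (mem_seg_of_mem φ hx)

namespace IsAdmissible

variable (hK : K.IsAdmissible)
include hK

theorem cellEdges_subset (c : Cell F H) : K.cellEdges c ⊆ K.edges := by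
  cases c with
  | poly f => exact fun e he => mem_iUnion.2 ⟨f, he⟩
  | hole h => exact hK.hole_edges h
  | outside => exact fun e he => he.1

theorem base_mem_verts (x : K.HatVertex) : x.base ∈ K.verts := by
  cases x with
  | poly f i => exact mem_iUnion.2 ⟨f, i, rfl⟩
  | hole h i =>
    exact mem_verts_of_mem_edge (hK.hole_edges h ((K.hole h).edge_mem_edges i))
      (Sym2.mem_mk_left _ _)
  | outside v hv => exact hv.1

theorem mem_verts_of_mem_region {v : ℂ} (hv : v ∈ K.verts) {g : F} (hg : v ∈ (K.poly g).region) :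
    ∃ k, (K.poly g).bd k = v := by
  obtain ⟨f, k, rfl⟩ := mem_iUnion.1 hv
  by_cases h : f = g
  · subst h; exact ⟨k, rfl⟩
  · exact (hK.meet f g h).vertex_mem hg

variable [Finite F] [Finite H]

theorem facet_ofEdge_iff {e : Sym2 ℂ} {he : e ∈ K.edges} {x : K.HatVertex} :
    (∃ E ∈ (HatCell.ofEdge e he).facets, x ∈ E) ↔ x.base ∈ e ∧ e ∈ K.cellEdges x.cell := by
  obtain ⟨f, i, rfl⟩ := mem_edges_iff.1 he
  rw [hK.facets_ofEdge]
  have hf : (K.poly f).edge i ∈ K.cellEdges (.poly f : Cell F H) := ⟨i, rfl⟩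
  constructor
  · rintro ⟨E, hE, hx⟩
    have : x = hK.nbStart f i ∨ x = hK.nbEnd f i ∨ x = .poly f i ∨ x = .poly f (finRotate _ i) := by
      rw [mem_cycleEdges_quad] at hE
      rcases hE with rfl | rfl | rfl | rfl <;> rcases Sym2.mem_iff.1 hx with h | h <;> tauto
    rcases this with rfl | rfl | rfl | rfl
    · rw [base_nbStart, cell_nbStart]
      exact ⟨Sym2.mem_mk_left _ _, hK.edge_mem_across f i⟩
    · rw [base_nbEnd, cell_nbEnd]
      exact ⟨Sym2.mem_mk_right _ _, hK.edge_mem_across f i⟩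
    · exact ⟨Sym2.mem_mk_left _ _, hf⟩
    · exact ⟨Sym2.mem_mk_right _ _, hf⟩
  · rintro ⟨h1, h2⟩
    have key : ∀ E, E ∈ cycleEdges (hK.quad f i) → x ∈ E →
      ∃ E ∈ cycleEdges (hK.quad f i), x ∈ E := fun E h h' => ⟨E, h, h'⟩
    rcases hK.mem_cellEdges_iff.1 h2 with h | h <;> rcases Sym2.mem_iff.1 h1 with h' | h'
    · obtain rfl : x = .poly f i := HatVertex.ext_cell_base h h'
      exact key _ (hK.mem_cycleEdges_quad.2 (Or.inr (Or.inr (Or.inr rfl)))) (Sym2.mem_mk_left _ _)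
    · obtain rfl : x = .poly f (finRotate _ i) := HatVertex.ext_cell_base h h'
      exact key _ (hK.mem_cycleEdges_quad.2 (Or.inr (Or.inr (Or.inl rfl)))) (Sym2.mem_mk_left _ _)
    · obtain rfl : x = hK.nbStart f i :=
        HatVertex.ext_cell_base (by rw [h, cell_nbStart]) (by rw [h', base_nbStart])
      exact key _ (hK.mem_cycleEdges_quad.2 (Or.inl rfl)) (Sym2.mem_mk_left _ _)
    · obtain rfl : x = hK.nbEnd f i :=
        HatVertex.ext_cell_base (by rw [h, cell_nbEnd]) (by rw [h', base_nbEnd])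
      exact key _ (hK.mem_cycleEdges_quad.2 (Or.inl rfl)) (Sym2.mem_mk_right _ _)

-- Copies of edges and new edges are all sides of Class 2 cells, so the study of crossings can be
-- confined to the quadrilaterals.
omit [Finite F] [Finite H] in
theorem exists_facet_ofEdge {c : K.HatCell} {E : Sym2 K.HatVertex} (hE : E ∈ c.facets) :
    ∃ e he, E ∈ (HatCell.ofEdge e he : K.HatCell).facets := by
  cases c with
  | ofPoly f =>
    obtain ⟨e, h⟩ := mem_iUnion.1 hE
    exact ⟨e, hK.cellEdges_subset _ h.1, Or.inl (mem_iUnion.2 ⟨_, h⟩)⟩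
  | ofEdge e he => exact ⟨e, he, hE⟩
  | ofVertex v C =>
    obtain ⟨e, h, -⟩ := hE
    obtain ⟨hv, x, y, hx, hy, hxy, hex, hey, rfl⟩ := h
    exact ⟨e, hK.cellEdges_subset _ hex,
      Or.inr (mem_iUnion.2 ⟨v, hv, x, y, hx, hy, hxy, hex, hey, rfl⟩)⟩

/-- Two distinct edges with a common end are shared by at most one common cell. -/
theorem cell_unique {e e' : Sym2 ℂ} (he : e ∈ K.edges) (hne : e ≠ e') {v : ℂ} (hv : v ∈ e)
    (hv' : v ∈ e') {c d : Cell F H} (hc : e ∈ K.cellEdges c) (hc' : e' ∈ K.cellEdges c)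
    (hd : e ∈ K.cellEdges d) (hd' : e' ∈ K.cellEdges d) : c = d := by
  by_contra hcd
  -- The case in which one of the two cells is a polygon `f`. A polygon shares just one edge with
  -- `f`, and a cell that is not a polygon cannot lie across both edges of `f` at `v`.
  have main : ∀ (f : F) (d : Cell F H), e ∈ K.cellEdges (.poly f : Cell F H) →
      e' ∈ K.cellEdges (.poly f : Cell F H) → e ∈ K.cellEdges d → e' ∈ K.cellEdges d →
      .poly f ≠ d → False := by
    rintro f d ⟨i, rfl⟩ ⟨j, rfl⟩ hd hd' hfd
    have hij : i ≠ j := fun h => hne (by rw [h])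
    have a1 := (hK.mem_cellEdges_iff (f := f) (i := i)).1 hd
    have a2 := (hK.mem_cellEdges_iff (f := f) (i := j)).1 hd'
    have a1 := a1.resolve_left (Ne.symm hfd)
    have a2 := a2.resolve_left (Ne.symm hfd)
    by_cases hp : d.IsPoly
    · obtain ⟨g, rfl⟩ := hp
      exact hij ((hK.meet f g fun h => hfd (by rw [h])).edge_unique hd hd')
    · rcases Sym2.mem_iff.1 hv with h1 | h1 <;> rcases Sym2.mem_iff.1 hv' with h2 | h2
      · exact hij ((K.poly f).simple.injective (h1.symm.trans h2))
      · have := (K.poly f).simple.injective (h1.symm.trans h2)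
        subst this
        rcases hK.isPoly_across f j with h | h
        · exact hp (a2 ▸ h)
        · exact hp (a1 ▸ h)
      · have := (K.poly f).simple.injective (h1.symm.trans h2)
        subst this
        rcases hK.isPoly_across f i with h | h
        · exact hp (a1 ▸ h)
        · exact hp (a2 ▸ h)
      · exact hij ((finRotate _).injective ((K.poly f).simple.injective (h1.symm.trans h2)))
  -- The edge `e` belongs to a polygon and to one further cell, so two distinct cells at `e` include
  -- that polygon.
  obtain ⟨f, i, hf⟩ := mem_edges_iff.1 he
  subst hf
  rcases hK.mem_cellEdges_iff.1 hc with h | h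
  · subst h; exact main f d hc hc' hd hd' hcd
  rcases hK.mem_cellEdges_iff.1 hd with h' | h'
  · subst h'; exact main f c hd hd' hc hc' (Ne.symm hcd)
  · exact hcd (h.trans h'.symm)

theorem eq_of_facet_facet {e e' : Sym2 ℂ} (he : e ∈ K.edges) (hne : e ≠ e')
    {x y : K.HatVertex} (hx : x.base ∈ e) (hx' : x.base ∈ e') (hy : y.base ∈ e)
    (hy' : y.base ∈ e') (cx : e ∈ K.cellEdges x.cell) (cx' : e' ∈ K.cellEdges x.cell)
    (cy : e ∈ K.cellEdges y.cell) (cy' : e' ∈ K.cellEdges y.cell) : x = y := by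
  refine HatVertex.ext_cell_base (hK.cell_unique he hne hx hx' cx cx' cy cy') ?_
  by_contra hb
  exact hne (((Sym2.mem_and_mem_iff hb).1 ⟨hx, hy⟩).trans
    ((Sym2.mem_and_mem_iff hb).1 ⟨hx', hy'⟩).symm)

variable {b : F → ℝ} (hb : K.IsOffsetChoice b)
include hb

omit [Finite F] [Finite H] hK hb in
variable (b) in
theorem offset_mem_core (f : F) (i : Fin (K.poly f).n) :
    offset (K.poly f).bd (b f) i ∈ K.core b f :=
  Or.inl (left_mem_boundary (offset (K.poly f).bd (b f)) i)

omit [Finite F] [Finite H] in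
theorem core_notMem_verts {f : F} {z : ℂ} (hz : z ∈ K.core b f) : z ∉ K.verts := by
  intro hv
  have hi := core_subset_inner hb hz
  obtain ⟨k, rfl⟩ := hK.mem_verts_of_mem_region hv (PolygonCell.mem_region_iff.2 (Or.inr hi))
  exact hi.1 (left_mem_boundary _ k)

omit [Finite F] [Finite H] hK in
theorem isSimple_offset (f : F) : IsSimple (offset (K.poly f).bd (b f)) :=
  (hb f).2 _ ⟨(hb f).1.le, le_rfl⟩

-- A displaced vertex is interior to its polygon, hence in no other polygon and no vertex of `K`.
-- Undisplaced vertices at the same point belong to the same cell.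
omit [Finite F] [Finite H] in
theorem place_injective : Function.Injective (K.place b) := by
  have key : ∀ (f : F) (i : Fin (K.poly f).n) (y : K.HatVertex),
      K.place b (.poly f i) = K.place b y → .poly f i = y := by
    intro f i y h
    have h1 := offset_mem_core b f i
    have h : offset (K.poly f).bd (b f) i = K.place b y := h
    by_cases hy : y.cell.IsPoly
    · cases y with
      | poly g j =>
        have h : offset (K.poly f).bd (b f) i = offset (K.poly g).bd (b g) j := h
        by_cases hfg : f = g
        · subst hfg
          rw [(isSimple_offset hb f).injective h]
        · refine (hK.core_inter_region hb hfg h1 ?_).elim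
          rw [h]
          exact PolygonCell.mem_region_iff.2
            (Or.inr (core_subset_inner hb (offset_mem_core b g j)))
      | hole h j => obtain ⟨g, hg⟩ := hy; cases hg
      | outside v hv => obtain ⟨g, hg⟩ := hy; cases hg
    · rw [HatVertex.place_of_not_isPoly hy] at h
      exact (hK.core_notMem_verts hb h1 (h ▸ hK.base_mem_verts y)).elim
  intro x y h
  by_cases hx : x.cell.IsPoly
  · cases x with
    | poly f i => exact key f i y h
    | hole h j => obtain ⟨g, hg⟩ := hx; cases hg
    | outside v hv => obtain ⟨g, hg⟩ := hx; cases hg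
  by_cases hy : y.cell.IsPoly
  · cases y with
    | poly f i => exact (key f i x h.symm).symm
    | hole h j => obtain ⟨g, hg⟩ := hy; cases hg
    | outside v hv => obtain ⟨g, hg⟩ := hy; cases hg
  rw [HatVertex.place_of_not_isPoly hx, HatVertex.place_of_not_isPoly hy] at h
  exact HatVertex.ext_cell_base
    (hK.eq_of_not_isPoly hx hy x.base_mem_cellRegion (h ▸ y.base_mem_cellRegion)) h

theorem mem_edge_of_midPiece {v : ℂ} (hv : v ∈ K.verts) {g : F} {j : Fin (K.poly g).n}
    (h : v ∈ hK.midPiece b g j) : v ∈ (K.poly g).edge j := by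
  obtain ⟨k, rfl⟩ := hK.mem_verts_of_mem_region hv (hK.midPiece_subset_region hb h)
  have h0 : sdist (K.poly g).bd j ((K.poly g).bd k) = 0 := by
    by_contra h0
    exact ((K.poly g).simple.interior_of_mem_strip (K.poly g).ccw (hb g) h.1 h0).1
      (left_mem_boundary _ k)
  rcases (K.poly g).simple.vertex_mem_edge
    (((K.poly g).simple.mem_segment_iff j).2 ⟨h0, h.1.2⟩) with rfl | rfl
  · exact Sym2.mem_mk_left _ _
  · exact Sym2.mem_mk_right _ _

theorem facet_of_midPiece {x : K.HatVertex} {g : F} {j : Fin (K.poly g).n}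
    (h : K.place b x ∈ hK.midPiece b g j) :
    x.base ∈ (K.poly g).edge j ∧ (K.poly g).edge j ∈ K.cellEdges x.cell := by
  by_cases hx : x.cell.IsPoly
  · cases x with
    | poly f i =>
      have h1 := offset_mem_core b f i
      by_cases hfg : f = g
      · subst hfg
        rcases (isSimple_offset hb f).vertex_mem_edge (hK.core_inter_mid hb h1 h) with rfl | rfl
        · exact ⟨Sym2.mem_mk_left _ _, _, rfl⟩
        · exact ⟨Sym2.mem_mk_right _ _, _, rfl⟩
      · exact (hK.core_inter_region hb hfg h1 (hK.midPiece_subset_region hb h)).elim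
    | hole h j => obtain ⟨g, hg⟩ := hx; cases hg
    | outside v hv => obtain ⟨g, hg⟩ := hx; cases hg
  · rw [HatVertex.place_of_not_isPoly hx] at h
    have h1 := hK.mem_edge_of_midPiece hb (hK.base_mem_verts x) h
    refine ⟨h1, ?_⟩
    rw [hK.eq_of_not_isPoly hx (hK.not_isPoly_of_mem_edge_mid hb h h1) x.base_mem_cellRegion
      (mem_cellRegion_of_mem_edge (hK.edge_mem_across g j) h1)]
    exact hK.edge_mem_across g j

theorem facet_of_edgeZone {x : K.HatVertex} {e : Sym2 ℂ}
    (h : K.place b x ∈ hK.edgeZone b e) : x.base ∈ e ∧ e ∈ K.cellEdges x.cell := by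
  obtain ⟨f, i, rfl, h⟩ := h
  exact hK.facet_of_midPiece hb h

omit hb in
/-- At the end of an edge whose other side is not a polygon there is an undisplaced vertex. -/
theorem exists_place_eq {f : F} {i : Fin (K.poly f).n} (hp : ¬ (hK.across f i).IsPoly) {v : ℂ}
    (hv : v ∈ (K.poly f).edge i) : ∃ x : K.HatVertex, x.cell = hK.across f i ∧ x.base = v ∧
      K.place b x = v := by
  rcases Sym2.mem_iff.1 hv with rfl | rfl
  · exact ⟨hK.nbStart f i, hK.cell_nbStart f i, hK.base_nbStart f i, hK.place_nbStart hp b⟩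
  · exact ⟨hK.nbEnd f i, hK.cell_nbEnd f i, hK.base_nbEnd f i, hK.place_nbEnd hp b⟩

/-- Inside one polygon, middle pieces of distinct edges share only an offset vertex. In distinct
polygons they share only an end of an edge whose other side is not a polygon, and there an
undisplaced copy is placed. -/
theorem edgeZone_inter_edgeZone {e e' : Sym2 ℂ} (hne : e ≠ e') {z : ℂ}
    (h : z ∈ hK.edgeZone b e) (h' : z ∈ hK.edgeZone b e') : ∃ x, z = K.place b x := by
  obtain ⟨f, i, rfl, h⟩ := h
  obtain ⟨g, j, rfl, h'⟩ := h'
  by_cases hfg : f = g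
  · subst hfg
    rcases hK.mid_inter_mid hb (fun h => hne (by rw [h])) h h' with ⟨-, h⟩ | ⟨-, h⟩
    · exact ⟨.poly f j, h⟩
    · exact ⟨.poly f i, h⟩
  · obtain ⟨h1, -, h2, -⟩ := hK.mid_inter_mid' hb hfg hne h h'
    obtain ⟨x, -, -, hx⟩ := hK.exists_place_eq (b := b) h2 h1
    exact ⟨x, hx.symm⟩

theorem seg_inter_edge_edge {e : Sym2 ℂ} {he : e ∈ K.edges} {E E' : Sym2 K.HatVertex}
    (hE : E ∈ (HatCell.ofEdge e he).facets) (hE' : E' ∈ (HatCell.ofEdge e he).facets)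
    (hne : E ≠ E') {z : ℂ} (hz : z ∈ seg (K.place b) E) (hz' : z ∈ seg (K.place b) E') :
    ∃ w, w ∈ E ∧ w ∈ E' ∧ z = K.place b w := by
  obtain ⟨f, i, rfl⟩ := mem_edges_iff.1 he
  obtain ⟨h1, h2⟩ := hK.isDrawnAs_quad hb f i he
  rw [h1] at hE hE'
  obtain ⟨m, rfl⟩ := hE
  obtain ⟨k, rfl⟩ := hE'
  rcases h2.edge_inter (i := m) (j := k) hz hz' with rfl | ⟨rfl, h⟩ | ⟨rfl, h⟩
  · exact (hne rfl).elim
  · exact ⟨_, Sym2.mem_mk_right _ _, Sym2.mem_mk_left _ _, h⟩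
  · exact ⟨_, Sym2.mem_mk_left _ _, Sym2.mem_mk_right _ _, h⟩

theorem vertex_of_seg {c : K.HatCell} {E : Sym2 K.HatVertex} (hE : E ∈ c.facets)
    {x : K.HatVertex} (hx : K.place b x ∈ seg (K.place b) E) : x ∈ E := by
  obtain ⟨e, he, hE⟩ := hK.exists_facet_ofEdge hE
  have h1 := hK.facet_of_edgeZone hb (hK.region_ofEdge_subset hb
    (HatCell.seg_subset_region hE hx))
  obtain ⟨E', hE', hxE'⟩ := hK.facet_ofEdge_iff (he := he).2 h1
  by_cases hne : E = E'
  · rwa [hne]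
  · obtain ⟨w, hw, -, h⟩ := hK.seg_inter_edge_edge hb hE hE' hne hx (mem_seg_of_mem _ hxE')
    rwa [hK.place_injective hb h]

/-- Two sides of the same quadrilateral meet properly because it is simple. Sides of different
quadrilaterals meet only where a vertex is placed, and an edge contains no placed vertices but its
ends. -/
theorem seg_inter_seg {c d : K.HatCell} {E E' : Sym2 K.HatVertex} (hE : E ∈ c.facets)
    (hE' : E' ∈ d.facets) (hne : E ≠ E') {z : ℂ} (hz : z ∈ seg (K.place b) E)
    (hz' : z ∈ seg (K.place b) E') : ∃ w, w ∈ E ∧ w ∈ E' ∧ z = K.place b w := by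
  obtain ⟨e, he, hE⟩ := hK.exists_facet_ofEdge hE
  obtain ⟨e', he', hE'⟩ := hK.exists_facet_ofEdge hE'
  by_cases hee : e = e'
  · subst hee
    exact hK.seg_inter_edge_edge hb hE hE' hne hz hz'
  · obtain ⟨w, rfl⟩ := hK.edgeZone_inter_edgeZone hb hee
      (hK.region_ofEdge_subset hb (HatCell.seg_subset_region hE hz))
      (hK.region_ofEdge_subset hb (HatCell.seg_subset_region hE' hz'))
    exact ⟨w, hK.vertex_of_seg hb hE hz, hK.vertex_of_seg hb hE' hz', rfl⟩

theorem isPlaneDrawing : IsPlaneDrawing K.hatGraph (K.place b) (seg (K.place b)) where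
  injective := hK.place_injective hb
  isArc := by
    intro u v huv
    have hne : K.place b u ≠ K.place b v := fun h => huv.ne (hK.place_injective hb h)
    refine ⟨fun t => AffineMap.lineMap (K.place b u) (K.place b v) (t : ℝ), ?_, ?_, by simp,
      by simp, ?_⟩
    · exact AffineMap.lineMap_continuous.comp continuous_subtype_val
    · exact (AffineMap.lineMap_injective ℝ hne).comp Subtype.val_injective
    · show _ = segment ℝ _ _
      rw [segment_eq_image_lineMap]
      ext z
      simp only [mem_range, mem_image, Subtype.exists, exists_prop]
  vertex := by
    intro e he w hw
    obtain ⟨c, hc⟩ := mem_iUnion.1 ((SimpleGraph.edgeSet_fromEdgeSet _) ▸ he).1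
    exact hK.vertex_of_seg hb hc hw
  crossing := by
    intro e he e' he' hne z hz
    obtain ⟨c, hc⟩ := mem_iUnion.1 ((SimpleGraph.edgeSet_fromEdgeSet _) ▸ he).1
    obtain ⟨c', hc'⟩ := mem_iUnion.1 ((SimpleGraph.edgeSet_fromEdgeSet _) ▸ he').1
    exact hK.seg_inter_seg hb hc hc' hne hz.1 hz.2

end IsAdmissible
end Mesh

/-! ### The cells generated by polygons and vertices -/

theorem segment_subset_union {A B Z : ℂ} (hZ : Z ∈ segment ℝ A B) :
    segment ℝ A B ⊆ segment ℝ A Z ∪ segment ℝ Z B := by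
  have hB : B = A + (1 : ℝ) * (B - A) := by push_cast; ring
  intro z hz
  rw [hB, mem_segment_iff_real zero_le_one] at hZ hz
  obtain ⟨y, hy0, hy1, hy⟩ := hZ
  obtain ⟨x, hx0, hx1, hx⟩ := hz
  rcases le_total x y with h | h
  · left
    rw [hx, hy]
    exact mem_segment_of_real hx0 h
  · right
    have e1 : z = Z + ((x - y : ℝ) : ℂ) * (B - A) := by rw [hx, hy]; push_cast; ring
    have e2 : B = Z + ((1 - y : ℝ) : ℂ) * (B - A) := by rw [hy]; push_cast; ring
    rw [e2, e1]
    have := mem_segment_of_real (u := Z) (d := B - A) (sub_nonneg.2 h)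
      (sub_le_sub_right hx1 y)
    rwa [← e2] at this ⊢

/-- A point whose orbit is finite is periodic if the map is injective away from the preimages of
this point. -/
theorem mem_periodicPts_of_injOn {X : Type*} {p : X → X} {S : Set X} (hS : S.Finite)
    (hp : MapsTo p S S) {x₀ : X} (h₀ : x₀ ∈ S)
    (hinj : ∀ x ∈ S, ∀ y ∈ S, p x = p y → p x ≠ x₀ → x = y) : x₀ ∈ Function.periodicPts p := by
  have hmem : ∀ k, p^[k] x₀ ∈ S := fun k => hp.iterate k h₀
  -- A coincidence between iterates is pulled back one step at a time by injectivity; the descent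
  -- stops only when `x₀` itself is reached again.
  have key : ∀ m k, 0 < k → p^[m] x₀ = p^[m + k] x₀ → x₀ ∈ Function.periodicPts p := by
    intro m
    induction m with
    | zero =>
      intro k hk h
      exact ⟨k, hk, by rw [zero_add] at h; exact h.symm⟩
    | succ m ih =>
      intro k hk h
      by_cases hx : p^[m + 1] x₀ = x₀
      · exact ⟨m + 1, by omega, hx⟩
      · refine ih k hk (hinj _ (hmem _) _ (hmem _) ?_ ?_)
        · rw [← Function.iterate_succ_apply' p, ← Function.iterate_succ_apply' p, h]
          congr 2; omega
        · rwa [← Function.iterate_succ_apply' p]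
  have : Finite S := hS
  obtain ⟨m, n, hmn, h⟩ := Finite.exists_ne_map_eq_of_infinite
    (fun k : ℕ => (⟨p^[k] x₀, hmem k⟩ : S))
  have h : p^[m] x₀ = p^[n] x₀ := congrArg Subtype.val h
  rcases lt_or_gt_of_ne hmn with h1 | h1
  · exact key m (n - m) (by omega) (by rw [h]; congr 2; omega)
  · exact key n (m - n) (by omega) (by rw [← h]; congr 2; omega)

theorem iterate_finRotate {X : Type*} (p : X → X) (x : X) (k : Fin (Function.minimalPeriod p x)) :
    p^[(finRotate _ k : ℕ)] x = p (p^[k] x) := by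
  have hk := k.2
  have h : ((finRotate _ k : Fin (Function.minimalPeriod p x)) : ℕ) =
      (k + 1) % Function.minimalPeriod p x := by
    revert k hk
    generalize Function.minimalPeriod p x = N
    intro k hk
    obtain ⟨m, rfl⟩ : ∃ m, N = m + 1 := ⟨N - 1, by omega⟩
    rw [coe_finRotate]
    split_ifs with h
    · rw [h]; simp
    · have : (k : ℕ) ≠ m := fun h' => h (Fin.ext h')
      rw [Nat.mod_eq_of_lt (by omega)]
  rw [h, Function.iterate_mod_minimalPeriod_eq, Function.iterate_succ_apply']

namespace Mesh
variable {F H : Type*} {K : Mesh F H}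

/-- The polygon `f` belongs to the part `C` of the star of `v`. -/
def InStar {v : ℂ} (C : (K.starGraph v).ConnectedComponent) (f : F) : Prop :=
  ∃ h : v ∈ (K.poly f).verts, (⟨f, h⟩ : {f : F // v ∈ (K.poly f).verts}) ∈ C.supp

theorem InStar.of_edge {v : ℂ} {C : (K.starGraph v).ConnectedComponent} {f g : F}
    (hf : InStar C f) (hfg : f ≠ g) {i : Fin (K.poly f).n} {j : Fin (K.poly g).n}
    (he : (K.poly f).edge i = (K.poly g).edge j) (hv : v ∈ (K.poly f).edge i) : InStar C g := by
  obtain ⟨h, hC⟩ := hf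
  have hg : v ∈ (K.poly g).verts := by
    rw [he] at hv
    rcases Sym2.mem_iff.1 hv with rfl | rfl <;> exact mem_range_self _
  refine ⟨hg, ?_⟩
  rw [SimpleGraph.ConnectedComponent.mem_supp_iff] at hC ⊢
  rw [← hC, SimpleGraph.ConnectedComponent.eq]
  exact SimpleGraph.Adj.reachable
    ⟨fun h => hfg (congrArg Subtype.val h).symm, _, ⟨⟨j, rfl⟩, ⟨i, he.symm⟩⟩,
      show v ∈ (K.poly g).edge j from he ▸ hv⟩

theorem InStar.eq {v : ℂ} {C C' : (K.starGraph v).ConnectedComponent} {f : F}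
    (h : InStar C f) (h' : InStar C' f) : C = C' := by
  obtain ⟨h1, h2⟩ := h
  obtain ⟨h3, h4⟩ := h'
  exact h2.symm.trans h4

theorem exists_inStar {v : ℂ} (C : (K.starGraph v).ConnectedComponent) :
    ∃ f i, (K.poly f).bd i = v ∧ InStar C f := by
  obtain ⟨⟨f, i, hi⟩, hf⟩ := C.nonempty_supp
  exact ⟨f, i, hi, ⟨i, hi⟩, hf⟩

/-- A property of polygons that is inherited across the edges at `v` holds on a whole part of the
star of `v`, or nowhere on it. -/
theorem InStar.induction {v : ℂ} {C : (K.starGraph v).ConnectedComponent} {Q : F → Prop}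
    (hQ : ∀ f g, InStar C f → f ≠ g → Q f → ∀ e ∈ (K.poly f).edges ∩ (K.poly g).edges, v ∈ e → Q g)
    {f g : F} (hf : InStar C f) (hg : InStar C g) (h : Q f) : Q g := by
  obtain ⟨hf', hfC⟩ := hf
  obtain ⟨hg', hgC⟩ := hg
  have hr : (K.starGraph v).Reachable ⟨f, hf'⟩ ⟨g, hg'⟩ :=
    SimpleGraph.ConnectedComponent.exact (hfC.trans hgC.symm)
  obtain ⟨w⟩ := hr
  have key : ∀ (x y : {f : F // v ∈ (K.poly f).verts}), (K.starGraph v).Walk x y → x ∈ C.supp →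
      Q x.1 → Q y.1 := by
    intro x y w
    induction w with
    | nil => exact fun _ h => h
    | cons hadj w ih =>
      intro hx hQx
      obtain ⟨hne, e, he, hv⟩ := hadj
      refine ih ?_ (hQ _ _ ⟨_, hx⟩ (fun h => hne (Subtype.ext h)) hQx e he hv)
      rw [SimpleGraph.ConnectedComponent.mem_supp_iff] at hx ⊢
      rw [← hx, SimpleGraph.ConnectedComponent.eq]
      exact SimpleGraph.Adj.reachable ⟨hne.symm, e, he.symm, hv⟩
  exact key _ _ w hfC h

namespace IsAdmissible

theorem facets_ofPoly (f : F) :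
    (HatCell.ofPoly f : K.HatCell).facets = cycleEdges (fun i => HatVertex.poly f i) := by
  have hx : ∀ (x : K.HatVertex) (i : Fin (K.poly f).n), x.cell = .poly f →
      x.base = (K.poly f).bd i → x = .poly f i := fun x i h1 h2 => HatVertex.ext_cell_base h1 h2
  ext E
  constructor
  · intro hE
    obtain ⟨e, ⟨i, rfl⟩, x, y, h1, h2, h3, rfl⟩ := mem_iUnion.1 hE
    refine ⟨i, ?_⟩
    rcases Sym2.eq_iff.1 h3 with ⟨h4, h5⟩ | ⟨h4, h5⟩
    · rw [hx x _ h1 h4, hx y _ h2 h5]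
    · rw [hx x _ h1 h4, hx y _ h2 h5, Sym2.eq_swap]
  · rintro ⟨i, rfl⟩
    exact mem_iUnion.2 ⟨(K.poly f).edge i, ⟨i, rfl⟩, _, _, rfl, rfl, rfl, rfl⟩

theorem isDrawnAs_ofPoly {b : F → ℝ} (hb : K.IsOffsetChoice b) (f : F) :
    (HatCell.ofPoly f : K.HatCell).IsDrawnAs (K.place b) (fun i => HatVertex.poly f i) :=
  ⟨facets_ofPoly f, isSimple_offset hb f⟩

theorem region_ofPoly (b : F → ℝ) (f : F) :
    (HatCell.ofPoly f : K.HatCell).region (K.place b) = K.core b f := by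
  unfold HatCell.region
  rw [HatCell.iUnion_facets (facets_ofPoly f)]
  rfl

theorem facet_ofPoly_iff {f : F} {x : K.HatVertex} :
    (∃ E ∈ (HatCell.ofPoly f : K.HatCell).facets, x ∈ E) ↔ x.cell = .poly f := by
  rw [facets_ofPoly]
  constructor
  · rintro ⟨E, ⟨i, rfl⟩, hx⟩
    rcases Sym2.mem_iff.1 hx with rfl | rfl <;> rfl
  · intro hx
    cases x with
    | poly g i =>
      cases hx
      exact ⟨_, ⟨i, rfl⟩, Sym2.mem_mk_left _ _⟩
    | hole h i => cases hx
    | outside v hv => cases hx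

variable [Finite F] [Finite H] (hK : K.IsAdmissible)
include hK

/-- A polygon of the part has one edge leaving `v` and one arriving there; the facets are the new
edges across these, seen from the polygon. -/
theorem facet_ofVertex_iff {v : ℂ} {C : (K.starGraph v).ConnectedComponent}
    {E : Sym2 K.HatVertex} : E ∈ (HatCell.ofVertex v C).facets ↔
      ∃ f i, (K.poly f).bd i = v ∧ InStar C f ∧ (E = s(.poly f i, hK.nbStart f i) ∨
        E = s(.poly f i, hK.nbEnd f ((finRotate _).symm i))) := by
  have aux : ∀ (f : F), InStar C f → ∀ (x y : K.HatVertex) (e : Sym2 ℂ), x.cell = .poly f →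
      x.base = v → y.base = v → x.cell ≠ y.cell → e ∈ K.cellEdges x.cell →
      e ∈ K.cellEdges y.cell → v ∈ e → ∃ i, (K.poly f).bd i = v ∧
      (s(x, y) = s(.poly f i, hK.nbStart f i) ∨
        s(x, y) = s(.poly f i, hK.nbEnd f ((finRotate _).symm i))) := by
    intro f hf x y e hx hxv hyv hxy hex hey hv
    rw [hx] at hex
    obtain ⟨k, rfl⟩ := hex
    have hy : y.cell = hK.across f k :=
      ((hK.mem_cellEdges_iff (f := f) (i := k)).1 hey).resolve_left fun h => hxy (hx.trans h.symm)
    rcases Sym2.mem_iff.1 hv with h | h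
    · refine ⟨k, h.symm, Or.inl ?_⟩
      have e1 : x = .poly f k := HatVertex.ext_cell_base hx (hxv.trans h)
      have e2 : y = hK.nbStart f k := HatVertex.ext_cell_base (by rw [cell_nbStart, hy])
        (by rw [base_nbStart, hyv, h])
      rw [e1, e2]
    · refine ⟨finRotate _ k, h.symm, Or.inr ?_⟩
      have e1 : x = .poly f (finRotate _ k) := HatVertex.ext_cell_base hx (hxv.trans h)
      have e2 : y = hK.nbEnd f k := HatVertex.ext_cell_base (by rw [cell_nbEnd, hy])
        (by rw [base_nbEnd, hyv, h])
      rw [e1, e2, Equiv.symm_apply_apply]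
  constructor
  · rintro ⟨e, ⟨hv, x, y, hxv, hyv, hxy, hex, hey, rfl⟩, w, hw, f, hf, hwf⟩
    have hf' : InStar C f.1 := ⟨f.2, hf⟩
    rcases Sym2.mem_iff.1 hw with rfl | rfl
    · obtain ⟨i, h1, h2⟩ := aux f.1 hf' w y e hwf hxv hyv hxy hex hey hv
      exact ⟨f.1, i, h1, hf', h2⟩
    · obtain ⟨i, h1, h2⟩ := aux f.1 hf' w x e hwf hyv hxv hxy.symm hey hex hv
      rw [Sym2.eq_swap]
      exact ⟨f.1, i, h1, hf', h2⟩
  · rintro ⟨f, i, rfl, ⟨hf, hfC⟩, rfl | rfl⟩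
    · refine ⟨(K.poly f).edge i, ⟨Sym2.mem_mk_left _ _, .poly f i, _, rfl, hK.base_nbStart f i, ?_,
        ⟨i, rfl⟩, ?_, rfl⟩, _, Sym2.mem_mk_left _ _, ⟨f, hf⟩, hfC, rfl⟩
      · rw [cell_nbStart]; exact (hK.across_ne f i).symm
      · rw [cell_nbStart]; exact hK.edge_mem_across f i
    · refine ⟨(K.poly f).edge ((finRotate _).symm i), ⟨PolygonCell.mem_edge_symm i, .poly f i, _,
        rfl, ?_, ?_, ⟨_, rfl⟩, ?_, rfl⟩, _, Sym2.mem_mk_left _ _, ⟨f, hf⟩, hfC, rfl⟩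
      · rw [base_nbEnd, Equiv.apply_symm_apply]
      · rw [cell_nbEnd]; exact (hK.across_ne f _).symm
      · rw [cell_nbEnd]; exact hK.edge_mem_across f _

/-- A region that contains the cell generated by the part `C` of the star of `v`. -/
def vertexZone (b : F → ℝ) (v : ℂ) (C : (K.starGraph v).ConnectedComponent) : Set ℂ :=
  {z | ∃ f i, (K.poly f).bd i = v ∧ InStar C f ∧ z ∈ hK.corner b f i}

/-- The new edges at the ends of an edge are mutually the same for the two polygons. -/
theorem nbStart_eq_iff {f g : F} {i : Fin (K.poly f).n} {j : Fin (K.poly g).n} :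
    hK.nbStart f i = .poly g j ↔ hK.nbEnd g ((finRotate _).symm j) = .poly f i := by
  constructor
  · intro h
    have hc : hK.across f i = .poly g := by rw [← cell_nbStart, h]; rfl
    obtain ⟨h1, k, h2⟩ := hK.across_eq_poly_iff.1 hc
    have h3 := hK.nbStart_eq h1.symm h2
    rw [h] at h3
    cases h3
    rw [Equiv.symm_apply_apply]
    exact hK.nbEnd_eq h1 h2.symm
  · intro h
    have hc : hK.across g ((finRotate _).symm j) = .poly f := by rw [← cell_nbEnd, h]; rfl
    obtain ⟨h1, k, h2⟩ := hK.across_eq_poly_iff.1 hc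
    have h3 := hK.nbEnd_eq h1.symm h2
    rw [h] at h3
    cases h3
    rw [hK.nbStart_eq h1 h2.symm, Equiv.apply_symm_apply]

variable {b : F → ℝ} (hb : K.IsOffsetChoice b)
include hb

/-- The new edge is divided where it crosses the edge of `K`: the first part bounds the corner of
`f`, the second the facing corner of the polygon across. -/
theorem segment_nbStart_subset {f : F} {i : Fin (K.poly f).n} :
    segment ℝ (offset (K.poly f).bd (b f) i) (K.place b (hK.nbStart f i)) ⊆
      hK.startPiece b f i ∪
        {z | ∃ g j, f ≠ g ∧ (K.poly f).edge i = (K.poly g).edge j ∧ z ∈ hK.endPiece b g j} := by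
  have h1 : segment ℝ (offset (K.poly f).bd (b f) i)
      ((K.poly f).bd i + hK.cutStart b f i * edgeDir (K.poly f).bd i) ⊆ hK.startPiece b f i :=
    (K.poly f).simple.segment_subset_leftCorner (hb f).1 (hb f) (hK.cut_nonneg hb f i).1
      (hK.cutStart_lt hb f i).le
  refine (segment_subset_union (hK.cutStart_mem_segment hb f i)).trans (union_subset
    (h1.trans subset_union_left) ?_)
  by_cases hp : (hK.across f i).IsPoly
  · refine subset_union_of_subset_right ?_ _
    obtain ⟨g, j, hfg, he⟩ := hK.exists_of_isPoly hp
    obtain ⟨o1, o2⟩ := (hK.meet f g hfg).opposite he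
    have h2 := (K.poly g).simple.segment_subset_rightCorner (hb g).1 (hb g)
      (hK.cut_nonneg hb g j).2 (hK.cutEnd_lt hb g j).le
    intro z hz
    refine ⟨g, j, hfg, he, h2 ?_⟩
    rw [← o1, (PolygonCell.sdist_of_opposite o1 o2).1, ← hK.cutStart_eq_cutEnd hb hfg he, mul_neg,
      sub_neg_eq_add, segment_symm]
    rw [hK.nbStart_eq hfg he] at hz
    exact hz
  -- Without a polygon across, the cut is `0` and the second part of the new edge is the single
  -- point `v`.
  · refine subset_union_of_subset_left ?_ _
    obtain ⟨b', k, k', g1, g2, -, -, -, g3, -⟩ := hK.exists_frame hb f i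
    have g4 := (hK.cut_eq hb g1 g2 (g3 hp).ge).1
    rw [g3 hp] at g4
    have h0 : hK.cutStart b f i = 0 := by
      have := (hb f).1
      have h : hK.cutStart b f i * b f = 0 := by linarith
      exact (mul_eq_zero.1 h).resolve_right this.ne'
    rw [hK.place_nbStart hp, h0]
    simp only [Complex.ofReal_zero, zero_mul, add_zero, segment_same, singleton_subset_iff]
    exact (K.poly f).simple.left_mem_leftCorner (hb f).1.le (hK.cut_nonneg hb f i).1 i

theorem segment_nbEnd_subset {f : F} {i : Fin (K.poly f).n} :
    segment ℝ (offset (K.poly f).bd (b f) (finRotate _ i)) (K.place b (hK.nbEnd f i)) ⊆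
      hK.endPiece b f i ∪
        {z | ∃ g j, f ≠ g ∧ (K.poly f).edge i = (K.poly g).edge j ∧ z ∈ hK.startPiece b g j} := by
  have h1 : segment ℝ (offset (K.poly f).bd (b f) (finRotate _ i))
      ((K.poly f).bd (finRotate _ i) - hK.cutEnd b f i * edgeDir (K.poly f).bd i) ⊆
      hK.endPiece b f i :=
    (K.poly f).simple.segment_subset_rightCorner (hb f).1 (hb f) (hK.cut_nonneg hb f i).2
      (hK.cutEnd_lt hb f i).le
  refine (segment_subset_union (hK.cutEnd_mem_segment hb f i)).trans (union_subset
    (h1.trans subset_union_left) ?_)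
  by_cases hp : (hK.across f i).IsPoly
  · refine subset_union_of_subset_right ?_ _
    obtain ⟨g, j, hfg, he⟩ := hK.exists_of_isPoly hp
    obtain ⟨o1, o2⟩ := (hK.meet f g hfg).opposite he
    have h2 := (K.poly g).simple.segment_subset_leftCorner (hb g).1 (hb g)
      (hK.cut_nonneg hb g j).1 (hK.cutStart_lt hb g j).le
    intro z hz
    refine ⟨g, j, hfg, he, h2 ?_⟩
    rw [← o2, (PolygonCell.sdist_of_opposite o1 o2).1,
      hK.cutStart_eq_cutEnd hb hfg.symm he.symm, mul_neg, ← sub_eq_add_neg, segment_symm]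
    rw [hK.nbEnd_eq hfg he] at hz
    exact hz
  · refine subset_union_of_subset_left ?_ _
    obtain ⟨b', k, k', g1, g2, -, -, -, g3, -⟩ := hK.exists_frame hb f i
    have g4 := (hK.cut_eq hb g1 g2 (g3 hp).ge).2
    rw [g3 hp] at g4
    have h0 : hK.cutEnd b f i = 0 := by
      have := (hb f).1
      have h : hK.cutEnd b f i * b f = 0 := by linarith
      exact (mul_eq_zero.1 h).resolve_right this.ne'
    rw [hK.place_nbEnd hp, h0]
    simp only [Complex.ofReal_zero, zero_mul, sub_zero, segment_same, singleton_subset_iff]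
    exact (K.poly f).simple.right_mem_rightCorner (hb f).1.le (hK.cut_nonneg hb f i).2 i

theorem seg_subset_vertexZone {v : ℂ} {C : (K.starGraph v).ConnectedComponent}
    {E : Sym2 K.HatVertex} (hE : E ∈ (HatCell.ofVertex v C).facets) :
    seg (K.place b) E ⊆ hK.vertexZone b v C := by
  obtain ⟨f, i, rfl, hf, rfl | rfl⟩ := hK.facet_ofVertex_iff.1 hE
  · intro z hz
    rcases hK.segment_nbStart_subset hb hz with h | ⟨g, j, hfg, he, h⟩
    · exact ⟨f, i, rfl, hf, Or.inl h⟩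
    · refine ⟨g, finRotate _ j, ((hK.meet f g hfg).opposite he).1.symm,
        hf.of_edge hfg he (Sym2.mem_mk_left _ _), Or.inr ?_⟩
      rwa [Equiv.symm_apply_apply]
  · obtain ⟨k, rfl⟩ : ∃ k, i = finRotate _ k := ⟨_, ((finRotate _).apply_symm_apply i).symm⟩
    rw [Equiv.symm_apply_apply]
    intro z hz
    rcases hK.segment_nbEnd_subset hb hz with h | ⟨g, j, hfg, he, h⟩
    · refine ⟨f, _, rfl, hf, Or.inr ?_⟩
      rwa [Equiv.symm_apply_apply]
    · exact ⟨g, j, ((hK.meet f g hfg).opposite he).2.symm,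
        hf.of_edge hfg he (Sym2.mem_mk_right _ _), Or.inl h⟩

/-- The zone is a union of convex pieces that all contain `v`, so it is star-shaped about `v` and
contains what any curve inside it encloses. -/
theorem region_ofVertex_subset {v : ℂ} {C : (K.starGraph v).ConnectedComponent} :
    (HatCell.ofVertex v C).region (K.place b) ⊆ hK.vertexZone b v C := by
  have hend : ∀ (f : F) (i : Fin (K.poly f).n),
      (K.poly f).bd i ∈ hK.endPiece b f ((finRotate _).symm i) := by
    intro f i
    have := (K.poly f).simple.right_mem_rightCorner (hb f).1.le
      (hK.cut_nonneg hb f ((finRotate _).symm i)).2 ((finRotate _).symm i)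
    rwa [Equiv.apply_symm_apply] at this
  have hstart : ∀ (f : F) (i : Fin (K.poly f).n), (K.poly f).bd i ∈ hK.startPiece b f i :=
    fun f i => (K.poly f).simple.left_mem_leftCorner (hb f).1.le (hK.cut_nonneg hb f i).1 i
  obtain ⟨f, i, hi, hf⟩ := exists_inStar C
  refine fill_subset_of_starConvex (v := v) ⟨f, i, hi, hf, Or.inl (hi ▸ hstart f i)⟩ ?_
    (iUnion₂_subset fun E hE => hK.seg_subset_vertexZone hb hE)
  rintro z ⟨f, i, rfl, hf, hz⟩ a c ha hc hac
  refine ⟨f, i, rfl, hf, ?_⟩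
  rcases hz with hz | hz
  · exact Or.inl (convex_leftCorner _ _ _ _ (hstart f i) hz ha hc hac)
  · exact Or.inr (convex_rightCorner _ _ _ _ (hend f i) hz ha hc hac)

end IsAdmissible

/-! ### Walking around a vertex -/

instance [Finite F] [Finite H] : Finite (Cell F H) := by
  refine Finite.of_surjective (fun s : Option (F ⊕ H) => s.elim .outside solidCell) fun c => ?_
  rcases eq_outside_or c with rfl | ⟨a, rfl⟩
  · exact ⟨none, rfl⟩
  · exact ⟨some a, rfl⟩

theorem finite_base [Finite F] [Finite H] (v : ℂ) : {x : K.HatVertex | x.base = v}.Finite := by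
  have : Function.Injective fun x : {x : K.HatVertex | x.base = v} => x.1.cell :=
    fun x y h => Subtype.ext (HatVertex.ext_cell_base h (x.2.trans y.2.symm))
  exact Finite.of_injective _ this

theorem HatVertex.cell_isPoly_iff {x : K.HatVertex} :
    x.cell.IsPoly ↔ ∃ f i, x = HatVertex.poly f i := by
  constructor
  · rintro ⟨f, hf⟩
    cases x with
    | poly g i => exact ⟨g, i, rfl⟩
    | hole h i => cases hf
    | outside v hv => cases hf
  · rintro ⟨f, i, rfl⟩
    exact ⟨f, rfl⟩

namespace IsAdmissible

variable (hK : K.IsAdmissible)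
include hK

theorem vertex_eq_of_not_isPoly {x y : K.HatVertex} (hx : ¬ x.cell.IsPoly) (hy : ¬ y.cell.IsPoly)
    (h : x.base = y.base) : x = y :=
  HatVertex.ext_cell_base (hK.eq_of_not_isPoly hx hy x.base_mem_cellRegion
    (h ▸ y.base_mem_cellRegion)) h

variable [Finite F] [Finite H]

omit hK [Finite F] [Finite H] in
/-- The vertices at `v` that may occur in the cell generated by the part `C` of the star. -/
def starVerts {v : ℂ} (C : (K.starGraph v).ConnectedComponent) : Set K.HatVertex :=
  {x | x.base = v ∧ ∀ f, x.cell = .poly f → InStar C f}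

theorem nbStart_mem_starVerts {v : ℂ} {C : (K.starGraph v).ConnectedComponent} {f : F}
    {i : Fin (K.poly f).n} (h : .poly f i ∈ starVerts C) : hK.nbStart f i ∈ starVerts C := by
  refine ⟨(hK.base_nbStart f i).trans h.1, fun g hg => ?_⟩
  rw [cell_nbStart] at hg
  obtain ⟨h1, j, h2⟩ := hK.across_eq_poly_iff.1 hg
  exact (h.2 f rfl).of_edge h1.symm h2 (h.1 ▸ Sym2.mem_mk_left _ _)

theorem nbEnd_mem_starVerts {v : ℂ} {C : (K.starGraph v).ConnectedComponent} {f : F}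
    {i : Fin (K.poly f).n} (h : .poly f i ∈ starVerts C) :
    hK.nbEnd f ((finRotate _).symm i) ∈ starVerts C := by
  have h1 := h.1
  refine ⟨?_, fun g hg => ?_⟩
  · rw [base_nbEnd, Equiv.apply_symm_apply]; exact h1
  · rw [cell_nbEnd] at hg
    obtain ⟨h2, j, h3⟩ := hK.across_eq_poly_iff.1 hg
    exact (h.2 f rfl).of_edge h2.symm h3 (h1 ▸ PolygonCell.mem_edge_symm i)

/-- Going once around `v` clockwise. -/
def prevVertex : K.HatVertex → K.HatVertex
  | .poly f i => hK.nbEnd f ((finRotate _).symm i)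
  | x => x

/-- Going once around `v` counterclockwise, where `y` follows on the cell that is not a polygon. -/
def nextVertex (y : K.HatVertex) : K.HatVertex → K.HatVertex
  | .poly f i => hK.nbStart f i
  | _ => y

theorem nextVertex_of_not_isPoly {x y : K.HatVertex} (hx : ¬ x.cell.IsPoly) :
    hK.nextVertex y x = y := by
  cases x with
  | poly f i => exact (hx ⟨f, rfl⟩).elim
  | hole h i => rfl
  | outside v hv => rfl

/-- If some polygon of the part `C` has a boundary edge leaving `v`, then some polygon of `C` has a
boundary edge arriving at `v`. -/
theorem exists_incoming {v : ℂ} {C : (K.starGraph v).ConnectedComponent} {f : F}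
    {i : Fin (K.poly f).n} (hi : (K.poly f).bd i = v) (hf : InStar C f)
    (hp : ¬ (hK.across f i).IsPoly) :
    ∃ g j, (K.poly g).bd j = v ∧ InStar C g ∧ ¬ (hK.across g ((finRotate _).symm j)).IsPoly := by
  by_contra! hall
  have hmem : HatVertex.poly f i ∈ starVerts C := ⟨hi, fun g hg => by cases hg; exact hf⟩
  -- If no boundary edge arrived at `v`, going back would always lead from a polygon to a polygon.
  -- On this finite set `prevVertex` is injective, since `nextVertex` undoes it, so the walk returns
  -- to `f`.
  have hmaps : MapsTo hK.prevVertex {x | x ∈ starVerts C ∧ x.cell.IsPoly}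
      {x | x ∈ starVerts C ∧ x.cell.IsPoly} := by
    rintro x ⟨hx, hxp⟩
    obtain ⟨g, j, rfl⟩ := HatVertex.cell_isPoly_iff.1 hxp
    refine ⟨hK.nbEnd_mem_starVerts hx, ?_⟩
    show (hK.nbEnd g _).cell.IsPoly
    rw [cell_nbEnd]
    exact hall g j hx.1 (hx.2 g rfl)
  have hper := mem_periodicPts_of_injOn (p := hK.prevVertex)
    (S := {x | x ∈ starVerts C ∧ x.cell.IsPoly}) ((finite_base v).subset fun x hx => hx.1.1)
    hmaps (x₀ := .poly f i) ⟨hmem, f, rfl⟩ (by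
      rintro x ⟨hx, hxp⟩ y ⟨hy, hyp⟩ hxy -
      have hpx := (hmaps ⟨hx, hxp⟩).2
      obtain ⟨g, j, rfl⟩ := HatVertex.cell_isPoly_iff.1 hxp
      obtain ⟨g', j', rfl⟩ := HatVertex.cell_isPoly_iff.1 hyp
      obtain ⟨k, l, hkl⟩ := HatVertex.cell_isPoly_iff.1 hpx
      have h1 : hK.nbEnd g ((finRotate _).symm j) = .poly k l := hkl
      have h2 : hK.nbEnd g' ((finRotate _).symm j') = .poly k l := hxy.symm.trans hkl
      rw [← nbStart_eq_iff] at h1 h2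
      exact h1.symm.trans h2)
  obtain ⟨n, hn, hper⟩ := hper
  obtain ⟨m, rfl⟩ : ∃ m, n = m + 1 := ⟨n - 1, by omega⟩
  have h1 : hK.prevVertex (hK.prevVertex^[m] (.poly f i)) = .poly f i := by
    rw [← Function.iterate_succ_apply' hK.prevVertex]; exact hper
  have h2 := hmaps.iterate m (x := HatVertex.poly f i) ⟨hmem, f, rfl⟩
  obtain ⟨g, j, hgj⟩ := HatVertex.cell_isPoly_iff.1 h2.2
  rw [hgj] at h1
  -- The last step back into `f` crosses its edge leaving `v`, so a polygon lies on the other side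
  -- of that edge.
  have h3 := hK.nbStart_eq_iff.2 h1
  apply hp
  rw [← cell_nbStart, h3]
  exact ⟨g, rfl⟩

/-- A starting point for walking around `v` along the part `C` of its star. -/
theorem exists_start {v : ℂ} (C : (K.starGraph v).ConnectedComponent) :
    ∃ (x₀ : K.HatVertex) (f₀ : F) (i₀ : Fin (K.poly f₀).n), x₀ ∈ starVerts C ∧
      .poly f₀ i₀ ∈ starVerts C ∧
      (∀ f i, .poly f i ∈ starVerts C → ¬ (hK.nbStart f i).cell.IsPoly → hK.nbStart f i = x₀) ∧
      (x₀ = .poly f₀ i₀ ∨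
        (¬ x₀.cell.IsPoly ∧ hK.nbEnd f₀ ((finRotate _).symm i₀) = x₀)) := by
  -- If the part has a boundary edge at `v`, the walk starts at the unique undisplaced copy of `v`,
  -- and `f₀` has the boundary edge arriving at `v`. Otherwise it may start at any polygon of the
  -- part.
  by_cases hB : ∃ f i, (K.poly f).bd i = v ∧ InStar C f ∧ ¬ (hK.across f i).IsPoly
  · obtain ⟨f, i, hi, hf, hp⟩ := hB
    obtain ⟨g, j, hj, hg, hq⟩ := hK.exists_incoming hi hf hp
    have hmem : HatVertex.poly f i ∈ starVerts C := ⟨hi, fun g hg => by cases hg; exact hf⟩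
    have hmem' : HatVertex.poly g j ∈ starVerts C := ⟨hj, fun f hf => by cases hf; exact hg⟩
    have hx := hK.nbStart_mem_starVerts hmem
    have hp' : ¬ (hK.nbStart f i).cell.IsPoly := by rwa [cell_nbStart]
    refine ⟨hK.nbStart f i, g, j, hx, hmem', ?_, Or.inr ⟨hp', ?_⟩⟩
    · intro f' i' h h'
      exact hK.vertex_eq_of_not_isPoly h' hp' ((hK.nbStart_mem_starVerts h).1.trans hx.1.symm)
    · exact hK.vertex_eq_of_not_isPoly (by rwa [cell_nbEnd]) hp'
        ((hK.nbEnd_mem_starVerts hmem').1.trans hx.1.symm)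
  · push Not at hB
    obtain ⟨f, i, hi, hf⟩ := exists_inStar C
    have hmem : HatVertex.poly f i ∈ starVerts C := ⟨hi, fun g hg => by cases hg; exact hf⟩
    refine ⟨.poly f i, f, i, hmem, hmem, ?_, Or.inl rfl⟩
    intro g j h h'
    rw [cell_nbStart] at h'
    exact (h' (hB g j h.1 (h.2 g rfl))).elim

/-- Iterating `nextVertex` from `x₀` gives a closed walk, since this map is injective on a finite
set except possibly over `x₀`. Connectedness of the part of the star shows that all its polygons are
visited. -/
theorem exists_cycle {v : ℂ} (C : (K.starGraph v).ConnectedComponent) :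
    ∃ (n : ℕ) (q : Fin n → K.HatVertex), 3 ≤ n ∧ Function.Injective q ∧
      (HatCell.ofVertex v C).facets = cycleEdges q := by
  obtain ⟨x₀, f₀, i₀, hx₀, hy₀, hout, hcase⟩ := hK.exists_start C
  set p := hK.nextVertex (.poly f₀ i₀) with hp
  have hpoly : ∀ f i, p (.poly f i) = hK.nbStart f i := fun f i => rfl
  have hnon : ∀ x, ¬ x.cell.IsPoly → p x = .poly f₀ i₀ := fun x hx =>
    hK.nextVertex_of_not_isPoly hx
  have hmaps : MapsTo p (starVerts C) (starVerts C) := by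
    intro x hx
    by_cases hxp : x.cell.IsPoly
    · obtain ⟨f, i, rfl⟩ := HatVertex.cell_isPoly_iff.1 hxp
      exact hK.nbStart_mem_starVerts hx
    · rw [hnon x hxp]; exact hy₀
  -- A step from a polygon to a polygon is reversed by `nbEnd`. The single undisplaced copy is sent
  -- to `f₀`, and the edge of `f₀` arriving at `v` has no polygon across it in that case, so no
  -- polygon leads to `f₀` as well.
  have hinj : ∀ x ∈ starVerts C, ∀ y ∈ starVerts C, p x = p y → p x ≠ x₀ → x = y := by
    have aux : ∀ f i, HatVertex.poly f i ∈ starVerts C → ∀ y ∈ starVerts C,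
        hK.nbStart f i = p y → hK.nbStart f i ≠ x₀ → .poly f i = y := by
      intro f i hx y hy hxy hne
      have hpx : (hK.nbStart f i).cell.IsPoly := by
        by_contra h; exact hne (hout f i hx h)
      obtain ⟨g, j, hgj⟩ := HatVertex.cell_isPoly_iff.1 hpx
      have h1 := hK.nbStart_eq_iff.1 hgj
      by_cases hyp : y.cell.IsPoly
      · obtain ⟨f', i', rfl⟩ := HatVertex.cell_isPoly_iff.1 hyp
        have h2 := hK.nbStart_eq_iff.1 (hxy.symm.trans hgj)
        exact h1.symm.trans h2
      · rw [hnon y hyp] at hxy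
        rcases hcase with h | ⟨h, h'⟩
        · exact (hne (hxy.trans h.symm)).elim
        · rw [hxy] at hgj
          cases hgj
          rw [h'] at h1
          exact (h (h1 ▸ ⟨f, rfl⟩)).elim
    intro x hx y hy hxy hne
    by_cases hxp : x.cell.IsPoly
    · obtain ⟨f, i, rfl⟩ := HatVertex.cell_isPoly_iff.1 hxp
      exact aux f i hx y hy hxy hne
    by_cases hyp : y.cell.IsPoly
    · obtain ⟨f, i, rfl⟩ := HatVertex.cell_isPoly_iff.1 hyp
      exact (aux f i hy x hx hxy.symm (by rw [hxy] at hne; exact hne)).symm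
    · exact hK.vertex_eq_of_not_isPoly hxp hyp (hx.1.trans hy.1.symm)
  have hper := mem_periodicPts_of_injOn ((finite_base v).subset fun x hx => hx.1) hmaps hx₀ hinj
  set N := Function.minimalPeriod p x₀ with hN
  have hN0 : 0 < N := Function.minimalPeriod_pos_of_mem_periodicPts hper
  let q : Fin N → K.HatVertex := fun k => p^[k] x₀
  have hq : ∀ k, q (finRotate N k) = p (q k) := fun k => iterate_finRotate p x₀ k
  have hqS : ∀ k, q k ∈ starVerts C := fun k => hmaps.iterate k hx₀
  have hqinj : Function.Injective q := fun k l h =>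
    Fin.ext (Function.iterate_injOn_Iio_minimalPeriod k.2 l.2 h)
  have hq0 : ∃ k, q k = x₀ := ⟨⟨0, hN0⟩, rfl⟩
  have hnext : ∀ k, ∃ l, q l = p (q k) := fun k => ⟨_, hq k⟩
  have hprev : ∀ k, ∃ l, q k = p (q l) := fun k =>
    ⟨(finRotate N).symm k, by rw [← hq, Equiv.apply_symm_apply]⟩
  have hqnon : ∀ k, ¬ (q k).cell.IsPoly →
      q k = x₀ ∧ hK.nbEnd f₀ ((finRotate _).symm i₀) = x₀ := by
    intro k hk
    have h1 : q k = x₀ := by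
      obtain ⟨l, hl⟩ := hprev k
      rw [hl] at hk ⊢
      by_cases hlp : (q l).cell.IsPoly
      · obtain ⟨f, i, hfi⟩ := HatVertex.cell_isPoly_iff.1 hlp
        have hlS := hqS l
        rw [hfi] at hk hlS ⊢
        exact hout f i hlS hk
      · rw [hnon _ hlp] at hk
        exact (hk ⟨f₀, rfl⟩).elim
    refine ⟨h1, ?_⟩
    rcases hcase with h | h
    · rw [h1, h] at hk; exact (hk ⟨f₀, rfl⟩).elim
    · exact h.2
  -- the vertex before a polygon on the walk
  have hback : ∀ k f i, q k = .poly f i → ∃ l, q l = hK.nbEnd f ((finRotate _).symm i) ∧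
      p (q l) = .poly f i := by
    intro k f i hk
    obtain ⟨l, hl⟩ := hprev k
    refine ⟨l, ?_, by rw [← hl, hk]⟩
    rw [hk] at hl
    by_cases hlp : (q l).cell.IsPoly
    · obtain ⟨g, j, hgj⟩ := HatVertex.cell_isPoly_iff.1 hlp
      rw [hgj] at hl ⊢
      exact (hK.nbStart_eq_iff.1 hl.symm).symm
    · rw [hnon _ hlp] at hl
      cases hl
      obtain ⟨h1, h2⟩ := hqnon l hlp
      rw [h1, h2]
  have hsome : ∃ k, q k = .poly f₀ i₀ := by
    rcases hcase with h | h
    · rw [← h]; exact hq0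
    · obtain ⟨k, hk⟩ := hq0
      obtain ⟨l, hl⟩ := hnext k
      exact ⟨l, by rw [hl, hk, hnon _ h.1]⟩
  -- Being visited is inherited across edges at `v`: an edge leaving `v` leads to the next vertex of
  -- the walk, an edge arriving at `v` to the previous one.
  have hall : ∀ f i, HatVertex.poly f i ∈ starVerts C → ∃ k, q k = .poly f i := by
    intro f i hfi
    have hvi : (K.poly f).bd i = v := hfi.1
    have key : ∃ i k, q k = .poly f i := by
      refine InStar.induction (C := C) (Q := fun f => ∃ i k, q k = .poly f i) ?_
        (hy₀.2 f₀ rfl) (hfi.2 f rfl) ⟨i₀, hsome⟩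
      rintro f g hf hfg ⟨i, k, hk⟩ e ⟨⟨l, rfl⟩, ⟨j, hj⟩⟩ hv
      have hj : (K.poly f).edge l = (K.poly g).edge j := hj
      have hi : (K.poly f).bd i = v := by have := (hqS k).1; rw [hk] at this; exact this
      rcases Sym2.mem_iff.1 hv with h | h
      · have : i = l := (K.poly f).simple.injective (hi.trans h)
        subst this
        obtain ⟨m, hm⟩ := hnext k
        rw [hk, hpoly, hK.nbStart_eq hfg hj] at hm
        exact ⟨_, m, hm⟩
      · have : i = finRotate _ l := (K.poly f).simple.injective (hi.trans h)
        subst this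
        obtain ⟨m, hm, -⟩ := hback k _ _ hk
        rw [Equiv.symm_apply_apply, hK.nbEnd_eq hfg hj] at hm
        exact ⟨_, m, hm⟩
    obtain ⟨i', k, hk⟩ := key
    have hi' : (K.poly f).bd i' = v := by have := (hqS k).1; rw [hk] at this; exact this
    rw [(K.poly f).simple.injective (hvi.trans hi'.symm)]
    exact ⟨k, hk⟩
  refine ⟨N, q, ?_, hqinj, ?_⟩
  · -- the walk is neither constant nor of period two
    by_contra hlt
    obtain ⟨k, hk⟩ := hsome
    obtain ⟨l, hl, hlp⟩ := hback k _ _ hk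
    have hkn := hq k
    have hne : hK.nbStart f₀ i₀ ≠ .poly f₀ i₀ := by
      intro h
      have h' := congrArg HatVertex.cell h
      rw [cell_nbStart] at h'
      exact hK.across_ne f₀ i₀ h'
    have hne' : hK.nbEnd f₀ ((finRotate _).symm i₀) ≠ .poly f₀ i₀ := by
      intro h
      have h' := congrArg HatVertex.cell h
      rw [cell_nbEnd] at h'
      exact hK.across_ne f₀ _ h'
    rw [hk, hpoly] at hkn
    have h1 : finRotate N k ≠ k := fun h => hne (by rw [← hkn, h, hk])
    have h2 : l ≠ k := fun h => hne' (by rw [← hl, h, hk])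
    have h3 : finRotate N k = l := by
      have a := (finRotate N k).2
      have a' := l.2
      have a'' := k.2
      have b1 : ((finRotate N k : Fin N) : ℕ) ≠ k := fun h => h1 (Fin.ext h)
      have b2 : (l : ℕ) ≠ k := fun h => h2 (Fin.ext h)
      exact Fin.ext (by omega)
    -- With fewer than three steps, successor and predecessor of `f₀` coincide. The same cell would
    -- then lie across both edges of `f₀` at `v`, which `cell_unique` excludes.
    have h4 : hK.nbStart f₀ i₀ = hK.nbEnd f₀ ((finRotate _).symm i₀) := by
      rw [← hkn, h3, hl]
    have h5 := congrArg HatVertex.cell h4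
    rw [cell_nbStart, cell_nbEnd] at h5
    have h6 := hK.edge_mem_across f₀ i₀
    have h7 := hK.edge_mem_across f₀ ((finRotate _).symm i₀)
    rw [← h5] at h7
    refine hK.across_ne f₀ i₀ (hK.cell_unique (edge_mem_edges f₀ i₀) ?_ (Sym2.mem_mk_left _ _)
      (PolygonCell.mem_edge_symm i₀) h6 h7 ⟨i₀, rfl⟩ ⟨_, rfl⟩)
    intro h
    have := PolygonCell.edge_injective h
    apply finRotate_ne_self (K.poly f₀).simple.three_le i₀
    conv_lhs => rw [this]
    rw [Equiv.apply_symm_apply]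
  · ext E
    rw [hK.facet_ofVertex_iff]
    constructor
    · rintro ⟨f, i, hi, hf, rfl | rfl⟩
      · obtain ⟨k, hk⟩ := hall f i ⟨hi, fun g hg => by cases hg; exact hf⟩
        exact ⟨k, by rw [hq, hk, hpoly]⟩
      · obtain ⟨k, hk⟩ := hall f i ⟨hi, fun g hg => by cases hg; exact hf⟩
        obtain ⟨l, hl, hlp⟩ := hback k f i hk
        exact ⟨l, by rw [hq, hlp, hl, Sym2.eq_swap]⟩
    · rintro ⟨k, rfl⟩
      rw [hq]
      by_cases hkp : (q k).cell.IsPoly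
      · obtain ⟨f, i, hfi⟩ := HatVertex.cell_isPoly_iff.1 hkp
        have := hqS k
        rw [hfi] at this ⊢
        exact ⟨f, i, this.1, this.2 f rfl, Or.inl rfl⟩
      · obtain ⟨h1, h2⟩ := hqnon k hkp
        refine ⟨f₀, i₀, hy₀.1, hy₀.2 f₀ rfl, Or.inr ?_⟩
        rw [hnon _ hkp, h1, h2, Sym2.eq_swap]

variable {b : F → ℝ} (hb : K.IsOffsetChoice b)
include hb

/-- Nothing metric remains to be shown: a cycle of at least three distinct vertices in a drawing
without crossings is a simple polygon. -/
theorem exists_isDrawnAs_ofVertex {v : ℂ} (C : (K.starGraph v).ConnectedComponent) :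
    ∃ (n : ℕ) (q : Fin n → K.HatVertex), (HatCell.ofVertex v C).IsDrawnAs (K.place b) q := by
  obtain ⟨n, q, hn, hinj, hq⟩ := hK.exists_cycle C
  have hE : ∀ i, s(q i, q (finRotate n i)) ∈ (HatCell.ofVertex v C).facets := fun i =>
    hq ▸ ⟨i, rfl⟩
  have key : ∀ i j, i ≠ j → ∀ z ∈ segment ℝ (K.place b (q i)) (K.place b (q (finRotate n i))),
      z ∈ segment ℝ (K.place b (q j)) (K.place b (q (finRotate n j))) →
      (j = finRotate n i ∧ z = K.place b (q j)) ∨ (i = finRotate n j ∧ z = K.place b (q i)) := by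
    intro i j hij z hz hz'
    have hne : s(q i, q (finRotate n i)) ≠ s(q j, q (finRotate n j)) := by
      intro h
      rcases Sym2.eq_iff.1 h with ⟨h1, -⟩ | ⟨h1, h2⟩
      · exact hij (hinj h1)
      · have h1 := hinj h1
        have h2 := hinj h2
        rw [h1] at h2
        exact finRotate_finRotate_ne_self hn j h2
    obtain ⟨w, hw, hw', rfl⟩ := hK.seg_inter_seg hb (hE i) (hE j) hne hz hz'
    rcases Sym2.mem_iff.1 hw with rfl | rfl <;> rcases Sym2.mem_iff.1 hw' with h | h
    · exact (hij (hinj h)).elim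
    · exact Or.inr ⟨hinj h, rfl⟩
    · exact Or.inl ⟨(hinj h).symm, by rw [h]⟩
    · exact (hij ((finRotate n).injective (hinj h))).elim
  refine ⟨n, q, hq, hn, (hK.place_injective hb).comp hinj, ?_, ?_⟩
  · intro i
    rw [edgeSet_eq_segment, edgeSet_eq_segment]
    ext z
    constructor
    · rintro ⟨h1, h2⟩
      rcases key i (finRotate n i) (finRotate_ne_self hn i).symm z h1 h2 with ⟨-, h⟩ | ⟨h, -⟩
      · exact h
      · exact (finRotate_finRotate_ne_self hn i h.symm).elim
    · rintro rfl
      exact ⟨right_mem_segment ℝ _ _, left_mem_segment ℝ _ _⟩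
  · intro i j h1 h2 h3
    rw [edgeSet_eq_segment, edgeSet_eq_segment, disjoint_left]
    intro z hz hz'
    rcases key i j h1 z hz hz' with ⟨h, -⟩ | ⟨h, -⟩
    · exact h2 h
    · exact h3 h

end IsAdmissible
end Mesh

/-! ### Neighborhoods of vertices and the intersections of cells -/

/-- In polar coordinates the punctured disc is the image of a convex set. -/
theorem isPreconnected_ball_diff_center (v : ℂ) (r : ℝ) :
    IsPreconnected (Metric.ball v r \ {v}) := by
  have h : Metric.ball v r \ {v} =
      (fun p : ℝ × ℝ => v + p.1 * Complex.exp (p.2 * Complex.I)) '' (Ioo 0 r ×ˢ univ) := by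
    ext z
    constructor
    · rintro ⟨h1, h2⟩
      have h2 : z ≠ v := h2
      refine ⟨(‖z - v‖, Complex.arg (z - v)), ⟨⟨norm_pos_iff.2 (sub_ne_zero.2 h2), ?_⟩, trivial⟩, ?_⟩
      · rwa [Metric.mem_ball, dist_eq_norm] at h1
      · simp only
        rw [Complex.norm_mul_exp_arg_mul_I]; ring
    · rintro ⟨⟨ρ, θ⟩, ⟨⟨h1, h2⟩, -⟩, rfl⟩
      have h1 : 0 < ρ := h1
      have h2 : ρ < r := h2
      have hn : ‖(ρ : ℂ) * Complex.exp (θ * Complex.I)‖ = ρ := by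
        rw [norm_mul, Complex.norm_exp_ofReal_mul_I, Complex.norm_real, mul_one,
          Real.norm_of_nonneg h1.le]
      refine ⟨?_, fun h => ?_⟩
      · rw [Metric.mem_ball, dist_eq_norm, add_sub_cancel_left, hn]; exact h2
      · have : (ρ : ℂ) * Complex.exp (θ * Complex.I) = 0 := by
          have h : v + (ρ : ℂ) * Complex.exp (θ * Complex.I) = v := h
          linear_combination h
        rw [this, norm_zero] at hn
        exact h1.ne hn
  rw [h]
  exact (isPreconnected_Ioo.prod isPreconnected_univ).image _ (by fun_prop)

/-- The vertex itself moves into the interior when the polygon is offset a little. -/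
theorem PolygonCell.exists_inner_near {P : PolygonCell} (i : Fin P.n) {U : Set ℂ}
    (hU : U ∈ 𝓝 (P.bd i)) : ∃ z ∈ U, z ∈ P.inner := by
  obtain ⟨b, hb⟩ := P.simple.exists_isMiteredOffset
  have h1 : ∀ᶠ t in 𝓝 (0 : ℝ), offset P.bd t i ∈ U := by
    have := (P.simple.continuous_offset i).tendsto 0
    rw [P.simple.offset_zero] at this
    exact this hU
  have h2 : ∀ᶠ t in 𝓝[>] (0 : ℝ), t ∈ Ioo 0 b := Ioo_mem_nhdsGT hb.1
  obtain ⟨t, ht, ht'⟩ := ((h1.filter_mono nhdsWithin_le_nhds).and h2).exists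
  exact ⟨_, ht, P.simple.interior_of_mem_fill_offset P.ccw hb ht'.1 ht'.2.le
    (Or.inl (left_mem_boundary (offset P.bd t) i))⟩

namespace Mesh
variable {F H : Type*} {K : Mesh F H}
namespace IsAdmissible

variable [Finite F] [Finite H] (hK : K.IsAdmissible)
include hK

/-- A part of the star of `v` all of whose edges at `v` are shared by two polygons covers a
neighbourhood of `v`. -/
theorem star_mem_nhds {v : ℂ} {C : (K.starGraph v).ConnectedComponent}
    (hfull : ∀ f i, (K.poly f).bd i = v → InStar C f →
      (hK.across f i).IsPoly ∧ (hK.across f ((finRotate _).symm i)).IsPoly) :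
    {z | ∃ f, InStar C f ∧ z ∈ (K.poly f).region} ∈ 𝓝 v := by
  set U := {z | ∃ f, InStar C f ∧ z ∈ (K.poly f).region} with hU
  have hclosed : IsClosed U := by
    have : U = ⋃ f : {f // InStar C f}, (K.poly f.1).region := by ext z; simp [hU]
    rw [this]
    exact isClosed_iUnion_of_finite fun f => PolygonCell.isClosed_region
  -- In a small disc about `v` there are no vertices other than `v`, and only edges through `v`
  -- appear.
  have hev : ∀ᶠ y in 𝓝 v, ∀ f, ∀ k : Fin (K.poly f).n,
      (v ∉ segment ℝ ((K.poly f).bd k) ((K.poly f).bd (finRotate _ k)) →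
        y ∉ segment ℝ ((K.poly f).bd k) ((K.poly f).bd (finRotate _ k))) ∧
      (v ≠ (K.poly f).bd k → y ≠ (K.poly f).bd k) := by
    refine eventually_all.2 fun f => eventually_all.2 fun k => ?_
    refine Eventually.and ?_ ?_
    · by_cases h : v ∈ segment ℝ ((K.poly f).bd k) ((K.poly f).bd (finRotate _ k))
      · exact Eventually.of_forall fun y h' => (h' h).elim
      · have hc : IsClosed (segment ℝ ((K.poly f).bd k) ((K.poly f).bd (finRotate _ k))) := by
          rw [← convexHull_pair]
          exact ((Set.toFinite _).isCompact_convexHull (𝕜 := ℝ)).isClosed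
        filter_upwards [hc.isOpen_compl.mem_nhds h] with y hy _ using hy
    · by_cases h : v = (K.poly f).bd k
      · exact Eventually.of_forall fun y h' => (h' h).elim
      · filter_upwards [isOpen_ne.mem_nhds h] with y hy _ using hy
  obtain ⟨r, hr, hball⟩ := Metric.eventually_nhds_iff.1 hev
  -- Away from `v` a boundary point of a polygon of the part is inside an edge at `v`. This edge is
  -- shared by two polygons of the part, which together cover a neighbourhood.
  have hopen : ∀ y ∈ Metric.ball v r \ {v}, y ∈ U → U ∈ 𝓝 y := by
    rintro y ⟨hy, hyv⟩ ⟨f, hf, hyf⟩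
    have hyv : y ≠ v := hyv
    rcases PolygonCell.mem_region_iff.1 hyf with hbd | hin
    · obtain ⟨k, hk⟩ := mem_boundary_iff.1 hbd
      have hvk : v ∈ segment ℝ ((K.poly f).bd k) ((K.poly f).bd (finRotate _ k)) := by
        by_contra h; exact (hball hy f k).1 h hk
      have hne : ∀ l, y ≠ (K.poly f).bd l := fun l h =>
        if hl : v = (K.poly f).bd l then hyv (h.trans hl.symm) else (hball hy f l).2 hl h
      obtain ⟨i, hi⟩ := hf.1
      have hi : (K.poly f).bd i = v := hi
      have hp : (hK.across f k).IsPoly ∧ v ∈ (K.poly f).edge k := by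
        rcases (K.poly f).simple.vertex_mem_edge (hi.symm ▸ hvk) with h | h
        · subst h
          exact ⟨(hfull f i hi hf).1, hi ▸ Sym2.mem_mk_left _ _⟩
        · have := (hfull f i hi hf).2
          rw [h, Equiv.symm_apply_apply] at this
          refine ⟨this, ?_⟩
          rw [← hi, h]; exact Sym2.mem_mk_right _ _
      obtain ⟨g, j, hfg, he⟩ := hK.exists_of_isPoly hp.1
      refine mem_of_superset ((hK.meet f g hfg).union_mem_nhds he hk (hne _) (hne _)) ?_
      rintro z (hz | hz)
      · exact ⟨f, hf, hz⟩
      · exact ⟨g, hf.of_edge hfg he hp.2, hz⟩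
    · exact mem_of_superset (PolygonCell.isOpen_inner.mem_nhds hin) fun z hz =>
        ⟨f, hf, PolygonCell.mem_region_iff.2 (Or.inr hz)⟩
  obtain ⟨f, i, hi, hf⟩ := exists_inStar C
  obtain ⟨w, hw, hwi⟩ := PolygonCell.exists_inner_near i (hi.symm ▸ Metric.ball_mem_nhds v hr)
  have hwv : w ∈ Metric.ball v r \ {v} := ⟨hi ▸ hw, fun h => hwi.1 (by
    have h : w = v := h
    rw [h, ← hi]; exact left_mem_boundary _ i)⟩
  have hwU : w ∈ U := ⟨f, hf, PolygonCell.mem_region_iff.2 (Or.inr hwi)⟩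
  refine mem_of_superset (Metric.ball_mem_nhds v hr) fun y hy => ?_
  by_cases hyv : y = v
  · exact ⟨f, hf, hyv ▸ hi ▸ PolygonCell.boundary_subset_region (left_mem_boundary _ i)⟩
  -- `U` is open and closed in the connected punctured disc and contains the point `w` of it.
  have := eq_of_isPreconnected (isPreconnected_ball_diff_center v r) (f := (· ∈ U)) (by
    intro x hx
    by_cases hxU : x ∈ U
    · filter_upwards [mem_nhdsWithin_of_mem_nhds (hopen x hx hxU)] with z hz
      exact propext ⟨fun _ => hxU, fun _ => hz⟩
    · filter_upwards [mem_nhdsWithin_of_mem_nhds (hclosed.isOpen_compl.mem_nhds hxU)] with z hz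
      exact propext ⟨fun h => (hz h).elim, fun h => (hxU h).elim⟩) hwv ⟨hy, hyv⟩
  exact this.mp hwU

/-- If a further polygon touches `v`, then an undisplaced vertex belongs to the cell generated by
the part `C` of the star of `v`. -/
theorem exists_boundary_vertex {v : ℂ} {C : (K.starGraph v).ConnectedComponent} {g : F}
    (hv : v ∈ (K.poly g).verts) (hg : ¬ InStar C g) :
    ∃ x : K.HatVertex, ¬ x.cell.IsPoly ∧ x.base = v ∧
      ∃ E ∈ (HatCell.ofVertex v C).facets, x ∈ E := by
  by_cases hfull : ∀ f i, (K.poly f).bd i = v → InStar C f →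
      (hK.across f i).IsPoly ∧ (hK.across f ((finRotate _).symm i)).IsPoly
  · exfalso
    -- The part would cover a neighbourhood of `v`, whereas interior points of `g` come arbitrarily
    -- close to `v`.
    obtain ⟨j, rfl⟩ := hv
    obtain ⟨z, ⟨f, hf, hz⟩, hz'⟩ := PolygonCell.exists_inner_near j (hK.star_mem_nhds hfull)
    exact (hK.meet g f fun h => hg (h ▸ hf)).notMem_of_mem_inner hz' hz
  · push Not at hfull
    obtain ⟨f, i, hi, hf, h⟩ := hfull
    by_cases hp : (hK.across f i).IsPoly
    · refine ⟨hK.nbEnd f ((finRotate _).symm i), ?_, ?_, _,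
        hK.facet_ofVertex_iff.2 ⟨f, i, hi, hf, Or.inr rfl⟩, Sym2.mem_mk_right _ _⟩
      · rw [cell_nbEnd]; exact h hp
      · rw [base_nbEnd, Equiv.apply_symm_apply, hi]
    · refine ⟨hK.nbStart f i, ?_, ?_, _,
        hK.facet_ofVertex_iff.2 ⟨f, i, hi, hf, Or.inl rfl⟩, Sym2.mem_mk_right _ _⟩
      · rwa [cell_nbStart]
      · rw [base_nbStart, hi]

omit [Finite F] [Finite H] hK in
theorem _root_.EulerTransform.Mesh.HatCell.MeetInFace.symm {c d : K.HatCell}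
    {φ : K.HatVertex → ℂ} (h : c.MeetInFace d φ) : d.MeetInFace c φ := by
  unfold HatCell.MeetInFace at h ⊢
  rw [inter_comm (d.region φ), inter_comm d.facets]
  rcases h with h | ⟨x, h1, h2, h3⟩ | h
  · exact Or.inl h
  · exact Or.inr (Or.inl ⟨x, h2, h1, h3⟩)
  · exact Or.inr (Or.inr h)

omit [Finite F] [Finite H] hK in
theorem _root_.EulerTransform.Mesh.HatCell.meetInFace_of_vertex {c d : K.HatCell}
    {φ : K.HatVertex → ℂ} {x : K.HatVertex} (hc : ∃ E ∈ c.facets, x ∈ E)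
    (hd : ∃ E ∈ d.facets, x ∈ E) (h : ∀ z ∈ c.region φ, z ∈ d.region φ → z = φ x) :
    c.MeetInFace d φ := by
  refine Or.inr (Or.inl ⟨x, hc, hd, Subset.antisymm (fun z hz => h z hz.1 hz.2) ?_⟩)
  rintro z rfl
  exact ⟨HatCell.mem_region_of_facet hc, HatCell.mem_region_of_facet hd⟩

omit [Finite F] [Finite H] hK in
theorem _root_.EulerTransform.Mesh.HatCell.meetInFace_of_edge {c d : K.HatCell}
    {φ : K.HatVertex → ℂ} {E : Sym2 K.HatVertex} (hc : E ∈ c.facets) (hd : E ∈ d.facets)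
    (h : ∀ z ∈ c.region φ, z ∈ d.region φ → z ∈ seg φ E) : c.MeetInFace d φ :=
  Or.inr (Or.inr ⟨E, ⟨hc, hd⟩, Subset.antisymm (fun z hz => h z hz.1 hz.2)
    (subset_inter (HatCell.seg_subset_region hc) (HatCell.seg_subset_region hd))⟩)

omit [Finite F] [Finite H] hK in
theorem _root_.EulerTransform.Mesh.HatCell.meetInFace_of_disjoint {c d : K.HatCell}
    {φ : K.HatVertex → ℂ} (h : ∀ z ∈ c.region φ, z ∉ d.region φ) : c.MeetInFace d φ :=
  Or.inl (eq_empty_of_forall_notMem fun z hz => h z hz.1 hz.2)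

/-- There is just one new edge across an edge at each of its ends. -/
theorem newEdges_unique {e : Sym2 ℂ} (he : e ∈ K.edges) {v : ℂ} {E E' : Sym2 K.HatVertex}
    (hE : E ∈ K.newEdges e v) (hE' : E' ∈ K.newEdges e v) : E = E' := by
  obtain ⟨f, i, rfl⟩ := mem_edges_iff.1 he
  obtain ⟨-, x, y, hx, hy, hxy, hex, hey, rfl⟩ := hE
  obtain ⟨-, x', y', hx', hy', hxy', hex', hey', rfl⟩ := hE'
  have key : ∀ z w : K.HatVertex, z.base = v → w.base = v → z.cell = w.cell → z = w :=
    fun z w h1 h2 h3 => HatVertex.ext_cell_base h3 (h1.trans h2.symm)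
  rw [hK.mem_cellEdges_iff] at hex hey hex' hey'
  rcases hex with a | a <;> rcases hey with a' | a' <;> rcases hex' with c | c <;>
    rcases hey' with c' | c' <;>
    first
    | exact (hxy (a.trans a'.symm)).elim
    | exact (hxy' (c.trans c'.symm)).elim
    | rw [key x x' hx hx' (a.trans c.symm), key y y' hy hy' (a'.trans c'.symm)]
    | rw [key x y' hx hy' (a.trans c'.symm), key y x' hy hx' (a'.trans c.symm), Sym2.eq_swap]

theorem start_mem_newEdges (f : F) (i : Fin (K.poly f).n) :
    s(.poly f i, hK.nbStart f i) ∈ K.newEdges ((K.poly f).edge i) ((K.poly f).bd i) :=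
  ⟨Sym2.mem_mk_left _ _, .poly f i, _, rfl, hK.base_nbStart f i,
    by rw [cell_nbStart]; exact (hK.across_ne f i).symm, ⟨i, rfl⟩,
    by rw [cell_nbStart]; exact hK.edge_mem_across f i, rfl⟩

theorem end_mem_newEdges (f : F) (i : Fin (K.poly f).n) :
    s(.poly f (finRotate _ i), hK.nbEnd f i) ∈
      K.newEdges ((K.poly f).edge i) ((K.poly f).bd (finRotate _ i)) :=
  ⟨Sym2.mem_mk_right _ _, .poly f _, _, rfl, hK.base_nbEnd f i,
    by rw [cell_nbEnd]; exact (hK.across_ne f i).symm, ⟨i, rfl⟩,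
    by rw [cell_nbEnd]; exact hK.edge_mem_across f i, rfl⟩

theorem exists_newEdge {f : F} {i : Fin (K.poly f).n} {v : ℂ} (hv : v ∈ (K.poly f).edge i) :
    ∃ E ∈ K.newEdges ((K.poly f).edge i) v,
      (∀ C : (K.starGraph v).ConnectedComponent, InStar C f → E ∈ (HatCell.ofVertex v C).facets) ∧
      ∀ b, ¬ (hK.across f i).IsPoly → v ∈ seg (K.place b) E := by
  rcases Sym2.mem_iff.1 hv with rfl | rfl
  · refine ⟨_, hK.start_mem_newEdges f i, fun C hC => ?_, fun b hp => ?_⟩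
    · exact hK.facet_ofVertex_iff.2 ⟨f, i, rfl, hC, Or.inl rfl⟩
    · have := mem_seg_of_mem (K.place b) (Sym2.mem_mk_right (HatVertex.poly f i) (hK.nbStart f i))
      rwa [hK.place_nbStart hp] at this
  · refine ⟨_, hK.end_mem_newEdges f i, fun C hC => ?_, fun b hp => ?_⟩
    · refine hK.facet_ofVertex_iff.2 ⟨f, _, rfl, hC, Or.inr ?_⟩
      rw [Equiv.symm_apply_apply]
    · have := mem_seg_of_mem (K.place b)
        (Sym2.mem_mk_right (HatVertex.poly f (finRotate _ i)) (hK.nbEnd f i))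
      rwa [hK.place_nbEnd hp] at this

variable {b : F → ℝ} (hb : K.IsOffsetChoice b)
include hb

theorem newEdge_of_corner_mid {f : F} {i j : Fin (K.poly f).n} {z : ℂ}
    (h1 : z ∈ hK.corner b f i) (h2 : z ∈ hK.midPiece b f j) :
    ∃ E ∈ K.newEdges ((K.poly f).edge j) ((K.poly f).bd i), z ∈ seg (K.place b) E := by
  rcases hK.corner_inter_mid hb h1 h2 with ⟨rfl, h⟩ | ⟨rfl, h⟩
  · exact ⟨_, hK.start_mem_newEdges f j, h⟩
  · exact ⟨_, hK.end_mem_newEdges f j, h⟩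

/-- The cells generated by an edge and by a vertex meet in the new edge across the edge at the
vertex, or in the vertex itself. -/
theorem vertexZone_inter_edgeZone {v : ℂ} {C : (K.starGraph v).ConnectedComponent} {e : Sym2 ℂ}
    {z : ℂ} (h1 : z ∈ hK.vertexZone b v C) (h2 : z ∈ hK.edgeZone b e) :
    (∃ f i, InStar C f ∧ (K.poly f).edge i = e ∧ ∃ E ∈ K.newEdges e v, z ∈ seg (K.place b) E) ∨
    (z = v ∧ v ∈ e ∧ ∃ g j, (K.poly g).edge j = e ∧ ¬ (hK.across g j).IsPoly) := by
  obtain ⟨f, i, rfl, hf, h1⟩ := h1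
  obtain ⟨g, j, rfl, h2⟩ := h2
  by_cases hfg : f = g
  · subst hfg
    exact Or.inl ⟨f, j, hf, rfl, hK.newEdge_of_corner_mid hb h1 h2⟩
  rcases hK.corner_inter_mid' hb hfg h1 h2 with ⟨k, hk, h3⟩ | ⟨h3, h4, h5⟩
  · exact Or.inl ⟨f, k, hf, hk, hk ▸ hK.newEdge_of_corner_mid hb h1 h3⟩
  · exact Or.inr ⟨h3, h3 ▸ h4, g, j, rfl, h5⟩

/-! ### Intersections of the cells of the three classes -/

theorem meet_ofPoly_ofEdge (f : F) {e : Sym2 ℂ} (he : e ∈ K.edges) :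
    (HatCell.ofPoly f).MeetInFace (HatCell.ofEdge e he) (K.place b) := by
  by_cases h : ∃ i, (K.poly f).edge i = e
  · obtain ⟨i, rfl⟩ := h
    refine HatCell.meetInFace_of_edge (E := s(.poly f (finRotate _ i), .poly f i)) ?_ ?_ ?_
    · rw [facets_ofPoly]; exact ⟨i, Sym2.eq_swap⟩
    · rw [hK.facets_ofEdge]; exact hK.mem_cycleEdges_quad.2 (Or.inr (Or.inr (Or.inl rfl)))
    · intro z hz hz'
      rw [region_ofPoly] at hz
      obtain ⟨g, j, hj, hg⟩ := hK.region_ofEdge_subset hb hz'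
      by_cases hfg : f = g
      · subst hfg
        rw [PolygonCell.edge_injective hj] at hg
        rw [Sym2.eq_swap]
        exact hK.core_inter_mid hb hz hg
      · exact (hK.core_inter_region hb hfg hz (hK.midPiece_subset_region hb hg)).elim
  · refine HatCell.meetInFace_of_disjoint fun z hz hz' => ?_
    rw [region_ofPoly] at hz
    obtain ⟨g, j, hj, hg⟩ := hK.region_ofEdge_subset hb hz'
    by_cases hfg : f = g
    · subst hfg; exact h ⟨j, hj⟩
    · exact hK.core_inter_region hb hfg hz (hK.midPiece_subset_region hb hg)

theorem meet_ofPoly_ofVertex (f : F) {v : ℂ} (C : (K.starGraph v).ConnectedComponent) :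
    (HatCell.ofPoly f).MeetInFace (HatCell.ofVertex v C) (K.place b) := by
  by_cases h : InStar C f
  · obtain ⟨i, hi⟩ := h.1
    have hi : (K.poly f).bd i = v := hi
    refine HatCell.meetInFace_of_vertex (x := .poly f i) (facet_ofPoly_iff.2 rfl)
      ⟨_, hK.facet_ofVertex_iff.2 ⟨f, i, hi, h, Or.inl rfl⟩, Sym2.mem_mk_left _ _⟩ ?_
    intro z hz hz'
    rw [region_ofPoly] at hz
    obtain ⟨g, j, hj, hg, hz'⟩ := hK.region_ofVertex_subset hb hz'
    by_cases hfg : f = g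
    · subst hfg
      rw [(K.poly f).simple.injective (hj.trans hi.symm)] at hz'
      exact hK.core_inter_corner hb hz hz'
    · exact (hK.core_inter_region hb hfg hz (hK.corner_subset_region hb hz')).elim
  · refine HatCell.meetInFace_of_disjoint fun z hz hz' => ?_
    rw [region_ofPoly] at hz
    obtain ⟨g, j, hj, hg, hz'⟩ := hK.region_ofVertex_subset hb hz'
    by_cases hfg : f = g
    · subst hfg; exact h hg
    · exact hK.core_inter_region hb hfg hz (hK.corner_subset_region hb hz')

/-- Every common point is a placed vertex belonging to both cells. Two distinct edges share at most
one end and, at this end, at most one cell, so there is only one such vertex. -/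
theorem meet_ofEdge_ofEdge {e e' : Sym2 ℂ} (he : e ∈ K.edges) (he' : e' ∈ K.edges)
    (hne : e ≠ e') : (HatCell.ofEdge e he).MeetInFace (HatCell.ofEdge e' he') (K.place b) := by
  have key : ∀ z ∈ (HatCell.ofEdge e he).region (K.place b),
      z ∈ (HatCell.ofEdge e' he').region (K.place b) → ∃ x : K.HatVertex, z = K.place b x ∧
        (x.base ∈ e ∧ e ∈ K.cellEdges x.cell) ∧ (x.base ∈ e' ∧ e' ∈ K.cellEdges x.cell) := by
    intro z hz hz'
    have h1 := hK.region_ofEdge_subset hb hz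
    have h2 := hK.region_ofEdge_subset hb hz'
    obtain ⟨x, rfl⟩ := hK.edgeZone_inter_edgeZone hb hne h1 h2
    exact ⟨x, rfl, hK.facet_of_edgeZone hb h1, hK.facet_of_edgeZone hb h2⟩
  by_cases h : ∃ z ∈ (HatCell.ofEdge e he).region (K.place b),
      z ∈ (HatCell.ofEdge e' he').region (K.place b)
  · obtain ⟨z, hz, hz'⟩ := h
    obtain ⟨x, -, hx, hx'⟩ := key z hz hz'
    refine HatCell.meetInFace_of_vertex (x := x) (hK.facet_ofEdge_iff.2 hx)
      (hK.facet_ofEdge_iff.2 hx') fun w hw hw' => ?_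
    obtain ⟨y, rfl, hy, hy'⟩ := key w hw hw'
    rw [hK.eq_of_facet_facet he hne hx.1 hx'.1 hy.1 hy'.1 hx.2 hx'.2 hy.2 hy'.2]
  · push Not at h
    exact HatCell.meetInFace_of_disjoint h

/-- If `e` is an edge at `v` of a polygon of the part, the cells share the new edge across `e` at
`v`. Otherwise they can only touch at `v`, where `e` then belongs to a different part of the star;
the common vertex is the undisplaced copy of `v`. -/
theorem meet_ofVertex_ofEdge {v : ℂ} (C : (K.starGraph v).ConnectedComponent) {e : Sym2 ℂ}
    (he : e ∈ K.edges) : (HatCell.ofVertex v C).MeetInFace (HatCell.ofEdge e he) (K.place b) := by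
  by_cases h : v ∈ e ∧ ∃ f i, InStar C f ∧ (K.poly f).edge i = e
  · obtain ⟨hv, f, i, hf, rfl⟩ := h
    obtain ⟨E, hE, hE1, hE2⟩ := hK.exists_newEdge hv
    refine HatCell.meetInFace_of_edge (E := E) (hE1 C hf) (Or.inr (mem_iUnion.2 ⟨v, hE⟩)) ?_
    intro z hz hz'
    rcases hK.vertexZone_inter_edgeZone hb (hK.region_ofVertex_subset hb hz)
      (hK.region_ofEdge_subset hb hz') with ⟨-, -, -, -, E', hE', h⟩ | ⟨rfl, -, g, j, hj, hp⟩
    · rwa [hK.newEdges_unique he hE hE']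
    · obtain ⟨E', hE', -, h⟩ := hK.exists_newEdge (f := g) (i := j) (v := z) (hj ▸ hv)
      rw [hj] at hE'
      rw [hK.newEdges_unique he hE hE']
      exact h b hp
  · have key : ∀ z ∈ (HatCell.ofVertex v C).region (K.place b),
        z ∈ (HatCell.ofEdge e he).region (K.place b) →
        z = v ∧ v ∈ e ∧ ∃ g j, (K.poly g).edge j = e ∧ ¬ (hK.across g j).IsPoly := by
      intro z hz hz'
      refine (hK.vertexZone_inter_edgeZone hb (hK.region_ofVertex_subset hb hz)
        (hK.region_ofEdge_subset hb hz')).resolve_left ?_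
      rintro ⟨f, i, hf, hi, E, hE, -⟩
      exact h ⟨hE.1, f, i, hf, hi⟩
    by_cases hne : ∃ z ∈ (HatCell.ofVertex v C).region (K.place b),
        z ∈ (HatCell.ofEdge e he).region (K.place b)
    · obtain ⟨z, hz, hz'⟩ := hne
      obtain ⟨-, hv, g, j, rfl, hp⟩ := key z hz hz'
      have hvg : v ∈ (K.poly g).verts := by
        rcases Sym2.mem_iff.1 hv with rfl | rfl <;> exact mem_range_self _
      obtain ⟨x, hx, hxv, hxE⟩ := hK.exists_boundary_vertex hvg fun hg => h ⟨hv, g, j, hg, rfl⟩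
      have hxc : x.cell = hK.across g j := hK.eq_of_not_isPoly hx hp
        (hxv ▸ x.base_mem_cellRegion) (mem_cellRegion_of_mem_edge (hK.edge_mem_across g j) hv)
      refine HatCell.meetInFace_of_vertex (x := x) hxE (hK.facet_ofEdge_iff.2 ⟨hxv ▸ hv, ?_⟩) ?_
      · rw [hxc]; exact hK.edge_mem_across g j
      · intro w hw hw'
        rw [HatVertex.place_of_not_isPoly hx, hxv]
        exact (key w hw hw').1
    · push Not at hne
      exact HatCell.meetInFace_of_disjoint hne

/-- Corners at distinct vertices are disjoint. Two parts of the star of the same vertex share no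
edge there, so their cells meet exactly in the undisplaced copy of that vertex, which belongs to
both. -/
theorem meet_ofVertex_ofVertex {v v' : ℂ} (C : (K.starGraph v).ConnectedComponent)
    (C' : (K.starGraph v').ConnectedComponent)
    (hne : HatCell.ofVertex v C ≠ HatCell.ofVertex v' C') :
    (HatCell.ofVertex v C).MeetInFace (HatCell.ofVertex v' C') (K.place b) := by
  by_cases hv : v = v'
  · subst hv
    have hC : C ≠ C' := fun h => hne (by rw [h])
    obtain ⟨f, i, hi, hf⟩ := exists_inStar C
    obtain ⟨g, j, hj, hg⟩ := exists_inStar C'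
    obtain ⟨x, hx, hxv, hxE⟩ := hK.exists_boundary_vertex ⟨j, hj⟩ fun h => hC (h.eq hg)
    obtain ⟨y, hy, hyv, hyE⟩ := hK.exists_boundary_vertex ⟨i, hi⟩ fun h => hC (hf.eq h)
    rw [← hK.vertex_eq_of_not_isPoly hx hy (hxv.trans hyv.symm)] at hyE
    refine HatCell.meetInFace_of_vertex hxE hyE fun z hz hz' => ?_
    rw [HatVertex.place_of_not_isPoly hx, hxv]
    obtain ⟨f, i, hi, hf, hz⟩ := hK.region_ofVertex_subset hb hz
    obtain ⟨g, j, hj, hg, hz'⟩ := hK.region_ofVertex_subset hb hz'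
    have hfg : f ≠ g := fun h => hC (hf.eq (h ▸ hg))
    rcases (hK.corner_inter_corner' hb hfg hz hz').2 with h | ⟨e, ⟨⟨k, rfl⟩, ⟨l, hl⟩⟩, h⟩
    · exact h.trans hi
    · exact (hC ((hf.of_edge hfg hl (hi ▸ h)).eq hg)).elim
  · refine HatCell.meetInFace_of_disjoint fun z hz hz' => hv ?_
    obtain ⟨f, i, hi, hf, hz⟩ := hK.region_ofVertex_subset hb hz
    obtain ⟨g, j, hj, hg, hz'⟩ := hK.region_ofVertex_subset hb hz'
    by_cases hfg : f = g
    · subst hfg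
      rw [← hi, ← hj, hK.corner_inter_corner hb hz hz']
    · rw [← hi, ← hj, (hK.corner_inter_corner' hb hfg hz hz').1]

theorem isRealization : K.IsRealization (K.place b) where
  simple := by
    rintro (f | ⟨e, he⟩ | ⟨v, C⟩)
    · exact ⟨_, _, isDrawnAs_ofPoly hb f⟩
    · obtain ⟨q, hq, -⟩ := hK.exists_quad hb he
      exact ⟨4, q, hq⟩
    · exact hK.exists_isDrawnAs_ofVertex hb C
  meet := by
    rintro (f | ⟨e, he⟩ | ⟨v, C⟩) (g | ⟨e', he'⟩ | ⟨v', C'⟩) hne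
    · refine HatCell.meetInFace_of_disjoint fun z hz hz' => ?_
      rw [region_ofPoly] at hz hz'
      exact hK.core_inter_region hb (fun h => hne (by rw [h])) hz
        (PolygonCell.mem_region_iff.2 (Or.inr (core_subset_inner hb hz')))
    · exact hK.meet_ofPoly_ofEdge hb f he'
    · exact hK.meet_ofPoly_ofVertex hb f C'
    · exact (hK.meet_ofPoly_ofEdge hb g he).symm
    · exact hK.meet_ofEdge_ofEdge hb he he' fun h => hne (by subst h; rfl)
    · exact (hK.meet_ofVertex_ofEdge hb C' he).symm
    · exact (hK.meet_ofPoly_ofVertex hb g C).symm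
    · exact hK.meet_ofVertex_ofEdge hb C he'
    · exact hK.meet_ofVertex_ofVertex hb C C' hne

end IsAdmissible
end Mesh
end EulerTransform
end

theorem mainTheorem3 {F H : Type*} [Finite F] [Finite H] (K : EulerTransform.Mesh F H)
    (hK : K.IsAdmissible) :
    EulerTransform.IsPlanar K.hatGraph ∧
    (∃ b, K.IsOffsetChoice b) ∧
    ∀ b, K.IsOffsetChoice b →
      K.IsRealization (K.place b) ∧
      EulerTransform.IsPlaneDrawing K.hatGraph (K.place b) (EulerTransform.seg (K.place b)) ∧
      ∀ (e : Sym2 ℂ) (he : e ∈ K.edges),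
        ∃ q : Fin 4 → K.HatVertex,
          (EulerTransform.Mesh.HatCell.ofEdge e he).IsDrawnAs (K.place b) q ∧
          ConvexIndependent ℝ (fun i => K.place b (q i)) ∧
          Convex ℝ ((EulerTransform.Mesh.HatCell.ofEdge e he).region (K.place b)) := by
  choose b hb using fun f => (K.poly f).simple.exists_isMiteredOffset
  exact ⟨⟨_, _, hK.isPlaneDrawing (b := b) hb⟩, ⟨b, hb⟩, fun b hb =>
    ⟨hK.isRealization hb, hK.isPlaneDrawing hb, fun e he => hK.exists_quad hb he⟩⟩
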